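/- Let $n\ge 3$, $r=\lfloor (n+2)/2\rfloor$, and let $\nu=0$ if $n$ is even, $\nu=1$ if $n$ is odd. Let $\mathfrak g$ be the complexification of $\mathfrak{so}(2,n)$, with generators $M_{ab}=-M_{ba}$ ($-1\le a,b\le n$) satisfying $[M_{ab},M_{cd}]=\eta_{ad}M_{bc}+\eta_{bc}M_{ad}-\eta_{ac}M_{bd}-\eta_{bd}M_{ac}$, $\eta=\mathrm{diag}(1,1,-1,\dots,-1)$. Let $\mathfrak k=\mathfrak{so}(2)\oplus\mathfrak{so}(n)$ be its (complexified) maximal compact subalgebra and $H_1=-iM_{-1,0}$, $H_j=iM_{2j-3,2j-2}$ ($2\le j\le r$) the basis of the Cartan subalgebra in which weights $(\lambda_1,\dots,\lambda_r)$ are written; with $(e_j)$ the dual basis, the positive roots are $e_j\pm e_k$ ($1\le j<k\le r$) and, for $n$ odd, also $e_j$ ($1\le j\le r$). Let $\mathfrak p^+$ be the span of the root vectors of the positive noncompact roots (those involving $e_1$). Write $K(\mu)=\chi(\mu_1)\otimes\pi(\mu_2,\dots,\mu_r)$ for the irreducible $\mathfrak k$-module with highest weight $\mu$, $N(\mu)=U(\mathfrak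 g)\otimes_{U(\mathfrak k+\mathfrak p^+)}K(\mu)$ for the induced highest weight module ($\mathfrak p^+$ acting on $K(\mu)$ by $0$), and $L(\mu)$ for its irreducible quotient, which carries the representation denoted $D(-\mu_1,\mu_2,\dots,\mu_r)$. For a real number $E_0$ let $\lambda=(-E_0,\frac12,\dots,\frac12)$. 1. If $E_0>\frac{n-1}{2}$, then $N(\lambda)$ is irreducible (so that $D(E_0,\frac12,\dots,\frac12)$ is carried by $N(\lambda)=L(\lambda)$), and $$D(E_0,\tfrac12,\dots,\tfrac12)\big|_{\mathfrak k}\;\cong\;\bigoplus_{l,k=0}^{\infty}\chi\bigl(-[E_0+l+2k]\bigr)\otimes\pi\bigl(\tfrac12+l,\tfrac12,\dots,\tfrac12\bigr)\;\oplus\;\bigoplus_{l,k=0}^{\infty}\chi\bigl(-[E_0+l+2k+1]\bigr)\otimes\pi\bigl(\tfrac12+l,\tfrac12,\dots,\tfrac12,\nu-\tfrac12\bigr),$$ where for $n=3$ both $\pi(\dots)$ mean $\pi(\frac12+l)$. 2. If $E_0=\frac{n-1}{2}$, then $N(\lambda)$ is not simple. It has a unique maximal proper submodule, which contains every proper submodule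 and is isomorphic to $L(-\frac{n+1}{2},\frac12,\dots,\frac12,\nu-\frac12)$; the latter is irreducible and unitarizable (it admits a positive definite Hermitian form for which $\mathfrak{so}(2,n)$ acts by skew-Hermitian operators), i.e. it carries the unitary irreducible representation $D(\frac{n+1}{2},\frac12,\dots,\frac12,\nu-\frac12)$. The quotient of $N(\lambda)$ by this submodule is isomorphic to $L(-\frac{n-1}{2},\frac12,\dots,\frac12)$, i.e. it carries the irreducible representation $D(\frac{n-1}{2},\frac12,\dots,\frac12)$. -/

import Mathlib

open scoped TensorProduct DirectSum

noncomputable section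

attribute [local instance 100] LieRing.ofAssociativeRing

namespace ConformalSpin

section Generic

variable {L : Type} [LieRing L] [LieAlgebra ℂ L]

/-- A left module over the enveloping algebra is a module over the Lie algebra:
`⁅x, m⁆ = ι x • m`. -/
@[reducible] def lieRingModuleOfEnveloping (M : Type) [AddCommGroup M]
    [Module (UniversalEnvelopingAlgebra ℂ L) M] : LieRingModule L M where
  bracket x m := UniversalEnvelopingAlgebra.ι ℂ x • m
  add_lie x y m := by simp only [map_add, add_smul]
  lie_add x m m' := by simp only [smul_add]
  leibniz_lie x y m := by
    simp only [LieHom.map_lie, LieRing.of_associative_ring_bracket, sub_smul, mul_smul]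
    abel

theorem lieModuleOfEnveloping (M : Type) [AddCommGroup M] [Module ℂ M]
    [Module (UniversalEnvelopingAlgebra ℂ L) M]
    [IsScalarTower ℂ (UniversalEnvelopingAlgebra ℂ L) M] :
    let _ : LieRingModule L M := lieRingModuleOfEnveloping M
    LieModule ℂ L M := by
  let _ : LieRingModule L M := lieRingModuleOfEnveloping M
  have hb : ∀ (x : L) (m : M), ⁅x, m⁆ = UniversalEnvelopingAlgebra.ι ℂ x • m := fun _ _ => rfl
  refine ⟨fun t x m => ?_, fun t x m => ?_⟩
  · rw [hb, hb, map_smul, smul_assoc]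
  · rw [hb, hb, ← algebraMap_smul (UniversalEnvelopingAlgebra ℂ L) t m,
      ← algebraMap_smul (UniversalEnvelopingAlgebra ℂ L) t
        (UniversalEnvelopingAlgebra.ι ℂ x • m), smul_smul, smul_smul, Algebra.commutes]

/-- The sum of all proper submodules. For a highest weight module it is the unique maximal
proper submodule, and the quotient by it is the unique irreducible quotient. -/
def sumOfProper (L M : Type) [LieRing L] [LieAlgebra ℂ L] [AddCommGroup M] [Module ℂ M]
    [LieRingModule L M] [LieModule ℂ L M] : LieSubmodule ℂ L M :=
  sSup {W : LieSubmodule ℂ L M | W ≠ ⊤}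

end Generic

/-- The complexification of `so(2,n)`: complex matrices `A` with `Aᵀ η + η A = 0`, where
`η = diag(1, 1, -1, …, -1)`. The indices `-1, 0` are `inl 0, inl 1`, and the index
`a ∈ {1, …, n}` is `inr (a - 1)`. -/
abbrev so2 (n : ℕ) : LieSubalgebra ℂ (Matrix (Fin 2 ⊕ Fin n) (Fin 2 ⊕ Fin n) ℂ) :=
  LieAlgebra.Orthogonal.so' (Fin 2) (Fin n) ℂ

/-- The real form `so(2,n)` inside its complexification. -/
def IsRealElement {n : ℕ} (x : so2 n) : Prop := ∀ a b, (x.1 a b).im = 0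

/-- The diagonal entries of `η`. -/
def etaDiag (n : ℕ) : Fin 2 ⊕ Fin n → ℂ := Sum.elim (fun _ => 1) (fun _ => -1)

/-- The infinitesimal rotation `u ∧ v : x ↦ u η(v, x) - v η(u, x)`. -/
def wedge {n : ℕ} (u v : Fin 2 ⊕ Fin n → ℂ) : so2 n :=
  ⟨Matrix.of fun a b => (u a * v b - v a * u b) * etaDiag n b, by
    have h : LieAlgebra.Orthogonal.indefiniteDiagonal (Fin 2) (Fin n) ℂ
        = Matrix.diagonal (etaDiag n) := rfl
    rw [so2, LieAlgebra.Orthogonal.so', mem_skewAdjointMatricesLieSubalgebra,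
      mem_skewAdjointMatricesSubmodule, h]
    ext a b
    simp only [Matrix.mul_diagonal, Matrix.diagonal_mul, Matrix.transpose_apply,
      Matrix.neg_apply, Matrix.of_apply]
    ring⟩

/-- The coordinate vectors of `ℂ^{n+2}`. -/
def coordVec {n : ℕ} (a : Fin 2 ⊕ Fin n) : Fin 2 ⊕ Fin n → ℂ := Pi.single a 1

/-- The generators `M_{ab} = e_a ∧ e_b`. -/
def genM {n : ℕ} (a b : Fin 2 ⊕ Fin n) : so2 n := wedge (coordVec a) (coordVec b)

/-- The complexified maximal compact subalgebra `so(2) ⊕ so(n)`: block diagonal matrices. -/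
def compactK (n : ℕ) : LieSubalgebra ℂ (so2 n) where
  carrier := {x | (∀ i j, x.1 (Sum.inl i) (Sum.inr j) = 0) ∧
    (∀ i j, x.1 (Sum.inr i) (Sum.inl j) = 0)}
  add_mem' := by
    rintro x y ⟨hx, hx'⟩ ⟨hy, hy'⟩
    exact ⟨fun i j => by simp [hx, hy], fun i j => by simp [hx', hy']⟩
  zero_mem' := ⟨fun i j => rfl, fun i j => rfl⟩
  smul_mem' := by
    rintro c x ⟨hx, hx'⟩
    exact ⟨fun i j => by simp [hx], fun i j => by simp [hx']⟩
  lie_mem' := by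
    rintro x y ⟨hx, hx'⟩ ⟨hy, hy'⟩
    constructor <;> intro i j <;>
      simp [LieRing.of_associative_ring_bracket, Matrix.mul_apply, hx, hx', hy, hy']

/-- The compact generator `M_{-1,0}`, which spans `so(2)`. -/
def rotTime (n : ℕ) : compactK n :=
  ⟨genM (Sum.inl 0) (Sum.inl 1), by
    constructor <;> intro i j <;> simp [genM, wedge, coordVec]⟩

/-- `u ∧ v` for `u, v` in the span of `e_1, …, e_n`; these elements span `so(n)`. -/
def wedgeSpace {n : ℕ} (u v : Fin n → ℂ) : compactK n :=
  ⟨wedge (Sum.elim 0 u) (Sum.elim 0 v), by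
    constructor <;> intro i j <;> simp [wedge]⟩

/-- The position `2i` (counted from zero) among `e_1, …, e_n`. -/
def evenIdx {n : ℕ} (i : Fin (n / 2)) : Fin n := ⟨2 * i.1, by omega⟩

/-- The position `2i + 1` (counted from zero) among `e_1, …, e_n`. -/
def oddIdx {n : ℕ} (i : Fin (n / 2)) : Fin n := ⟨2 * i.1 + 1, by omega⟩

/-- The basis `H_1, …, H_r`, `r = n / 2 + 1`, of the Cartan subalgebra:
`H_1 = -i M_{-1,0}` and `H_j = i M_{2j-3,2j-2}` for `2 ≤ j ≤ r`. -/
def cartanH (n : ℕ) : Fin (n / 2 + 1) → compactK n :=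
  Fin.cons (-Complex.I • rotTime n)
    (fun i => Complex.I • wedgeSpace (Pi.single (evenIdx i) 1) (Pi.single (oddIdx i) 1))

/-- The isotropic vectors `e_{2j-3} + i e_{2j-2}` (weight `e_j`), with `j = i + 2`. -/
def isoPos {n : ℕ} (i : Fin (n / 2)) : Fin n → ℂ :=
  Pi.single (evenIdx i) 1 + Pi.single (oddIdx i) Complex.I

/-- The isotropic vectors `e_{2j-3} - i e_{2j-2}` (weight `-e_j`), with `j = i + 2`. -/
def isoNeg {n : ℕ} (i : Fin (n / 2)) : Fin n → ℂ :=
  Pi.single (evenIdx i) 1 - Pi.single (oddIdx i) Complex.I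

/-- The vector `e_n` of weight zero if `n` is odd, and `0` if `n` is even. -/
def isoZero (n : ℕ) : Fin n → ℂ := fun a => if Odd n ∧ a.1 + 1 = n then 1 else 0

/-- Root vectors of the positive compact roots `e_j ± e_k` (`2 ≤ j < k ≤ r`) and, for odd `n`,
`e_j` (`2 ≤ j ≤ r`). -/
def posCompact (n : ℕ) : Set (compactK n) :=
  {x | ∃ i j : Fin (n / 2), i < j ∧
      (x = wedgeSpace (isoPos i) (isoPos j) ∨ x = wedgeSpace (isoPos i) (isoNeg j))} ∪
    {x | ∃ i : Fin (n / 2), x = wedgeSpace (isoPos i) (isoZero n)}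

/-- The noncompact positive root vectors: `X_{1,k} = (e_{-1} + i e_0) ∧ e_k`, `1 ≤ k ≤ n`,
whose span is `𝔭⁺`. -/
def pPlus {n : ℕ} (k : Fin n) : so2 n :=
  wedge (coordVec (Sum.inl 0) + Complex.I • coordVec (Sum.inl 1)) (coordVec (Sum.inr k))

/-- `U(𝔨)` for the complexified maximal compact subalgebra `𝔨`. -/
abbrev UK (n : ℕ) : Type := UniversalEnvelopingAlgebra ℂ (compactK n)

/-- `U(𝔤)` for the complexification `𝔤` of `so(2,n)`. -/
abbrev UG (n : ℕ) : Type := UniversalEnvelopingAlgebra ℂ (so2 n)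

/-- The left ideal of `U(𝔨)` that defines the Verma module of highest weight `μ`. -/
def vermaIdeal (n : ℕ) (μ : Fin (n / 2 + 1) → ℂ) : Submodule (UK n) (UK n) :=
  Submodule.span (UK n)
    (UniversalEnvelopingAlgebra.ι ℂ '' posCompact n ∪
      Set.range fun j => UniversalEnvelopingAlgebra.ι ℂ (cartanH n j) - algebraMap ℂ (UK n) (μ j))

/-- The Verma module of `𝔨` of highest weight `μ`. -/
def VermaK (n : ℕ) (μ : Fin (n / 2 + 1) → ℂ) : Type := UK n ⧸ vermaIdeal n μ

section
variable (n : ℕ) (μ : Fin (n / 2 + 1) → ℂ)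

instance : AddCommGroup (VermaK n μ) := inferInstanceAs (AddCommGroup (UK n ⧸ vermaIdeal n μ))
instance : Module ℂ (VermaK n μ) := inferInstanceAs (Module ℂ (UK n ⧸ vermaIdeal n μ))
instance : Module (UK n) (VermaK n μ) := inferInstanceAs (Module (UK n) (UK n ⧸ vermaIdeal n μ))
instance : IsScalarTower ℂ (UK n) (VermaK n μ) :=
  inferInstanceAs (IsScalarTower ℂ (UK n) (UK n ⧸ vermaIdeal n μ))
instance : LieRingModule (compactK n) (VermaK n μ) := lieRingModuleOfEnveloping _
instance : LieModule ℂ (compactK n) (VermaK n μ) := lieModuleOfEnveloping _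

/-- `K(μ)`: the irreducible `𝔨`-module of highest weight `μ`, also written
`χ(μ_1) ⊗ π(μ_2, …, μ_r)`. -/
def KMod : Type := VermaK n μ ⧸ sumOfProper (compactK n) (VermaK n μ)

instance : AddCommGroup (KMod n μ) :=
  inferInstanceAs (AddCommGroup (VermaK n μ ⧸ sumOfProper (compactK n) (VermaK n μ)))
instance : Module ℂ (KMod n μ) :=
  inferInstanceAs (Module ℂ (VermaK n μ ⧸ sumOfProper (compactK n) (VermaK n μ)))
instance : LieRingModule (compactK n) (KMod n μ) :=
  inferInstanceAs
    (LieRingModule (compactK n) (VermaK n μ ⧸ sumOfProper (compactK n) (VermaK n μ)))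
instance : LieModule ℂ (compactK n) (KMod n μ) :=
  inferInstanceAs
    (LieModule ℂ (compactK n) (VermaK n μ ⧸ sumOfProper (compactK n) (VermaK n μ)))

/-- The relations `u x ⊗ v = u ⊗ x v` (`x ∈ 𝔨`) and `u y ⊗ v = 0` (`y ∈ 𝔭⁺`) that define
`U(𝔤) ⊗_{U(𝔨 + 𝔭⁺)} K(μ)`, where `𝔭⁺` acts on `K(μ)` by zero. -/
def inducedRel : Submodule (UG n) (UG n ⊗[ℂ] KMod n μ) :=
  Submodule.span (UG n)
    ({t | ∃ (u : UG n) (x : compactK n) (v : KMod n μ),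
        t = (u * UniversalEnvelopingAlgebra.ι ℂ (x : so2 n)) ⊗ₜ[ℂ] v - u ⊗ₜ[ℂ] ⁅x, v⁆} ∪
      {t | ∃ (u : UG n) (k : Fin n) (v : KMod n μ),
        t = (u * UniversalEnvelopingAlgebra.ι ℂ (pPlus k)) ⊗ₜ[ℂ] v})

/-- `N(μ) = U(𝔤) ⊗_{U(𝔨 + 𝔭⁺)} K(μ)`: the induced highest weight `𝔤`-module. -/
def NMod : Type := (UG n ⊗[ℂ] KMod n μ) ⧸ inducedRel n μ

instance : AddCommGroup (NMod n μ) :=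
  inferInstanceAs (AddCommGroup ((UG n ⊗[ℂ] KMod n μ) ⧸ inducedRel n μ))
instance : Module ℂ (NMod n μ) :=
  inferInstanceAs (Module ℂ ((UG n ⊗[ℂ] KMod n μ) ⧸ inducedRel n μ))
instance : Module (UG n) (NMod n μ) :=
  inferInstanceAs (Module (UG n) ((UG n ⊗[ℂ] KMod n μ) ⧸ inducedRel n μ))
instance : IsScalarTower ℂ (UG n) (NMod n μ) :=
  inferInstanceAs (IsScalarTower ℂ (UG n) ((UG n ⊗[ℂ] KMod n μ) ⧸ inducedRel n μ))
instance : LieRingModule (so2 n) (NMod n μ) := lieRingModuleOfEnveloping _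
instance : LieModule ℂ (so2 n) (NMod n μ) := lieModuleOfEnveloping _

/-- `L(μ)`: the irreducible quotient of `N(μ)`. It carries the representation
`D(-μ_1, μ_2, …, μ_r)`. -/
def LMod : Type := NMod n μ ⧸ sumOfProper (so2 n) (NMod n μ)

instance : AddCommGroup (LMod n μ) :=
  inferInstanceAs (AddCommGroup (NMod n μ ⧸ sumOfProper (so2 n) (NMod n μ)))
instance : Module ℂ (LMod n μ) :=
  inferInstanceAs (Module ℂ (NMod n μ ⧸ sumOfProper (so2 n) (NMod n μ)))
instance : LieRingModule (so2 n) (LMod n μ) :=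
  inferInstanceAs (LieRingModule (so2 n) (NMod n μ ⧸ sumOfProper (so2 n) (NMod n μ)))
instance : LieModule ℂ (so2 n) (LMod n μ) :=
  inferInstanceAs (LieModule ℂ (so2 n) (NMod n μ ⧸ sumOfProper (so2 n) (NMod n μ)))

end

/-- A `𝔤`-module is unitarizable if it has a positive definite Hermitian form for which the
elements of the real form `so(2,n)` act by skew-Hermitian operators. -/
def IsUnitarizable (n : ℕ) (V : Type) [AddCommGroup V] [Module ℂ V] [LieRingModule (so2 n) V] :
    Prop :=
  ∃ B : V →ₗ⋆[ℂ] V →ₗ[ℂ] ℂ,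
    (∀ v w, B w v = starRingEnd ℂ (B v w)) ∧
    (∀ v, v ≠ 0 → 0 < (B v v).re) ∧
    (∀ x : so2 n, IsRealElement x → ∀ v w, B ⁅x, v⁆ w = -B v ⁅x, w⁆)

/-- The weight `(-E, 1/2 + l, 1/2, …, 1/2, c)` with `r = n / 2 + 1` entries. If `r = 2`, it is
`(-E, 1/2 + l)`. -/
def spinWeight (n : ℕ) (E : ℝ) (l : ℕ) (c : ℝ) : Fin (n / 2 + 1) → ℂ := fun i =>
  if i.1 = 0 then ((-E : ℝ) : ℂ)
  else if i.1 = 1 then ((1 / 2 + l : ℝ) : ℂ)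
  else if i.1 = n / 2 then (c : ℂ)
  else 1 / 2

/-- `ν - 1/2`, where `ν = 0` for even `n` and `ν = 1` for odd `n`. -/
def lastSpin (n : ℕ) : ℝ := (n % 2 : ℕ) - 1 / 2

end ConformalSpin

end

open scoped TensorProduct DirectSum

noncomputable section

attribute [local instance 100] LieRing.ofAssociativeRing

namespace ConformalSpin

/-! The induced module is realised on spinor-valued polynomials in `n` variables. There `𝔭⁻` acts by
multiplication by the coordinates `x_k`, `H_1` by minus the Euler operator shifted by `E`, `so(n)`
by rotations with a spin part, and `𝔭⁺` by second-order operators `K_k` (`kOp`). Spinors form a Fock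
space with `(n + 1) / 2` fermionic modes, so that for odd `n` as well a chirality operator
anticommutes with all `γ_k`. A chirality sector of the constants is a half-spin module for even `n`
and a copy of the spin module for odd `n`. The polynomials of one chirality (`confChir`) form a free
module over the polynomials in `𝔭⁻` generated by these constants, and this identifies them with
`N(μ)` (`exists_NMod_equiv`).

Put `x̸ = ∑ γ_k x_k` (`xs`) and `∂̸ = ∑ γ_k ∂_k` (`dirac`). From `∂̸ x̸ + x̸ ∂̸ = 2 Eul + n` follows
the Fischer decomposition into the spaces `x̸^j M_l`, where `M_l` is the space of homogeneous
solutions of `∂̸F = 0` of degree `l` (`degSub_le_iSup_comp`). Each `M_l` of fixed chirality is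
irreducible under `so(n)`: its only vector killed by the positive root vectors is, up to scalars,
`z^l` times the top spinor (`eq_smul_hwv`), and the Fischer inner product excludes a proper
submodule containing it. As `x̸^j` is injective and commutes with rotations, this gives all the
`𝔨`-types (`compK_equiv`).

Irreducibility and unitarity are governed by the operator `∑ x_k K_k` (`casimir`). It acts on `x̸^j
M_l` by the scalar `j(2l+n+j-1) - (j+l)(2(j+l)+2E-1)`. For `E > (n-1)/2` this is negative off the
constants, hence no nonconstant homogeneous polynomial is killed by all `K_k`. A nonzero submodule,
pushed down in degree by the `K_k`, therefore meets the constants, and these generate everything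
(`stable_eq_bot_or`).

For `E = (n-1)/2` the scalar vanishes off the constants exactly on `x̸ M_0`. There `x̸` intertwines
the module with parameter `E + 1` and opposite chirality with the given one (`rhoLin_xs`), so the
multiples of `x̸` form a submodule. It is irreducible because `E + 1` lies above the bound. Modulo
`x̸` only the monogenics survive, on which the scalar is still nonzero in positive degree, so the
descent in degree shows that every proper submodule consists of multiples of `x̸` (`stable_le_or`).

For unitarity, the Fischer pairing on constants extends, by the universal property of the induced
module applied to the conjugate dual, to an invariant form (`exists_form`). Since `x_k` and `-K_k`
are adjoint, the Casimir eigenvalue times `B(F,F)` equals `-∑ B(K_k F, K_k F)`, and positivity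
propagates by induction on the degree. -/

section Shortcuts
variable (n : ℕ)
scoped instance : AddCommGroup (so2 n) := inferInstance
scoped instance : AddCommMonoid (so2 n) := inferInstance
scoped instance : Module ℂ (so2 n) := inferInstance
scoped instance : LieRing (so2 n) := inferInstance
scoped instance : LieAlgebra ℂ (so2 n) := inferInstance
scoped instance : AddCommGroup (compactK n) := inferInstance
scoped instance : AddCommMonoid (compactK n) := inferInstance
scoped instance : Module ℂ (compactK n) := inferInstance
scoped instance : LieRing (compactK n) := inferInstance
scoped instance : LieAlgebra ℂ (compactK n) := inferInstance
end Shortcuts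

/-! ### Wedges, matrix entries and a spanning set of `so(2,n)` -/

/-- The bilinear form `η`. -/
def etaForm {n : ℕ} (u v : Fin 2 ⊕ Fin n → ℂ) : ℂ := ∑ a, u a * v a * etaDiag n a

lemma wedge_apply {n : ℕ} (u v : Fin 2 ⊕ Fin n → ℂ) (a b : Fin 2 ⊕ Fin n) :
    (wedge u v).1 a b = (u a * v b - v a * u b) * etaDiag n b := rfl

lemma so2_skew {n : ℕ} (x : so2 n) (a b : Fin 2 ⊕ Fin n) :
    x.1 b a * etaDiag n b = -(etaDiag n a * x.1 a b) := by
  have hx : x.1.transpose * Matrix.diagonal (etaDiag n) = Matrix.diagonal (etaDiag n) * -x.1 :=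
    (mem_skewAdjointMatricesSubmodule _ _).1 x.2
  have := congrFun (congrFun hx a) b
  simpa [Matrix.mul_diagonal, Matrix.diagonal_mul, Matrix.transpose_apply] using this

lemma wedge_mulVec {n : ℕ} (u v y : Fin 2 ⊕ Fin n → ℂ) :
    (wedge u v).1.mulVec y = etaForm v y • u - etaForm u y • v := by
  ext a
  simp only [Matrix.mulVec, dotProduct, wedge_apply, etaForm, Pi.sub_apply, Pi.smul_apply,
    smul_eq_mul, Finset.sum_mul, ← Finset.sum_sub_distrib]
  exact Finset.sum_congr rfl fun b _ => by ring

/-- Since `x` is `η`-skew, multiplying a wedge by `x` on the right amounts to minus applying `x` to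
the second vector of each rank-one term. Thus the wedge map is equivariant, and every structure
constant below follows from this rule. -/
lemma lie_wedge {n : ℕ} (x : so2 n) (u v : Fin 2 ⊕ Fin n → ℂ) :
    ⁅x, wedge u v⁆ = wedge (x.1.mulVec u) v + wedge u (x.1.mulVec v) := by
  apply Subtype.ext
  ext a b
  have h1 : ∀ w : Fin 2 ⊕ Fin n → ℂ, ∑ c, w c * etaDiag n c * x.1 c b
      = -((x.1.mulVec w) b * etaDiag n b) := by
    intro w
    simp only [Matrix.mulVec, dotProduct, Finset.sum_mul, ← Finset.sum_neg_distrib]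
    refine Finset.sum_congr rfl fun c _ => ?_
    have h := so2_skew x b c
    linear_combination w c * h
  have h2 : ∀ w : Fin 2 ⊕ Fin n → ℂ, (x.1.mulVec w) a = ∑ c, x.1 a c * w c := fun w => rfl
  have e1 : (⁅x, wedge u v⁆ : so2 n).1 a b =
      (∑ c, x.1 a c * u c) * (v b * etaDiag n b) - (∑ c, x.1 a c * v c) * (u b * etaDiag n b)
        - u a * (∑ c, v c * etaDiag n c * x.1 c b) + v a * ∑ c, u c * etaDiag n c * x.1 c b := by
    have : (⁅x, wedge u v⁆ : so2 n).1 = x.1 * (wedge u v).1 - (wedge u v).1 * x.1 := rfl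
    rw [this]
    simp only [Matrix.sub_apply, Matrix.mul_apply, wedge_apply, Finset.mul_sum, Finset.sum_mul,
      ← Finset.sum_sub_distrib, ← Finset.sum_add_distrib]
    exact Finset.sum_congr rfl fun c _ => by ring
  rw [e1, h1, h1, ← h2, ← h2]
  have e2 : (wedge (x.1.mulVec u) v + wedge u (x.1.mulVec v) : so2 n).1 a b =
    (wedge (x.1.mulVec u) v).1 a b + (wedge u (x.1.mulVec v)).1 a b := rfl
  rw [e2, wedge_apply, wedge_apply]
  ring

lemma wedge_add_left {n : ℕ} (u u' v : Fin 2 ⊕ Fin n → ℂ) :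
    wedge (u + u') v = wedge u v + wedge u' v := by
  apply Subtype.ext; ext a b
  change (wedge (u + u') v).1 a b = (wedge u v).1 a b + (wedge u' v).1 a b
  simp only [wedge_apply, Pi.add_apply]; ring

lemma wedge_smul_left {n : ℕ} (c : ℂ) (u v : Fin 2 ⊕ Fin n → ℂ) :
    wedge (c • u) v = c • wedge u v := by
  apply Subtype.ext; ext a b
  change (wedge (c • u) v).1 a b = c * (wedge u v).1 a b
  simp only [wedge_apply, Pi.smul_apply, smul_eq_mul]; ring

lemma wedge_swap {n : ℕ} (u v : Fin 2 ⊕ Fin n → ℂ) : wedge u v = -wedge v u := by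
  apply Subtype.ext; ext a b
  change (wedge u v).1 a b = -(wedge v u).1 a b
  simp only [wedge_apply]; ring

/-- The wedge product as a bilinear map. -/
def wedgeLin (n : ℕ) : (Fin 2 ⊕ Fin n → ℂ) →ₗ[ℂ] (Fin 2 ⊕ Fin n → ℂ) →ₗ[ℂ] so2 n :=
  LinearMap.mk₂ ℂ wedge wedge_add_left wedge_smul_left
    (fun u v v' => by
      rw [wedge_swap, wedge_add_left, wedge_swap v u, wedge_swap v' u, neg_add, neg_neg, neg_neg])
    (fun c u v => by rw [wedge_swap, wedge_smul_left, wedge_swap v u, smul_neg, neg_neg])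

@[simp] lemma wedgeLin_apply {n : ℕ} (u v : Fin 2 ⊕ Fin n → ℂ) : wedgeLin n u v = wedge u v := rfl

/-- The noncompact negative root vectors `(e_{-1} - i e_0) ∧ e_k`. -/
def pMinus {n : ℕ} (k : Fin n) : so2 n :=
  wedge (coordVec (Sum.inl 0) - Complex.I • coordVec (Sum.inl 1)) (coordVec (Sum.inr k))

/-- The generator `H_1 = -i M_{-1,0}` in `so2 n`. -/
def hTime (n : ℕ) : so2 n := -Complex.I • genM (Sum.inl 0) (Sum.inl 1)

/-- The rotation generators `M_{jk}` with spatial indices. -/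
def rotM {n : ℕ} (j k : Fin n) : so2 n := genM (Sum.inr j) (Sum.inr k)

/-- The matrix entries as linear forms on `so2 n`. -/
def entry {n : ℕ} (a b : Fin 2 ⊕ Fin n) : so2 n →ₗ[ℂ] ℂ :=
  Matrix.entryLinearMap ℂ ℂ a b ∘ₗ (so2 n).toSubmodule.subtype

lemma entry_apply {n : ℕ} (a b : Fin 2 ⊕ Fin n) (x : so2 n) : entry a b x = x.1 a b := rfl

lemma so2_ext {n : ℕ} {x y : so2 n} (h : ∀ a b, entry a b x = entry a b y) : x = y :=
  Subtype.ext (Matrix.ext h)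

lemma entry_wedge {n : ℕ} (u v : Fin 2 ⊕ Fin n → ℂ) (a b : Fin 2 ⊕ Fin n) :
    entry a b (wedge u v) = (u a * v b - v a * u b) * etaDiag n b := rfl

lemma entry_hTime {n : ℕ} (a b : Fin 2 ⊕ Fin n) :
    entry a b (hTime n) = -Complex.I * ((if a = Sum.inl 0 ∧ b = Sum.inl 1 then 1 else 0)
      - (if a = Sum.inl 1 ∧ b = Sum.inl 0 then 1 else 0)) * etaDiag n b := by
  rw [hTime, genM, map_smul, entry_wedge]
  simp only [coordVec, Pi.single_apply, ite_and, smul_eq_mul]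
  split_ifs <;> simp

lemma entry_rotM {n : ℕ} (j k : Fin n) (a b : Fin 2 ⊕ Fin n) :
    entry a b (rotM j k) = ((if a = Sum.inr j then if b = Sum.inr k then 1 else 0 else 0)
      - (if b = Sum.inr j then if a = Sum.inr k then 1 else 0 else 0)) * etaDiag n b := by
  rw [rotM, genM, entry_wedge]
  simp only [coordVec, Pi.single_apply]
  congr 2 <;> split_ifs <;> simp

lemma entry_pPlus {n : ℕ} (k : Fin n) (a b : Fin 2 ⊕ Fin n) :
    entry a b (pPlus k) = (((if a = Sum.inl 0 then 1 else 0)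
        + if a = Sum.inl 1 then Complex.I else 0) * (if b = Sum.inr k then 1 else 0)
      - (if a = Sum.inr k then 1 else 0) * ((if b = Sum.inl 0 then 1 else 0)
        + if b = Sum.inl 1 then Complex.I else 0)) * etaDiag n b := by
  rw [pPlus, entry_wedge]
  simp [coordVec, Pi.single_apply]

lemma entry_pMinus {n : ℕ} (k : Fin n) (a b : Fin 2 ⊕ Fin n) :
    entry a b (pMinus k) = (((if a = Sum.inl 0 then 1 else 0)
        - if a = Sum.inl 1 then Complex.I else 0) * (if b = Sum.inr k then 1 else 0)
      - (if a = Sum.inr k then 1 else 0) * ((if b = Sum.inl 0 then 1 else 0)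
        - if b = Sum.inl 1 then Complex.I else 0)) * etaDiag n b := by
  rw [pMinus, entry_wedge]
  simp [coordVec, Pi.single_apply]

/-- The signs come from `η = -1` on spatial indices; the factor `1/2` in the double sum compensates
for counting each rotation twice, and the coefficients of `pMinus` and `pPlus` invert the passage
from the two time rows to `e_{-1} ∓ i e_0`. The same coefficients later define the action on
polynomials, so that no basis has to be chosen. -/
lemma so2_decomp {n : ℕ} (x : so2 n) :
    x = (Complex.I * entry (Sum.inl 0) (Sum.inl 1) x) • hTime n
      + ∑ k, (-(1 / 2) * entry (Sum.inl 0) (Sum.inr k) x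
          - Complex.I / 2 * entry (Sum.inl 1) (Sum.inr k) x) • pMinus k
      + ∑ k, (-(1 / 2) * entry (Sum.inl 0) (Sum.inr k) x
          + Complex.I / 2 * entry (Sum.inl 1) (Sum.inr k) x) • pPlus k
      + ∑ j, ∑ k, (-(1 / 2) * entry (Sum.inr j) (Sum.inr k) x) • rotM j k := by
  have I2 := Complex.I_mul_I
  apply so2_ext
  intro a b
  have h1 : entry a b x * etaDiag n a = -(etaDiag n b * entry b a x) := so2_skew x b a
  simp only [map_add, map_sum, map_smul, smul_eq_mul, entry_hTime, entry_pMinus, entry_pPlus,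
    entry_rotM]
  rcases a with a | a <;> rcases b with b | b
  · have h0 : entry _ _ x * _ = -(_ * entry _ _ x) := so2_skew x (Sum.inl 0) (Sum.inl 0)
    have h2 : entry _ _ x * _ = -(_ * entry _ _ x) := so2_skew x (Sum.inl 1) (Sum.inl 1)
    have h3 : entry _ _ x * _ = -(_ * entry _ _ x) := so2_skew x (Sum.inl 0) (Sum.inl 1)
    simp [etaDiag] at h0 h2 h3
    fin_cases a <;> fin_cases b <;> simp [etaDiag]
    · linear_combination h0 / 2
    · linear_combination entry (Sum.inl 0) (Sum.inl 1) x * I2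
    · linear_combination h3 - entry (Sum.inl 0) (Sum.inl 1) x * I2
    · linear_combination h2 / 2
  · fin_cases a <;> simp [etaDiag]
    · ring
    · linear_combination entry (Sum.inl 1) (Sum.inr b) x * I2
  · fin_cases b <;> simp [etaDiag] at h1 ⊢
    · linear_combination h1
    · linear_combination h1 + entry (Sum.inl 1) (Sum.inr a) x * I2
  · simp [etaDiag, mul_sub, Finset.sum_sub_distrib] at h1 ⊢
    linear_combination -h1 / 2

lemma etaForm_coordVec {n : ℕ} (a b : Fin 2 ⊕ Fin n) :
    etaForm (coordVec a) (coordVec b) = if a = b then etaDiag n a else 0 := by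
  simp only [etaForm, coordVec, Pi.single_apply, mul_ite, ite_mul, one_mul, zero_mul, mul_one,
    mul_zero]
  rw [Finset.sum_ite_eq']
  by_cases h : a = b
  · simp [h]
  · simp [h, Ne.symm h]

/-- The bilinear form `η` as a bilinear map. -/
def etaLin (n : ℕ) : (Fin 2 ⊕ Fin n → ℂ) →ₗ[ℂ] (Fin 2 ⊕ Fin n → ℂ) →ₗ[ℂ] ℂ :=
  LinearMap.mk₂ ℂ etaForm
    (fun u u' v => by
      simp only [etaForm, Pi.add_apply, ← Finset.sum_add_distrib]
      exact Finset.sum_congr rfl fun _ _ => by ring)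
    (fun c u v => by
      simp only [etaForm, Pi.smul_apply, smul_eq_mul, Finset.mul_sum]
      exact Finset.sum_congr rfl fun _ _ => by ring)
    (fun u v v' => by
      simp only [etaForm, Pi.add_apply, ← Finset.sum_add_distrib]
      exact Finset.sum_congr rfl fun _ _ => by ring)
    (fun c u v => by
      simp only [etaForm, Pi.smul_apply, smul_eq_mul, Finset.mul_sum]
      exact Finset.sum_congr rfl fun _ _ => by ring)

lemma etaForm_eq_etaLin {n : ℕ} (u v : Fin 2 ⊕ Fin n → ℂ) : etaForm u v = etaLin n u v := rfl

lemma lie_wedge_wedge {n : ℕ} (u v y w : Fin 2 ⊕ Fin n → ℂ) :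
    ⁅wedge u v, wedge y w⁆ = etaLin n v y • wedgeLin n u w - etaLin n u y • wedgeLin n v w
      + etaLin n v w • wedgeLin n y u - etaLin n u w • wedgeLin n y v := by
  rw [lie_wedge, wedge_mulVec, wedge_mulVec]
  simp only [← wedgeLin_apply, map_sub, map_smul, LinearMap.sub_apply, LinearMap.smul_apply,
    etaForm_eq_etaLin]
  abel

lemma wedge_self {n : ℕ} (u : Fin 2 ⊕ Fin n → ℂ) : wedge u u = 0 := by
  apply so2_ext; intro a b; rw [entry_wedge, map_zero]; ring

/-! ### Commutation relations of `H_1`, `𝔭⁻`, `𝔭⁺` and the rotations -/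

section Brackets
variable {n : ℕ}

lemma etaLin_coord (a b : Fin 2 ⊕ Fin n) :
    etaLin n (coordVec a) (coordVec b) = if a = b then etaDiag n a else 0 := etaForm_coordVec a b

lemma lie_hTime_pMinus (k : Fin n) : ⁅hTime n, pMinus k⁆ = -pMinus k := by
  rw [hTime, pMinus, genM, smul_lie, lie_wedge_wedge]
  simp [etaLin_coord, etaDiag, ← wedgeLin_apply, smul_sub, smul_smul]
  abel

lemma lie_hTime_pPlus (k : Fin n) : ⁅hTime n, pPlus k⁆ = pPlus k := by
  rw [hTime, pPlus, genM, smul_lie, lie_wedge_wedge]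
  simp [etaLin_coord, etaDiag, ← wedgeLin_apply, smul_sub, smul_smul]

lemma lie_hTime_rotM (j k : Fin n) : ⁅hTime n, rotM j k⁆ = 0 := by
  rw [hTime, rotM, genM, genM, smul_lie, lie_wedge_wedge]
  simp [etaLin_coord]

lemma lie_rotM_pMinus (j k m : Fin n) : ⁅rotM j k, pMinus m⁆
    = (if j = m then (1 : ℂ) else 0) • pMinus k - (if k = m then (1 : ℂ) else 0) • pMinus j := by
  rw [rotM, pMinus, genM, lie_wedge_wedge]
  simp [etaLin_coord, etaDiag, pMinus, ← wedgeLin_apply]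
  split_ifs <;> (simp; try abel)

lemma lie_rotM_pPlus (j k m : Fin n) : ⁅rotM j k, pPlus m⁆
    = (if j = m then (1 : ℂ) else 0) • pPlus k - (if k = m then (1 : ℂ) else 0) • pPlus j := by
  rw [rotM, pPlus, genM, lie_wedge_wedge]
  simp [etaLin_coord, etaDiag, pPlus, ← wedgeLin_apply]
  split_ifs <;> (simp; try abel)

lemma lie_rotM_rotM (j k a b : Fin n) : ⁅rotM j k, rotM a b⁆
    = (if j = a then (1 : ℂ) else 0) • rotM k b - (if k = a then (1 : ℂ) else 0) • rotM j b
      + (if j = b then (1 : ℂ) else 0) • rotM a k - (if k = b then (1 : ℂ) else 0) • rotM a j := by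
  simp only [rotM, genM]
  rw [lie_wedge_wedge]
  simp only [etaLin_coord, etaDiag, ← wedgeLin_apply, Sum.inr.injEq, Sum.elim_inr]
  split_ifs <;> (simp; try abel)

lemma lie_pMinus_pMinus (j k : Fin n) : ⁅(pMinus j : so2 n), pMinus k⁆ = 0 := by
  rw [pMinus, pMinus, lie_wedge_wedge]
  have h : wedge (coordVec (Sum.inl 1)) (coordVec (Sum.inl 0))
    = -wedge (coordVec (Sum.inl 0)) (coordVec (Sum.inl 1 : Fin 2 ⊕ Fin n)) := wedge_swap _ _
  simp only [map_sub, map_smul, LinearMap.sub_apply,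
    LinearMap.smul_apply, etaLin_coord, wedgeLin_apply, wedge_self, h]
  simp [etaDiag]

lemma lie_pPlus_pPlus (j k : Fin n) : ⁅(pPlus j : so2 n), pPlus k⁆ = 0 := by
  rw [pPlus, pPlus, lie_wedge_wedge]
  have h : wedge (coordVec (Sum.inl 1)) (coordVec (Sum.inl 0))
    = -wedge (coordVec (Sum.inl 0)) (coordVec (Sum.inl 1 : Fin 2 ⊕ Fin n)) := wedge_swap _ _
  simp only [map_add, map_smul, LinearMap.add_apply,
    LinearMap.smul_apply, etaLin_coord, wedgeLin_apply, wedge_self, h]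
  simp [etaDiag]

lemma lie_pPlus_pMinus (j k : Fin n) : ⁅(pPlus j : so2 n), pMinus k⁆
    = -(2 : ℂ) • rotM j k + (if j = k then (2 : ℂ) else 0) • hTime n := by
  have h : wedge (coordVec (Sum.inl 1)) (coordVec (Sum.inl 0))
    = -wedge (coordVec (Sum.inl 0)) (coordVec (Sum.inl 1 : Fin 2 ⊕ Fin n)) := wedge_swap _ _
  rw [pPlus, pMinus, lie_wedge_wedge]
  simp only [map_add, map_sub, map_smul, LinearMap.add_apply, LinearMap.sub_apply,
    LinearMap.smul_apply, etaLin_coord, wedgeLin_apply, wedge_self, h, rotM, genM, hTime]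
  by_cases hjk : j = k
  · simp [hjk, wedge_self, etaDiag]
    module
  · simp [hjk, etaDiag]
    norm_num
end Brackets

/-! ### Weights and a grading of the compact subalgebra -/

section Compact
variable {n : ℕ}

/-- `wedgeSpace` as a bilinear map. -/
def wedgeSpaceLin (n : ℕ) : (Fin n → ℂ) →ₗ[ℂ] (Fin n → ℂ) →ₗ[ℂ] compactK n :=
  LinearMap.mk₂ ℂ wedgeSpace
    (fun u u' v => Subtype.ext <| by
      change wedgeLin n _ _ = wedgeLin n _ _ + wedgeLin n _ _
      rw [← LinearMap.add_apply, ← map_add]; congr 2; ext (a | a) <;> simp)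
    (fun c u v => Subtype.ext <| by
      change wedgeLin n _ _ = c • wedgeLin n _ _
      rw [← LinearMap.smul_apply, ← map_smul]; congr 2; ext (a | a) <;> simp)
    (fun u v v' => Subtype.ext <| by
      change wedgeLin n _ _ = wedgeLin n _ _ + wedgeLin n _ _
      rw [← map_add]; congr 1; ext (a | a) <;> simp)
    (fun c u v => Subtype.ext <| by
      change wedgeLin n _ _ = c • wedgeLin n _ _
      rw [← map_smul]; congr 1; ext (a | a) <;> simp)

lemma wedgeSpace_eq (u v : Fin n → ℂ) : wedgeSpace u v = wedgeSpaceLin n u v := rfl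

lemma wedgeSpace_swap (u v : Fin n → ℂ) : wedgeSpace u v = -wedgeSpace v u :=
  Subtype.ext (wedge_swap _ _)

lemma wedgeSpace_self (u : Fin n → ℂ) : wedgeSpace u u = 0 := Subtype.ext (wedge_self _)

lemma wedgeSpace_single (j k : Fin n) :
    (wedgeSpace (Pi.single j 1) (Pi.single k 1) : so2 n) = rotM j k := by
  have h : ∀ j : Fin n, (Sum.elim 0 (Pi.single j 1) : Fin 2 ⊕ Fin n → ℂ) = coordVec (Sum.inr j) := by
    intro j; ext (a | a) <;> simp [coordVec, Pi.single_apply]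
  simp only [wedgeSpace, h]; rfl

/-- The action of `H_{i+2}` on spatial vectors. -/
def hAct (i : Fin (n / 2)) (u : Fin n → ℂ) : Fin n → ℂ :=
  Complex.I • (u (evenIdx i) • Pi.single (oddIdx i) 1 - u (oddIdx i) • Pi.single (evenIdx i) 1)

lemma lie_cartanH_succ (i : Fin (n / 2)) (u v : Fin n → ℂ) :
    ⁅cartanH n i.succ, wedgeSpace u v⁆ = wedgeSpace (hAct i u) v + wedgeSpace u (hAct i v) := by
  have key : ∀ w : Fin n → ℂ, (Complex.I • wedge (Sum.elim 0 (Pi.single (evenIdx i) 1))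
      (Sum.elim 0 (Pi.single (oddIdx i) 1)) : so2 n).1.mulVec (Sum.elim 0 w)
      = (Sum.elim 0 (hAct i w) : Fin 2 ⊕ Fin n → ℂ) := by
    intro w
    change (Complex.I • (wedge _ _ : so2 n).1).mulVec _ = _
    rw [Matrix.smul_mulVec, wedge_mulVec]
    ext (a | a) <;> simp [hAct, etaForm, etaDiag]
    simp [Pi.single_apply]
    ring
  apply Subtype.ext
  change ⁅(Complex.I • wedge _ _ : so2 n), wedge _ _⁆ = wedge _ _ + wedge _ _
  rw [lie_wedge, key, key]

lemma evenIdx_ne_oddIdx (i j : Fin (n / 2)) : evenIdx i ≠ (oddIdx j : Fin n) := by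
  intro h; have := congrArg Fin.val h; simp [evenIdx, oddIdx] at this; omega

lemma evenIdx_inj {i j : Fin (n / 2)} : (evenIdx i : Fin n) = evenIdx j ↔ i = j := by
  simp [evenIdx, Fin.ext_iff]

lemma oddIdx_inj {i j : Fin (n / 2)} : (oddIdx i : Fin n) = oddIdx j ↔ i = j := by
  simp [oddIdx, Fin.ext_iff]

lemma hAct_isoPos (i j : Fin (n / 2)) :
    hAct i (isoPos j) = (if i = j then (1 : ℂ) else 0) • isoPos j := by
  have h := evenIdx_ne_oddIdx (n := n)
  split_ifs with hij
  · subst hij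
    ext k
    simp [hAct, isoPos, Pi.single_apply, h, (h _ _).symm]
    split_ifs with h1 h2 <;> simp_all
  · simp [hAct, isoPos, h, (h _ _).symm, evenIdx_inj, oddIdx_inj, hij]

lemma hAct_isoNeg (i j : Fin (n / 2)) :
    hAct i (isoNeg j) = (if i = j then (-1 : ℂ) else 0) • isoNeg j := by
  have h := evenIdx_ne_oddIdx (n := n)
  split_ifs with hij
  · subst hij
    ext k
    simp [hAct, isoNeg, Pi.single_apply, h, (h _ _).symm]
    split_ifs with h1 h2 <;> simp_all
  · simp [hAct, isoNeg, h, (h _ _).symm, evenIdx_inj, oddIdx_inj, hij]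

lemma hAct_isoZero (i : Fin (n / 2)) : hAct i (isoZero n) = 0 := by
  have hi := i.2
  have h1 : ¬ (Odd n ∧ (evenIdx i : Fin n).1 + 1 = n) := by
    rintro ⟨-, h⟩; simp [evenIdx] at h; omega
  have h2 : ¬ (Odd n ∧ (oddIdx i : Fin n).1 + 1 = n) := by
    rintro ⟨h0, h⟩; simp [oddIdx] at h; rcases h0 with ⟨m, rfl⟩; omega
  simp [hAct, isoZero, h1, h2]

/-- The grading element `∑ (n/2 - i) H_{i+2}`. -/
def gradK (n : ℕ) : compactK n := ∑ i : Fin (n / 2), ((n / 2 : ℕ) - (i.1 : ℂ)) • cartanH n i.succ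

lemma lie_gradK {u v : Fin n → ℂ} {α β : Fin (n / 2) → ℂ} (hu : ∀ i, hAct i u = α i • u)
    (hv : ∀ i, hAct i v = β i • v) : ⁅gradK n, wedgeSpace u v⁆
      = (∑ i : Fin (n / 2), ((n / 2 : ℕ) - (i.1 : ℂ)) * (α i + β i)) • wedgeSpace u v := by
  rw [gradK, sum_lie, Finset.sum_smul]
  refine Finset.sum_congr rfl fun i _ => ?_
  rw [smul_lie, lie_cartanH_succ, hu, hv]
  simp only [wedgeSpace_eq, map_smul, LinearMap.smul_apply]
  module

/-- Root vectors of the negative compact roots. -/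
def negCompact (n : ℕ) : Set (compactK n) :=
  {x | ∃ i j : Fin (n / 2), i < j ∧
      (x = wedgeSpace (isoNeg i) (isoNeg j) ∨ x = wedgeSpace (isoNeg i) (isoPos j))} ∪
    {x | ∃ i : Fin (n / 2), x = wedgeSpace (isoNeg i) (isoZero n)}

/-- The coefficients `n/2 - i` are positive and strictly decreasing in `i`, so each root `e_i ± e_j`
with `i < j`, and each `e_i`, takes a positive integral value on the grading element. This single
operator does the work of the whole weight decomposition in the highest weight arguments. -/
lemma lie_gradK_posCompact {x : compactK n} (hx : x ∈ posCompact n) :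
    ∃ m : ℕ, 0 < m ∧ ⁅gradK n, x⁆ = (m : ℂ) • x := by
  rcases hx with ⟨i, j, hij, rfl | rfl⟩ | ⟨i, rfl⟩
  · refine ⟨(n / 2 - i) + (n / 2 - j), by omega, ?_⟩
    rw [lie_gradK (hAct_isoPos · i) (hAct_isoPos · j)]
    congr 1
    simp [mul_add, Finset.sum_add_distrib, Nat.cast_sub i.2.le, Nat.cast_sub j.2.le]
  · refine ⟨j - i, by omega, ?_⟩
    rw [lie_gradK (hAct_isoPos · i) (hAct_isoNeg · j)]
    congr 1
    simp [mul_add, Finset.sum_add_distrib, Nat.cast_sub (Fin.le_def.1 hij.le)]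
  · refine ⟨n / 2 - i, by omega, ?_⟩
    rw [lie_gradK (β := 0) (hAct_isoPos · i) (fun k => by simp [hAct_isoZero])]
    congr 1
    simp [Nat.cast_sub i.2.le]

lemma lie_gradK_negCompact {x : compactK n} (hx : x ∈ negCompact n) :
    ∃ m : ℕ, 0 < m ∧ ⁅gradK n, x⁆ = -(m : ℂ) • x := by
  rcases hx with ⟨i, j, hij, rfl | rfl⟩ | ⟨i, rfl⟩
  · refine ⟨(n / 2 - i) + (n / 2 - j), by omega, ?_⟩
    rw [lie_gradK (hAct_isoNeg · i) (hAct_isoNeg · j)]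
    congr 1
    simp [mul_add, Finset.sum_add_distrib, Nat.cast_sub i.2.le, Nat.cast_sub j.2.le]
    ring
  · refine ⟨j - i, by omega, ?_⟩
    rw [lie_gradK (hAct_isoNeg · i) (hAct_isoPos · j)]
    congr 1
    simp [mul_add, Finset.sum_add_distrib, Nat.cast_sub (Fin.le_def.1 hij.le)]
  · refine ⟨n / 2 - i, by omega, ?_⟩
    rw [lie_gradK (β := 0) (hAct_isoNeg · i) (fun k => by simp [hAct_isoZero])]
    congr 1
    simp [Nat.cast_sub i.2.le]
end Compact

/-! ### Triangular decomposition of the compact subalgebra -/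

section Spanning
variable {n : ℕ}

lemma single_even_eq (i : Fin (n / 2)) :
    (Pi.single (evenIdx i) 1 : Fin n → ℂ) = (1 / 2 : ℂ) • isoPos i + (1 / 2 : ℂ) • isoNeg i := by
  simp only [isoPos, isoNeg]; module

lemma single_odd_eq (i : Fin (n / 2)) : (Pi.single (oddIdx i) 1 : Fin n → ℂ)
    = (-Complex.I / 2) • isoPos i + (Complex.I / 2) • isoNeg i := by
  have h : (Pi.single (oddIdx i) Complex.I : Fin n → ℂ) = Complex.I • Pi.single (oddIdx i) 1 := by
    rw [← Pi.single_smul]; simp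
  simp only [isoPos, isoNeg, h, smul_add, smul_sub, smul_smul]
  have := Complex.I_mul_I
  match_scalars
  · linear_combination this
  · ring

/-- Each spatial coordinate vector is a combination of the isotropic vectors. -/
lemma single_mem (a : Fin n) : (Pi.single a 1 : Fin n → ℂ) = isoZero n ∨
    ∃ i : Fin (n / 2), i.1 = a.1 / 2 ∧ ∃ c d : ℂ, Pi.single a 1 = c • isoPos i + d • isoNeg i := by
  have ha := a.2
  by_cases h : a.1 / 2 < n / 2
  · right
    refine ⟨⟨a / 2, h⟩, rfl, ?_⟩
    rcases Nat.mod_two_eq_zero_or_one a with h0 | h0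
    · have : a = evenIdx ⟨a / 2, h⟩ := Fin.ext (by simp [evenIdx]; omega)
      exact ⟨_, _, (congrArg (fun b => (Pi.single b 1 : Fin n → ℂ)) this).trans
        (single_even_eq ⟨a / 2, h⟩)⟩
    · have : a = oddIdx ⟨a / 2, h⟩ := Fin.ext (by simp [oddIdx]; omega)
      exact ⟨_, _, (congrArg (fun b => (Pi.single b 1 : Fin n → ℂ)) this).trans
        (single_odd_eq ⟨a / 2, h⟩)⟩
  · left
    have h1 : a.1 + 1 = n := by omega
    have h2 : Odd n := Nat.odd_iff.2 (by omega)
    ext b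
    have : (b = a) ↔ b.1 + 1 = n := by rw [Fin.ext_iff]; omega
    simp only [isoZero, Pi.single_apply, this, h2, true_and]

/-- A coordinate beyond plane `i` is spanned by the isotropic vectors of a later plane or is the
weight-zero vector. This allows the condition of being killed by positive root vectors to be used
coordinate by coordinate. -/
lemma wedge_isoPos_mem_span (i : Fin (n / 2)) (a : Fin n) (ha : 2 * i.1 + 2 ≤ a.1) :
    wedgeSpace (isoPos i) (Pi.single a 1) ∈ Submodule.span ℂ (posCompact n) := by
  rcases single_mem a with h | ⟨j, hj, c, d, h⟩
  · rw [h]; exact Submodule.subset_span (Or.inr ⟨i, rfl⟩)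
  · rw [h, wedgeSpace_eq, map_add, map_smul, map_smul]
    have hij : i < j := Fin.lt_def.2 (by omega)
    exact add_mem (Submodule.smul_mem _ _ (Submodule.subset_span (Or.inl ⟨i, j, hij, Or.inl rfl⟩)))
      (Submodule.smul_mem _ _ (Submodule.subset_span (Or.inl ⟨i, j, hij, Or.inr rfl⟩)))

lemma wedge_isoNeg_mem_span (i : Fin (n / 2)) (a : Fin n) (ha : 2 * i.1 + 2 ≤ a.1) :
    wedgeSpace (isoNeg i) (Pi.single a 1) ∈ Submodule.span ℂ (negCompact n) := by
  rcases single_mem a with h | ⟨j, hj, c, d, h⟩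
  · rw [h]; exact Submodule.subset_span (Or.inr ⟨i, rfl⟩)
  · rw [h, wedgeSpace_eq, map_add, map_smul, map_smul]
    have hij : i < j := Fin.lt_def.2 (by omega)
    exact add_mem (Submodule.smul_mem _ _ (Submodule.subset_span (Or.inl ⟨i, j, hij, Or.inr rfl⟩)))
      (Submodule.smul_mem _ _ (Submodule.subset_span (Or.inl ⟨i, j, hij, Or.inl rfl⟩)))

lemma cartanH_succ (i : Fin (n / 2)) : cartanH n i.succ
    = Complex.I • wedgeSpace (Pi.single (evenIdx i) 1) (Pi.single (oddIdx i) 1) := rfl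

lemma coe_cartanH_zero : (cartanH n 0 : so2 n) = hTime n := rfl

lemma wedge_single_mem_span (a b : Fin n) : wedgeSpace (Pi.single a 1) (Pi.single b 1) ∈
    Submodule.span ℂ (negCompact n ∪ Set.range (cartanH n) ∪ posCompact n) := by
  have hpos : Submodule.span ℂ (posCompact n) ≤
    Submodule.span ℂ (negCompact n ∪ Set.range (cartanH n) ∪ posCompact n) :=
    Submodule.span_mono Set.subset_union_right
  have hneg : Submodule.span ℂ (negCompact n) ≤
    Submodule.span ℂ (negCompact n ∪ Set.range (cartanH n) ∪ posCompact n) :=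
    Submodule.span_mono (Set.subset_union_left.trans Set.subset_union_left)
  wlog hab : a < b generalizing a b
  · rcases eq_or_ne a b with rfl | hne
    · rw [wedgeSpace_self]; exact zero_mem _
    · rw [wedgeSpace_swap]
      exact neg_mem (this b a (lt_of_le_of_ne (not_lt.1 hab) hne.symm))
  have hab' : a.1 < b.1 := hab
  have hb := b.2
  rcases single_mem a with h | ⟨i, hi, c, d, h⟩
  -- The vector of weight zero is the last coordinate vector, which leaves no index `b > a`.
  · exfalso
    have := congrFun h a
    simp [isoZero] at this
    omega
  · by_cases hb2 : 2 * i.1 + 2 ≤ b.1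
    · rw [h, wedgeSpace_eq, map_add, map_smul, map_smul]
      exact add_mem (Submodule.smul_mem _ _ (hpos (wedge_isoPos_mem_span i b hb2)))
        (Submodule.smul_mem _ _ (hneg (wedge_isoNeg_mem_span i b hb2)))
    · have h1 : a = evenIdx i := Fin.ext (by simp [evenIdx]; omega)
      have h2 : b = oddIdx i := Fin.ext (by simp [oddIdx]; omega)
      have h3 : wedgeSpace (Pi.single a 1) (Pi.single b 1) = -Complex.I • cartanH n i.succ := by
        rw [cartanH_succ, smul_smul, h1, h2]; simp
      rw [h3]
      exact Submodule.smul_mem _ _ (Submodule.subset_span (Or.inl (Or.inr ⟨_, rfl⟩)))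

/-- The inclusion of `𝔨` into `𝔤` as a linear map. -/
def kIncl (n : ℕ) : compactK n →ₗ[ℂ] so2 n := (compactK n).toSubmodule.subtype

lemma kIncl_apply (x : compactK n) : kIncl n x = (x : so2 n) := rfl

lemma compactK_decomp (x : compactK n) :
    x = (Complex.I * entry (Sum.inl 0) (Sum.inl 1) (x : so2 n)) • cartanH n 0
      + ∑ j, ∑ k, (-(1 / 2) * entry (Sum.inr j) (Sum.inr k) (x : so2 n)) •
        wedgeSpace (Pi.single j 1) (Pi.single k 1) := by
  have h0 : ∀ i k, entry (Sum.inl i) (Sum.inr k) (x : so2 n) = 0 := x.2.1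
  apply Subtype.ext
  have h := so2_decomp (x : so2 n)
  simp only [h0, mul_zero, sub_zero, add_zero, zero_smul, Finset.sum_const_zero] at h
  refine h.trans (Eq.trans ?_ (kIncl_apply _))
  simp only [map_add, map_sum, map_smul, kIncl_apply, wedgeSpace_single, coe_cartanH_zero]

lemma compactK_span :
    Submodule.span ℂ (negCompact n ∪ Set.range (cartanH n) ∪ posCompact n) = ⊤ := by
  rw [eq_top_iff]
  rintro x -
  rw [compactK_decomp x]
  refine add_mem (Submodule.smul_mem _ _ (Submodule.subset_span (Or.inl (Or.inr ⟨0, rfl⟩))))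
    (sum_mem fun j _ => sum_mem fun k _ => Submodule.smul_mem _ _ (wedge_single_mem_span j k))

end Spanning

set_option linter.unusedSectionVars false

/-! ### Enveloping algebras, eigencomponents and irreducible quotients -/

section Generic
variable {L : Type} [LieRing L] [LieAlgebra ℂ L]

/-- A subspace stable under `ι x` for all `x` is stable under the enveloping algebra. -/
lemma enveloping_smul_mem {M : Type} [AddCommGroup M] [Module ℂ M]
    [Module (UniversalEnvelopingAlgebra ℂ L) M]
    [IsScalarTower ℂ (UniversalEnvelopingAlgebra ℂ L) M] (W : Submodule ℂ M)
    (hW : ∀ (x : L), ∀ w ∈ W, UniversalEnvelopingAlgebra.ι ℂ x • w ∈ W)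
    (u : UniversalEnvelopingAlgebra ℂ L) (w : M) (hw : w ∈ W) : u • w ∈ W := by
  -- The stabiliser of `W` is a subalgebra containing `ι L`. The lift of `ι` into it, composed with
  -- the inclusion, is the identity by the universal property, so the stabiliser is everything.
  let A : Subalgebra ℂ (UniversalEnvelopingAlgebra ℂ L) :=
    { carrier := {u | ∀ w ∈ W, u • w ∈ W}
      mul_mem' := fun {a b} ha hb w hw => by rw [mul_smul]; exact ha _ (hb _ hw)
      add_mem' := fun {a b} ha hb w hw => by rw [add_smul]; exact add_mem (ha _ hw) (hb _ hw)
      algebraMap_mem' := fun c w hw => by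
        rw [algebraMap_smul]; exact W.smul_mem _ hw }
  let f : L →ₗ⁅ℂ⁆ A :=
    { toFun := fun x => ⟨UniversalEnvelopingAlgebra.ι ℂ x, hW x⟩
      map_add' := fun x y => Subtype.ext (map_add _ _ _)
      map_smul' := fun c x => Subtype.ext (map_smul _ _ _)
      map_lie' := fun {x y} => Subtype.ext (LieHom.map_lie _ _ _) }
  have h : A.val.comp (UniversalEnvelopingAlgebra.lift ℂ f) = AlgHom.id ℂ _ := by
    apply UniversalEnvelopingAlgebra.hom_ext
    ext x
    change ((UniversalEnvelopingAlgebra.lift ℂ f) (UniversalEnvelopingAlgebra.ι ℂ x)).1 = _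
    rw [UniversalEnvelopingAlgebra.lift_ι_apply]
    rfl
  have h2 : u = ((UniversalEnvelopingAlgebra.lift ℂ f) u).1 := (DFunLike.congr_fun h u).symm
  rw [h2]
  exact ((UniversalEnvelopingAlgebra.lift ℂ f) u).2 w hw

/-- In an invariant subspace, the component of a vector in one eigenspace belongs to it. -/
lemma mem_of_add_mem_of_eigen {V : Type} [AddCommGroup V] [Module ℂ V] (W : Submodule ℂ V)
    (g : Module.End ℂ V) (hg : ∀ w ∈ W, g w ∈ W) (d : ℂ) {v w : V} (hv : g v = d • v)
    (hw : w ∈ ⨆ e : {e : ℂ // e ≠ d}, Module.End.eigenspace g e.1) (hvw : v + w ∈ W) : v ∈ W := by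
  -- In `V ⧸ W` the class of `v` is minus that of `w`; independence of the eigenspaces of the
  -- induced operator makes it zero.
  let g' : Module.End ℂ (V ⧸ W) := W.mapQ W g hg
  have hind := Module.End.eigenspaces_iSupIndep g' d
  have h1 : W.mkQ v ∈ Module.End.eigenspace g' d := by
    rw [Module.End.mem_eigenspace_iff]
    change W.mkQ (g v) = _
    rw [hv, map_smul]
  have h2 : W.mkQ w ∈ ⨆ e, ⨆ (_ : e ≠ d), Module.End.eigenspace g' e := by
    have : (⨆ e : {e : ℂ // e ≠ d}, Module.End.eigenspace g e.1) ≤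
        (⨆ e, ⨆ (_ : e ≠ d), Module.End.eigenspace g' e).comap W.mkQ := by
      refine iSup_le fun e y hy => ?_
      rw [Module.End.mem_eigenspace_iff] at hy
      refine Submodule.mem_iSup_of_mem e.1 (Submodule.mem_iSup_of_mem e.2 ?_)
      rw [Module.End.mem_eigenspace_iff]
      change W.mkQ (g y) = _
      rw [hy, map_smul]
    exact this hw
  have h3 : W.mkQ v = -W.mkQ w := by
    rw [eq_neg_iff_add_eq_zero, ← map_add]
    exact (Submodule.Quotient.mk_eq_zero W).2 hvw
  have h4 := Submodule.disjoint_def.1 hind _ h1 (h3 ▸ neg_mem h2)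
  simpa using h4

variable {M V : Type} [AddCommGroup M] [Module ℂ M] [LieRingModule L M] [LieModule ℂ L M]
  [AddCommGroup V] [Module ℂ V] [LieRingModule L V] [LieModule ℂ L V]

/-- The span of all words in `T` applied to vectors in `S`. -/
def wordSpan (T : Set L) (S : Set M) : Submodule ℂ M :=
  sInf {Z | S ⊆ Z ∧ ∀ t ∈ T, ∀ z ∈ Z, ⁅t, z⁆ ∈ Z}

lemma subset_wordSpan (T : Set L) (S : Set M) : S ⊆ wordSpan T S :=
  fun _ hs => Submodule.mem_sInf.2 fun _ hZ => hZ.1 hs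

lemma lie_mem_wordSpan_of_mem {T : Set L} {S : Set M} {t : L} (ht : t ∈ T) {z : M}
    (hz : z ∈ wordSpan T S) : ⁅t, z⁆ ∈ wordSpan T S :=
  Submodule.mem_sInf.2 fun Z hZ => hZ.2 t ht z (Submodule.mem_sInf.1 hz Z hZ)

lemma wordSpan_le {T : Set L} {S : Set M} {Z : Submodule ℂ M} (h1 : S ⊆ Z)
    (h2 : ∀ t ∈ T, ∀ z ∈ Z, ⁅t, z⁆ ∈ Z) : wordSpan T S ≤ Z := sInf_le ⟨h1, h2⟩

/-- By the Leibniz rule `x t z = [x,t] z + t x z`, stability under all of `L` passes from `z` to `t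
z`. It therefore needs to be checked only on the generators `S`, and no ordering of words is
required. -/
lemma lie_mem_wordSpan {T : Set L} {S : Set M} (h : ∀ x : L, ∀ s ∈ S, ⁅x, s⁆ ∈ wordSpan T S)
    (x : L) {z : M} (hz : z ∈ wordSpan T S) : ⁅x, z⁆ ∈ wordSpan T S := by
  let Z : Submodule ℂ M :=
    { carrier := {z | z ∈ wordSpan T S ∧ ∀ x : L, ⁅x, z⁆ ∈ wordSpan T S}
      add_mem' := fun {a b} ha hb => ⟨add_mem ha.1 hb.1, fun x => by
        rw [lie_add]; exact add_mem (ha.2 x) (hb.2 x)⟩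
      zero_mem' := ⟨zero_mem _, fun x => by rw [lie_zero]; exact zero_mem _⟩
      smul_mem' := fun c a ha => ⟨Submodule.smul_mem _ _ ha.1, fun x => by
        rw [lie_smul]; exact Submodule.smul_mem _ _ (ha.2 x)⟩ }
  have : wordSpan T S ≤ Z := by
    refine wordSpan_le (fun s hs => ⟨subset_wordSpan T S hs, fun x => h x s hs⟩) ?_
    rintro t ht z ⟨hz, hz'⟩
    refine ⟨lie_mem_wordSpan_of_mem ht hz, fun x => ?_⟩
    rw [leibniz_lie]
    exact add_mem (hz' _) (lie_mem_wordSpan_of_mem ht (hz' x))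
  exact (this hz).2 x

/-- If a surjection onto an irreducible module kills every proper submodule, then its target is
the quotient by the sum of all proper submodules. -/
lemma quotient_sumOfProper_equiv (hV : LieModule.IsIrreducible ℂ L V) (f : M →ₗ⁅ℂ, L⁆ V)
    (hf : Function.Surjective f) (hW : ∀ W : LieSubmodule ℂ L M, W ≠ ⊤ → ∀ w ∈ W, f w = 0) :
    sumOfProper L M = f.ker ∧ Nonempty ((M ⧸ sumOfProper L M) ≃ₗ⁅ℂ, L⁆ V) := by
  have hnt : Nontrivial V := LieModule.nontrivial_of_isIrreducible ℂ L V
  have hker : sumOfProper L M = f.ker := by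
    apply le_antisymm
    · refine sSup_le fun W h w hw => ?_
      exact LieModuleHom.mem_ker.2 (hW W h w hw)
    · refine le_sSup fun h => ?_
      obtain ⟨v, hv⟩ := exists_ne (0 : V)
      obtain ⟨m, rfl⟩ := hf v
      exact hv (LieModuleHom.mem_ker.1 (h ▸ LieSubmodule.mem_top m))
  refine ⟨hker, ?_⟩
  have hker' : (sumOfProper L M).toSubmodule = LinearMap.ker (f : M →ₗ[ℂ] V) := by
    rw [hker]; rfl
  let e : (M ⧸ (sumOfProper L M).toSubmodule) ≃ₗ[ℂ] V :=
    (Submodule.quotEquivOfEq _ _ hker').trans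
      (LinearMap.quotKerEquivOfSurjective (f : M →ₗ[ℂ] V) hf)
  have he : ∀ m, e (Submodule.Quotient.mk m) = f m := fun m => rfl
  refine ⟨{ (e : (M ⧸ (sumOfProper L M).toSubmodule) ≃ₗ[ℂ] V) with map_lie' := ?_ }⟩
  intro x m
  obtain ⟨m, rfl⟩ := Submodule.Quotient.mk_surjective _ m
  change e (Submodule.Quotient.mk ⁅x, m⁆) = ⁅x, e (Submodule.Quotient.mk m)⁆
  rw [he, he, LieModuleHom.map_lie]

lemma isIrreducible_of_equiv (e : M ≃ₗ⁅ℂ, L⁆ V) (hV : LieModule.IsIrreducible ℂ L V) :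
    LieModule.IsIrreducible ℂ L M := by
  have hnt : Nontrivial V := LieModule.nontrivial_of_isIrreducible ℂ L V
  have : Nontrivial M := e.toEquiv.nontrivial
  refine LieModule.IsIrreducible.mk fun N hN => ?_
  have h := IsSimpleOrder.eq_bot_or_eq_top (N.map (e : M →ₗ⁅ℂ, L⁆ V))
  rcases h with h | h
  · exfalso
    apply hN
    rw [LieSubmodule.eq_bot_iff] at h ⊢
    intro m hm
    have := h (e m) (LieSubmodule.mem_map_of_mem hm)
    exact e.injective (this.trans (map_zero (e : M →ₗ⁅ℂ, L⁆ V)).symm)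
  · rw [eq_top_iff]
    rintro m -
    have : e m ∈ N.map (e : M →ₗ⁅ℂ, L⁆ V) := by rw [h]; exact LieSubmodule.mem_top _
    obtain ⟨m', hm', h'⟩ := (LieSubmodule.mem_map _).1 this
    rwa [← e.injective h']
end Generic

/-! ### Verma modules of the compact subalgebra and recognition of `K(μ)` -/

section KModules
variable {n : ℕ} {μ : Fin (n / 2 + 1) → ℂ}

/-- The highest weight vector of the Verma module. -/
def vermaVec (n : ℕ) (μ : Fin (n / 2 + 1) → ℂ) : VermaK n μ :=
  (Submodule.Quotient.mk 1 : UK n ⧸ vermaIdeal n μ)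

lemma verma_lie (x : compactK n) (v : VermaK n μ) :
    ⁅x, v⁆ = UniversalEnvelopingAlgebra.ι ℂ x • v := rfl

lemma lie_vermaVec (x : compactK n) : ⁅x, vermaVec n μ⁆ =
    (Submodule.Quotient.mk (UniversalEnvelopingAlgebra.ι ℂ x) : UK n ⧸ vermaIdeal n μ) := by
  rw [verma_lie]
  change (Submodule.Quotient.mk (UniversalEnvelopingAlgebra.ι ℂ x * 1) : UK n ⧸ vermaIdeal n μ) = _
  rw [mul_one]

lemma posCompact_lie_vermaVec {x : compactK n} (hx : x ∈ posCompact n) :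
    ⁅x, vermaVec n μ⁆ = 0 := by
  rw [lie_vermaVec]
  exact (Submodule.Quotient.mk_eq_zero _).2 (Submodule.subset_span (Or.inl ⟨x, hx, rfl⟩))

lemma cartanH_lie_vermaVec (j : Fin (n / 2 + 1)) :
    ⁅cartanH n j, vermaVec n μ⁆ = μ j • vermaVec n μ := by
  rw [lie_vermaVec]
  refine ((Submodule.Quotient.eq _).2 (Submodule.subset_span (Or.inr ⟨j, ?_⟩)) :
    (Submodule.Quotient.mk _ : UK n ⧸ vermaIdeal n μ)
      = Submodule.Quotient.mk (μ j • (1 : UK n))).trans ?_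
  · simp [Algebra.algebraMap_eq_smul_one]
  · rfl

lemma verma_generated (W : Submodule ℂ (VermaK n μ))
    (hW : ∀ (x : compactK n), ∀ w ∈ W, ⁅x, w⁆ ∈ W) (hv : vermaVec n μ ∈ W) : W = ⊤ := by
  rw [eq_top_iff]
  rintro v -
  obtain ⟨u, rfl⟩ := Submodule.Quotient.mk_surjective (vermaIdeal n μ) v
  have : (Submodule.Quotient.mk u : UK n ⧸ vermaIdeal n μ) = u • vermaVec n μ := by
    change _ = (Submodule.Quotient.mk (u * 1) : UK n ⧸ vermaIdeal n μ)
    rw [mul_one]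
  rw [this]
  exact enveloping_smul_mem W hW u _ hv

/-- The Cartan elements scale the top vector and the positive root vectors kill it, so by the
triangular decomposition the span of negative words is stable under all of `𝔨`. -/
lemma verma_wordSpan : wordSpan (negCompact n) {vermaVec n μ} = ⊤ := by
  have hv : vermaVec n μ ∈ wordSpan (negCompact n) {vermaVec n μ} := subset_wordSpan _ _ rfl
  refine verma_generated _ (fun x w hw => lie_mem_wordSpan ?_ x hw) hv
  rintro x s rfl
  have hx : x ∈ Submodule.span ℂ (negCompact n ∪ Set.range (cartanH n) ∪ posCompact n) := by
    rw [compactK_span]; trivial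
  induction hx using Submodule.span_induction with
  | mem x hx =>
    rcases hx with (hx | ⟨j, rfl⟩) | hx
    · exact lie_mem_wordSpan_of_mem hx hv
    · rw [cartanH_lie_vermaVec]; exact Submodule.smul_mem _ _ hv
    · rw [posCompact_lie_vermaVec hx]; exact zero_mem _
  | zero => rw [zero_lie]; exact zero_mem _
  | add x y _ _ hx hy => rw [add_lie]; exact add_mem hx hy
  | smul c x _ hx => rw [smul_lie]; exact Submodule.smul_mem _ _ hx

/-- The eigenvalue of the grading element on the highest weight vector. -/
def gradVal (n : ℕ) (μ : Fin (n / 2 + 1) → ℂ) : ℂ :=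
  ∑ i : Fin (n / 2), ((n / 2 : ℕ) - (i.1 : ℂ)) * μ i.succ

/-- The action of the grading element. -/
def gradEnd (n : ℕ) (M : Type) [AddCommGroup M] [Module ℂ M] [LieRingModule (compactK n) M]
    [LieModule ℂ (compactK n) M] : Module.End ℂ M := LieModule.toEnd ℂ (compactK n) M (gradK n)

lemma gradK_lie_vec {M : Type} [AddCommGroup M] [Module ℂ M] [LieRingModule (compactK n) M]
    [LieModule ℂ (compactK n) M] {v : M} (hv : ∀ j, ⁅cartanH n j, v⁆ = μ j • v) :
    gradEnd n M v = gradVal n μ • v := by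
  change ⁅gradK n, v⁆ = _
  rw [gradK, sum_lie, gradVal, Finset.sum_smul]
  exact Finset.sum_congr rfl fun i _ => by rw [smul_lie, hv, smul_smul]

/-- Each negative root vector lowers the grading by a positive integer, so among words in them only
the empty one keeps the top eigenvalue. -/
lemma verma_decomp (w : VermaK n μ) : ∃ (c : ℂ) (y : VermaK n μ), w = c • vermaVec n μ + y ∧
    y ∈ ⨆ m : {m : ℕ // 0 < m}, Module.End.eigenspace (gradEnd n (VermaK n μ))
      (gradVal n μ - (m.1 : ℂ)) := by
  set Y := ⨆ m : {m : ℕ // 0 < m}, Module.End.eigenspace (gradEnd n (VermaK n μ))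
      (gradVal n μ - (m.1 : ℂ)) with hY
  have hstep : ∀ x ∈ negCompact n, ∀ (m : ℕ) (y : VermaK n μ),
      gradEnd n (VermaK n μ) y = (gradVal n μ - (m : ℂ)) • y → ⁅x, y⁆ ∈ Y := by
    intro x hx m y hy
    obtain ⟨k, hk, hxk⟩ := lie_gradK_negCompact hx
    refine Submodule.mem_iSup_of_mem ⟨m + k, by omega⟩ ?_
    rw [Module.End.mem_eigenspace_iff]
    change ⁅gradK n, ⁅x, y⁆⁆ = _
    change ⁅gradK n, y⁆ = _ at hy
    rw [leibniz_lie, hxk, hy, smul_lie, lie_smul]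
    push_cast
    module
  have htop : wordSpan (negCompact n) {vermaVec n μ} ≤ Submodule.span ℂ {vermaVec n μ} ⊔ Y := by
    refine wordSpan_le ?_ ?_
    · rintro _ rfl
      exact Submodule.mem_sup_left (Submodule.mem_span_singleton_self _)
    · intro x hx z hz
      refine Submodule.mem_sup_right ?_
      have h1 : Submodule.span ℂ {vermaVec n μ} ⊔ Y
          ≤ Y.comap (LieModule.toEnd ℂ (compactK n) (VermaK n μ) x) := by
        refine sup_le ?_ (iSup_le fun m y hy => ?_)
        · rw [Submodule.span_singleton_le_iff_mem]
          refine hstep x hx 0 _ ?_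
          rw [gradK_lie_vec cartanH_lie_vermaVec]; simp
        · exact hstep x hx m y (Module.End.mem_eigenspace_iff.1 hy)
      exact h1 hz
  rw [verma_wordSpan] at htop
  obtain ⟨a, ha, y, hy, h⟩ := Submodule.mem_sup.1 (htop (Submodule.mem_top (x := w)))
  obtain ⟨c, rfl⟩ := Submodule.mem_span_singleton.1 ha
  exact ⟨c, y, h.symm, hy⟩

section Lift
variable {V : Type} [AddCommGroup V] [Module ℂ V] [LieRingModule (compactK n) V]
  [LieModule ℂ (compactK n) V]

/-- The map is `u ↦ u v`; the two hypotheses say that it kills the generators of the left ideal. -/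
lemma exists_verma_hom (v : V) (hpos : ∀ x ∈ posCompact n, ⁅x, v⁆ = 0)
    (hwt : ∀ j, ⁅cartanH n j, v⁆ = μ j • v) :
    ∃ f : VermaK n μ →ₗ⁅ℂ, compactK n⁆ V, f (vermaVec n μ) = v := by
  let a : UK n →ₐ[ℂ] Module.End ℂ V :=
    UniversalEnvelopingAlgebra.lift ℂ (LieModule.toEnd ℂ (compactK n) V)
  have ha : ∀ x w, a (UniversalEnvelopingAlgebra.ι ℂ x) w = ⁅x, w⁆ := fun x w =>
    DFunLike.congr_fun
      (UniversalEnvelopingAlgebra.lift_ι_apply ℂ (LieModule.toEnd ℂ (compactK n) V) x) w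
  let p : UK n →ₗ[ℂ] V := (LinearMap.applyₗ v).comp a.toLinearMap
  have hp : ∀ u, p u = a u v := fun u => rfl
  have hker : ∀ u ∈ vermaIdeal n μ, p u = 0 := by
    intro u hu
    induction hu using Submodule.span_induction with
    | mem u hu =>
      rcases hu with ⟨x, hx, rfl⟩ | ⟨j, rfl⟩
      · rw [hp, ha, hpos x hx]
      · rw [hp, map_sub, LinearMap.sub_apply, ha, hwt, AlgHom.commutes,
          Module.algebraMap_end_apply, sub_self]
    | zero => exact map_zero p
    | add x y _ _ hx hy => rw [map_add, hx, hy, add_zero]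
    | smul c x _ hx =>
      rw [hp, smul_eq_mul, map_mul, Module.End.mul_apply, ← hp, hx, map_zero]
  let q : VermaK n μ →ₗ[ℂ] V :=
    ((vermaIdeal n μ).restrictScalars ℂ).liftQ p (fun u hu => LinearMap.mem_ker.2 (hker u hu))
  have hq : ∀ u : UK n, q (Submodule.Quotient.mk u : UK n ⧸ vermaIdeal n μ) = a u v := fun u => rfl
  refine ⟨{ q with map_lie' := ?_ }, ?_⟩
  · intro x w
    obtain ⟨u, rfl⟩ := Submodule.Quotient.mk_surjective (vermaIdeal n μ) w
    change q (Submodule.Quotient.mk (UniversalEnvelopingAlgebra.ι ℂ x * u) :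
      UK n ⧸ vermaIdeal n μ) = ⁅x, q (Submodule.Quotient.mk u : UK n ⧸ vermaIdeal n μ)⁆
    rw [hq, hq, map_mul, Module.End.mul_apply, ha]
  · change q (Submodule.Quotient.mk 1 : UK n ⧸ vermaIdeal n μ) = v
    rw [hq, map_one, Module.End.one_apply]

/-- An irreducible `𝔨`-module with a highest weight vector of weight `μ` is `K(μ)`. -/
theorem KMod_equiv (hV : LieModule.IsIrreducible ℂ (compactK n) V) (v : V) (hv : v ≠ 0)
    (hpos : ∀ x ∈ posCompact n, ⁅x, v⁆ = 0) (hwt : ∀ j, ⁅cartanH n j, v⁆ = μ j • v) :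
    Nonempty (KMod n μ ≃ₗ⁅ℂ, compactK n⁆ V) := by
  obtain ⟨f, hf⟩ := exists_verma_hom v hpos hwt
  -- A vector over `v` is `c` times the top vector plus terms of lower grading. Comparing gradings
  -- in `V` forces `c = 1`; the grading operator then separates the top vector inside `W`, and that
  -- vector generates.
  have key : ∀ W : LieSubmodule ℂ (compactK n) (VermaK n μ), (∃ w ∈ W, f w = v) → W = ⊤ := by
    rintro W ⟨w, hw, hfw⟩
    obtain ⟨c, y, rfl, hy⟩ := verma_decomp w
    have hgrad : ∀ (m : VermaK n μ), f (gradEnd n _ m) = gradEnd n V (f m) :=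
      fun m => f.map_lie _ _
    have hlt : ∀ m : {m : ℕ // 0 < m}, gradVal n μ - (m.1 : ℂ) ≠ gradVal n μ := by
      intro m h
      have : (m.1 : ℂ) = 0 := by linear_combination -h
      exact m.2.ne' (by exact_mod_cast this)
    have hyV : f y ∈ ⨆ e : {e : ℂ // e ≠ gradVal n μ}, Module.End.eigenspace (gradEnd n V) e.1 := by
      have : (⨆ m : {m : ℕ // 0 < m}, Module.End.eigenspace (gradEnd n (VermaK n μ))
          (gradVal n μ - (m.1 : ℂ))) ≤ (⨆ e : {e : ℂ // e ≠ gradVal n μ},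
            Module.End.eigenspace (gradEnd n V) e.1).comap (f : VermaK n μ →ₗ[ℂ] V) := by
        refine iSup_le fun m z hz => Submodule.mem_iSup_of_mem ⟨_, hlt m⟩ ?_
        rw [Module.End.mem_eigenspace_iff] at hz ⊢
        change gradEnd n V (f z) = _ • f z
        rw [← hgrad, hz, map_smul]
      exact this hy
    have hc : c = 1 := by
      have h1 : (c - 1) • v + f y = 0 := by
        rw [map_add, map_smul, hf] at hfw
        rw [sub_smul, one_smul, sub_add_eq_add_sub, hfw, sub_self]
      have h2 := mem_of_add_mem_of_eigen (⊥ : Submodule ℂ V) (gradEnd n V)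
        (fun w hw => by rw [Submodule.mem_bot] at hw ⊢; rw [hw, map_zero]) (gradVal n μ)
        (v := (c - 1) • v) (by rw [map_smul, gradK_lie_vec hwt, smul_comm]) hyV
        (by rw [h1]; exact zero_mem _)
      rw [Submodule.mem_bot, smul_eq_zero] at h2
      rcases h2 with h2 | h2
      · exact sub_eq_zero.1 h2
      · exact absurd h2 hv
    have hyM : y ∈ ⨆ e : {e : ℂ // e ≠ gradVal n μ},
        Module.End.eigenspace (gradEnd n (VermaK n μ)) e.1 :=
      (iSup_le fun m => le_iSup (fun e : {e : ℂ // e ≠ gradVal n μ} =>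
        Module.End.eigenspace (gradEnd n (VermaK n μ)) e.1) ⟨_, hlt m⟩ :
          (⨆ m : {m : ℕ // 0 < m}, Module.End.eigenspace (gradEnd n (VermaK n μ))
          (gradVal n μ - (m.1 : ℂ))) ≤ _) hy
    have := mem_of_add_mem_of_eigen W.toSubmodule (gradEnd n (VermaK n μ))
      (fun w hw => W.lie_mem hw) (gradVal n μ) (v := vermaVec n μ)
      (gradK_lie_vec cartanH_lie_vermaVec) hyM (by rw [hc, one_smul] at hw; exact hw)
    have h3 := verma_generated W.toSubmodule (fun x w hw => W.lie_mem hw) this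
    exact (LieSubmodule.toSubmodule_eq_top _).1 h3
  have hrange : f.range = ⊤ := by
    have hb : f.range ≠ ⊥ := by
      intro h
      have : v ∈ f.range := ⟨vermaVec n μ, hf⟩
      rw [h] at this
      exact hv ((LieSubmodule.mem_bot _).1 this)
    exact (IsSimpleOrder.eq_bot_or_eq_top f.range).resolve_left hb
  have hsurj : Function.Surjective f := fun w => by
    have : w ∈ f.range := by rw [hrange]; exact LieSubmodule.mem_top _
    exact this
  refine (quotient_sumOfProper_equiv hV f hsurj fun W hW => ?_).2
  -- If `f` is nonzero on `W`, then `f(W)` is all of `V` by irreducibility and contains `v`, so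
  -- `key` makes `W` improper.
  by_contra! hcon
  obtain ⟨w, hw, hw0⟩ := hcon
  apply hW
  apply key
  have : W.map f = ⊤ := by
    refine (IsSimpleOrder.eq_bot_or_eq_top (W.map f)).resolve_left fun h => hw0 ?_
    have : f w ∈ W.map f := LieSubmodule.mem_map_of_mem hw
    rw [h] at this
    exact (LieSubmodule.mem_bot _).1 this
  have hv' : v ∈ W.map f := by rw [this]; exact LieSubmodule.mem_top _
  exact (LieSubmodule.mem_map _).1 hv'
end Lift
end KModules

/-! ### The induced module and its universal property -/

section NModules
variable {n : ℕ} {μ : Fin (n / 2 + 1) → ℂ}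

/-- The inclusion `v ↦ 1 ⊗ v` of `K(μ)` into `N(μ)`. -/
def inclK (n : ℕ) (μ : Fin (n / 2 + 1) → ℂ) : KMod n μ →ₗ[ℂ] NMod n μ :=
  ((inducedRel n μ).mkQ.restrictScalars ℂ).comp (TensorProduct.mk ℂ (UG n) (KMod n μ) 1)

lemma inclK_apply (v : KMod n μ) : inclK n μ v =
    (Submodule.Quotient.mk (1 ⊗ₜ[ℂ] v) : (UG n ⊗[ℂ] KMod n μ) ⧸ inducedRel n μ) := rfl

lemma smul_inclK (u : UG n) (v : KMod n μ) : u • inclK n μ v =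
    (Submodule.Quotient.mk (u ⊗ₜ[ℂ] v) : (UG n ⊗[ℂ] KMod n μ) ⧸ inducedRel n μ) := by
  rw [inclK_apply]
  change (Submodule.Quotient.mk ((u * 1) ⊗ₜ[ℂ] v) : (UG n ⊗[ℂ] KMod n μ) ⧸ inducedRel n μ) = _
  rw [mul_one]

lemma NMod_lie (x : so2 n) (v : NMod n μ) : ⁅x, v⁆ = UniversalEnvelopingAlgebra.ι ℂ x • v := rfl

lemma compact_lie_inclK (x : compactK n) (v : KMod n μ) :
    ⁅(x : so2 n), inclK n μ v⁆ = inclK n μ ⁅x, v⁆ := by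
  rw [NMod_lie, smul_inclK, inclK_apply]
  refine (Submodule.Quotient.eq _).2 (Submodule.subset_span (Or.inl ⟨1, x, v, ?_⟩))
  rw [one_mul]

lemma pPlus_lie_inclK (k : Fin n) (v : KMod n μ) : ⁅(pPlus k : so2 n), inclK n μ v⁆ = 0 := by
  rw [NMod_lie, smul_inclK]
  refine (Submodule.Quotient.mk_eq_zero _).2 (Submodule.subset_span (Or.inr ⟨1, k, v, ?_⟩))
  rw [one_mul]

lemma NMod_generated (W : Submodule ℂ (NMod n μ))
    (hW : ∀ (x : so2 n), ∀ w ∈ W, ⁅x, w⁆ ∈ W) (hv : ∀ v, inclK n μ v ∈ W) : W = ⊤ := by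
  rw [eq_top_iff]
  rintro w -
  obtain ⟨t, rfl⟩ := Submodule.Quotient.mk_surjective (inducedRel n μ) w
  induction t with
  | zero => exact zero_mem W
  | tmul u v => rw [← smul_inclK]; exact enveloping_smul_mem W hW u _ (hv v)
  | add a b ha hb => exact add_mem ha hb

/-- The universal property of the induced module. -/
theorem exists_NMod_hom {Y : Type} [AddCommGroup Y] [Module ℂ Y] [LieRingModule (so2 n) Y]
    [LieModule ℂ (so2 n) Y] (φ : KMod n μ →ₗ[ℂ] Y)
    (hk : ∀ (x : compactK n) v, φ ⁅x, v⁆ = ⁅(x : so2 n), φ v⁆)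
    (hp : ∀ (k : Fin n) v, ⁅(pPlus k : so2 n), φ v⁆ = 0) :
    ∃ f : NMod n μ →ₗ⁅ℂ, so2 n⁆ Y, ∀ v, f (inclK n μ v) = φ v := by
  let a : UG n →ₐ[ℂ] Module.End ℂ Y :=
    UniversalEnvelopingAlgebra.lift ℂ (LieModule.toEnd ℂ (so2 n) Y)
  have ha : ∀ x w, a (UniversalEnvelopingAlgebra.ι ℂ x) w = ⁅x, w⁆ := fun x w =>
    DFunLike.congr_fun
      (UniversalEnvelopingAlgebra.lift_ι_apply ℂ (LieModule.toEnd ℂ (so2 n) Y) x) w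
  let p : UG n ⊗[ℂ] KMod n μ →ₗ[ℂ] Y :=
    TensorProduct.lift ((LinearMap.lcomp ℂ Y φ).comp a.toLinearMap)
  have hp1 : ∀ u v, p (u ⊗ₜ[ℂ] v) = a u (φ v) := fun u v => rfl
  have hp2 : ∀ (u : UG n) t, p (u • t) = a u (p t) := by
    intro u t
    induction t with
    | zero => rw [smul_zero, map_zero, map_zero]
    | tmul u' v =>
      change p ((u * u') ⊗ₜ[ℂ] v) = _
      rw [hp1, hp1, map_mul, Module.End.mul_apply]
    | add s t hs ht => rw [smul_add, map_add, hs, ht, map_add, map_add]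
  have hker : ∀ t ∈ inducedRel n μ, p t = 0 := by
    intro t ht
    induction ht using Submodule.span_induction with
    | mem t ht =>
      rcases ht with ⟨u, x, v, rfl⟩ | ⟨u, k, v, rfl⟩
      · rw [map_sub, hp1, hp1, map_mul, Module.End.mul_apply, ha, hk, sub_self]
      · rw [hp1, map_mul, Module.End.mul_apply, ha, hp, map_zero]
    | zero => exact map_zero p
    | add x y _ _ hx hy => rw [map_add, hx, hy, add_zero]
    | smul c x _ hx => rw [hp2, hx, map_zero]
  let q : NMod n μ →ₗ[ℂ] Y :=
    ((inducedRel n μ).restrictScalars ℂ).liftQ p (fun u hu => LinearMap.mem_ker.2 (hker u hu))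
  have hq : ∀ t, q (Submodule.Quotient.mk t : (UG n ⊗[ℂ] KMod n μ) ⧸ inducedRel n μ) = p t :=
    fun t => rfl
  refine ⟨{ q with map_lie' := ?_ }, ?_⟩
  · intro x w
    obtain ⟨t, rfl⟩ := Submodule.Quotient.mk_surjective (inducedRel n μ) w
    change q (Submodule.Quotient.mk (UniversalEnvelopingAlgebra.ι ℂ x • t) :
      (UG n ⊗[ℂ] KMod n μ) ⧸ inducedRel n μ)
      = ⁅x, q (Submodule.Quotient.mk t : (UG n ⊗[ℂ] KMod n μ) ⧸ inducedRel n μ)⁆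
    rw [hq, hq, hp2, ha]
  · intro v
    change q (Submodule.Quotient.mk (1 ⊗ₜ[ℂ] v) : (UG n ⊗[ℂ] KMod n μ) ⧸ inducedRel n μ) = φ v
    rw [hq, hp1, map_one, Module.End.one_apply]
end NModules

/-! ### Clifford, differential and conformal operators on spinor polynomials -/

section Operators

/-- Occupation numbers of the fermionic modes. -/
abbrev Bits (n : ℕ) : Type := Fin ((n + 1) / 2) → Bool

/-- Polynomials with values in the Fock space of spinors. -/
abbrev Poly (n : ℕ) : Type := Bits n → MvPolynomial (Fin n) ℂ

/-- The mode to which a coordinate belongs. -/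
def half {n : ℕ} (a : Fin n) : Fin ((n + 1) / 2) := ⟨a.1 / 2, by omega⟩

/-- The sign of an occupation number. -/
def bsgn (x : Bool) : ℂ := if x then 1 else -1

/-- Change one occupation number. -/
def bflip {n : ℕ} (i : Fin ((n + 1) / 2)) (b : Bits n) : Bits n := Function.update b i (!b i)

/-- The sign string of the Jordan-Wigner transformation. -/
def strg {n : ℕ} (i : Fin ((n + 1) / 2)) (b : Bits n) : ℂ :=
  ∏ j ∈ Finset.univ.filter (· < i), bsgn (b j)

/-- The chirality of an occupation pattern. -/
def par {n : ℕ} (b : Bits n) : ℂ := ∏ j, bsgn (b j)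

/-- The phase of a Clifford generator. -/
def phase {n : ℕ} (a : Fin n) (x : Bool) : ℂ :=
  if a.1 % 2 = 0 then 1 else if x then -Complex.I else Complex.I

variable {n : ℕ}

lemma bsgn_not (x : Bool) : bsgn (!x) = -bsgn x := by cases x <;> simp [bsgn]

lemma bsgn_mul_self (x : Bool) : bsgn x * bsgn x = 1 := by cases x <;> simp [bsgn]

lemma bflip_bflip (i : Fin ((n + 1) / 2)) (b : Bits n) : bflip i (bflip i b) = b := by
  ext j; by_cases h : j = i
  · subst h; simp [bflip]
  · simp [bflip, h]

lemma bflip_comm (i j : Fin ((n + 1) / 2)) (b : Bits n) :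
    bflip i (bflip j b) = bflip j (bflip i b) := by
  rcases eq_or_ne i j with rfl | h
  · rfl
  · ext k
    by_cases h1 : k = i
    · subst h1; simp [bflip, h]
    · by_cases h2 : k = j
      · subst h2; simp [bflip, h1]
      · simp [bflip, h1, h2]

lemma bflip_self (i : Fin ((n + 1) / 2)) (b : Bits n) : bflip i b i = !b i := by simp [bflip]

lemma bflip_ne {i j : Fin ((n + 1) / 2)} (h : j ≠ i) (b : Bits n) : bflip i b j = b j := by
  simp [bflip, h]

lemma strg_bflip_lt {i j : Fin ((n + 1) / 2)} (h : j < i) (b : Bits n) :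
    strg i (bflip j b) = -strg i b := by
  have hj : j ∈ Finset.univ.filter (· < i) := by simpa using h
  rw [strg, strg, ← Finset.mul_prod_erase _ _ hj, ← Finset.mul_prod_erase _ _ hj, bflip_self,
    bsgn_not, neg_mul]
  congr 2
  exact Finset.prod_congr rfl fun k hk => by rw [bflip_ne (Finset.ne_of_mem_erase hk)]

lemma strg_bflip_ge {i j : Fin ((n + 1) / 2)} (h : i ≤ j) (b : Bits n) :
    strg i (bflip j b) = strg i b := by
  refine Finset.prod_congr rfl fun k hk => ?_
  rw [bflip_ne]
  have : k < i := by simpa using hk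
  exact (lt_of_lt_of_le this h).ne

lemma strg_mul_self (i : Fin ((n + 1) / 2)) (b : Bits n) : strg i b * strg i b = 1 := by
  rw [strg, ← Finset.prod_mul_distrib]
  exact Finset.prod_eq_one fun j _ => bsgn_mul_self _

lemma par_bflip (j : Fin ((n + 1) / 2)) (b : Bits n) : par (bflip j b) = -par b := by
  rw [par, par, ← Finset.mul_prod_erase _ _ (Finset.mem_univ j),
    ← Finset.mul_prod_erase _ _ (Finset.mem_univ j), bflip_self, bsgn_not, neg_mul]
  congr 2
  exact Finset.prod_congr rfl fun k hk => by rw [bflip_ne (Finset.ne_of_mem_erase hk)]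

/-- Multiplication by a coordinate. -/
def mulX (k : Fin n) : Module.End ℂ (Poly n) :=
  (LinearMap.mulLeft ℂ (MvPolynomial.X k : MvPolynomial (Fin n) ℂ)).compLeft (Bits n)

/-- Partial derivatives. -/
def der (k : Fin n) : Module.End ℂ (Poly n) :=
  ((MvPolynomial.pderiv k : Derivation ℂ (MvPolynomial (Fin n) ℂ) _) :
    MvPolynomial (Fin n) ℂ →ₗ[ℂ] MvPolynomial (Fin n) ℂ).compLeft (Bits n)

/-- The generators of the Clifford algebra. -/
def gam (a : Fin n) : Module.End ℂ (Poly n) where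
  toFun F b := (strg (half a) b * phase a (b (half a))) • F (bflip (half a) b)
  map_add' F G := by ext1 b; simp only [Pi.add_apply, smul_add]
  map_smul' c F := by ext1 b; simp only [Pi.smul_apply, RingHom.id_apply]; rw [smul_comm]

/-- The chirality operator. -/
def chi (n : ℕ) : Module.End ℂ (Poly n) where
  toFun F b := par b • F b
  map_add' F G := by ext1 b; simp only [Pi.add_apply, smul_add]
  map_smul' c F := by ext1 b; simp only [Pi.smul_apply, RingHom.id_apply]; rw [smul_comm]

lemma mulX_apply (k : Fin n) (F : Poly n) (b : Bits n) :
    mulX k F b = MvPolynomial.X k * F b := rfl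

lemma der_apply (k : Fin n) (F : Poly n) (b : Bits n) :
    der k F b = MvPolynomial.pderiv k (F b) := rfl

lemma gam_apply (a : Fin n) (F : Poly n) (b : Bits n) : gam a F b =
    (strg (half a) b * phase a (b (half a))) • F (bflip (half a) b) := rfl

lemma chi_apply (F : Poly n) (b : Bits n) : chi n F b = par b • F b := rfl

/-- Kronecker's delta. -/
def dlt (j k : Fin n) : ℂ := if j = k then 1 else 0

lemma dlt_comm (j k : Fin n) : dlt j k = dlt k j := by simp [dlt, eq_comm]

lemma dlt_self (j : Fin n) : dlt j j = 1 := by simp [dlt]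

lemma sum_dlt_smul {M : Type} [AddCommGroup M] [Module ℂ M] (j : Fin n) (f : Fin n → M) :
    ∑ k, dlt j k • f k = f j := by simp [dlt]

lemma sum_dlt_smul' {M : Type} [AddCommGroup M] [Module ℂ M] (j : Fin n) (f : Fin n → M) :
    ∑ k, dlt k j • f k = f j := by simp [dlt]

lemma mulX_comm (j k : Fin n) (F : Poly n) : mulX j (mulX k F) = mulX k (mulX j F) := by
  ext1 b; simp only [mulX_apply]; ring

lemma der_comm (j k : Fin n) (F : Poly n) : der j (der k F) = der k (der j F) := by
  ext1 b; ext m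
  simp only [der_apply, MvPolynomial.coeff_pderiv, Finsupp.add_apply]
  rcases eq_or_ne j k with rfl | h
  · rfl
  · rw [add_right_comm m]
    simp [h, h.symm]
    ring

lemma der_mulX (j k : Fin n) (F : Poly n) :
    der j (mulX k F) = mulX k (der j F) + dlt j k • F := by
  ext1 b
  simp only [der_apply, mulX_apply, Pi.add_apply, Pi.smul_apply, MvPolynomial.pderiv_mul,
    MvPolynomial.pderiv_X, dlt, Pi.single_apply, eq_comm (a := j)]
  split_ifs <;> simp [add_comm]

lemma gam_mulX (a k : Fin n) (F : Poly n) : gam a (mulX k F) = mulX k (gam a F) := by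
  ext1 b; simp only [gam_apply, mulX_apply, mul_smul_comm]

lemma der_gam (k a : Fin n) (F : Poly n) : der k (gam a F) = gam a (der k F) := by
  ext1 b; simp only [gam_apply, der_apply, Derivation.map_smul]

lemma chi_mulX (k : Fin n) (F : Poly n) : chi n (mulX k F) = mulX k (chi n F) := by
  ext1 b; simp only [chi_apply, mulX_apply, mul_smul_comm]

lemma chi_der (k : Fin n) (F : Poly n) : chi n (der k F) = der k (chi n F) := by
  ext1 b; simp only [chi_apply, der_apply, Derivation.map_smul]

lemma chi_gam (a : Fin n) (F : Poly n) : chi n (gam a F) = -gam a (chi n F) := by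
  ext1 b
  simp only [chi_apply, gam_apply, Pi.neg_apply, par_bflip, smul_smul, ← neg_smul]
  congr 1; ring

/-- This is the Jordan-Wigner mechanism: flipping a lower mode reverses the sign string of a higher
mode, while flipping the higher one leaves the lower string alone. -/
lemma gam_gam_aux {a c : Fin n} (h : half a < half c) (F : Poly n) :
    gam a (gam c F) = -gam c (gam a F) := by
  ext1 b
  simp only [gam_apply, Pi.neg_apply, smul_smul, ← neg_smul]
  rw [bflip_comm, strg_bflip_lt h, strg_bflip_ge h.le, bflip_ne h.ne', bflip_ne h.ne]
  congr 1; ring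

lemma gam_gam (a c : Fin n) (F : Poly n) :
    gam a (gam c F) = -gam c (gam a F) + (2 * dlt a c) • F := by
  rcases lt_trichotomy (half a) (half c) with h | h | h
  · have : a ≠ c := fun h' => by simp [h'] at h
    rw [gam_gam_aux h]; simp [dlt, this]
  -- Two generators of the same mode act as the first or second Pauli matrix, according to parity;
  -- the strings square to one and a case check remains.
  · have hac : a = c ↔ a.1 % 2 = c.1 % 2 := by
      rw [Fin.ext_iff]
      have := congrArg Fin.val h
      simp only [half] at this
      omega
    ext1 b
    simp only [gam_apply, Pi.neg_apply, Pi.add_apply, Pi.smul_apply, smul_smul, ← neg_smul]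
    rw [h, bflip_bflip, strg_bflip_ge le_rfl, bflip_self, ← add_smul]
    congr 1
    have hs := strg_mul_self (half c) b
    have hI := Complex.I_mul_I
    rcases Nat.mod_two_eq_zero_or_one a with ha | ha <;>
      rcases Nat.mod_two_eq_zero_or_one c with hc | hc <;> cases b (half c) <;>
      simp [phase, dlt, hac, ha, hc]
    · linear_combination 2 * hs
    · linear_combination 2 * hs
    · ring
    · ring
    · ring
    · ring
    · linear_combination 2 * hs - 2 * (strg (half c) b) ^ 2 * hI
    · linear_combination 2 * hs - 2 * (strg (half c) b) ^ 2 * hI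
  · have : a ≠ c := fun h' => by simp [h'] at h
    rw [gam_gam_aux h]; simp [dlt, this]

lemma gam_sq (a : Fin n) (F : Poly n) : gam a (gam a F) = F := by
  have h := gam_gam a a F
  rw [dlt_self] at h
  have h2 : (2 : ℂ) • gam a (gam a F) = (2 : ℂ) • F := by
    rw [two_smul]; nth_rewrite 1 [h]; module
  exact smul_right_injective _ (two_ne_zero) h2

/-- The Dirac operator. -/
def dirac (n : ℕ) : Module.End ℂ (Poly n) := ∑ k, gam k ∘ₗ der k

/-- Clifford multiplication by the position vector. -/
def xs (n : ℕ) : Module.End ℂ (Poly n) := ∑ k, gam k ∘ₗ mulX k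

/-- The Euler operator. -/
def eul (n : ℕ) : Module.End ℂ (Poly n) := ∑ k, mulX k ∘ₗ der k

lemma dirac_apply (F : Poly n) : dirac n F = ∑ k, gam k (der k F) := by
  simp [dirac, LinearMap.sum_apply]

lemma xs_apply (F : Poly n) : xs n F = ∑ k, gam k (mulX k F) := by
  simp [xs, LinearMap.sum_apply]

lemma eul_apply (F : Poly n) : eul n F = ∑ k, mulX k (der k F) := by
  simp [eul, LinearMap.sum_apply]

lemma dirac_mulX (k : Fin n) (F : Poly n) :
    dirac n (mulX k F) = mulX k (dirac n F) + gam k F := by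
  simp only [dirac_apply, der_mulX, map_add, map_smul, gam_mulX, Finset.sum_add_distrib, map_sum,
    sum_dlt_smul']

lemma der_dirac (k : Fin n) (F : Poly n) : der k (dirac n F) = dirac n (der k F) := by
  simp only [dirac_apply, map_sum, der_gam, der_comm k]

lemma dirac_gam (k : Fin n) (F : Poly n) :
    dirac n (gam k F) = -gam k (dirac n F) + (2 : ℂ) • der k F := by
  simp only [dirac_apply, der_gam, map_sum, gam_gam _ k, Finset.sum_add_distrib,
    Finset.sum_neg_distrib, mul_smul, ← Finset.smul_sum, sum_dlt_smul']

lemma eul_mulX (k : Fin n) (F : Poly n) : eul n (mulX k F) = mulX k (eul n F) + mulX k F := by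
  simp only [eul_apply, der_mulX, map_add, map_smul, mulX_comm _ k, Finset.sum_add_distrib, map_sum,
    sum_dlt_smul']

lemma der_eul (k : Fin n) (F : Poly n) : der k (eul n F) = eul n (der k F) + der k F := by
  simp only [eul_apply, der_mulX, Finset.sum_add_distrib, map_sum, sum_dlt_smul, der_comm k]

lemma eul_gam (k : Fin n) (F : Poly n) : eul n (gam k F) = gam k (eul n F) := by
  simp only [eul_apply, map_sum, der_gam, gam_mulX]

lemma dirac_eul (F : Poly n) : dirac n (eul n F) = eul n (dirac n F) + dirac n F := by
  rw [dirac_apply, dirac_apply, map_sum]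
  simp only [der_eul, map_add, Finset.sum_add_distrib, eul_gam]

lemma xs_mulX (k : Fin n) (F : Poly n) : xs n (mulX k F) = mulX k (xs n F) := by
  simp only [xs_apply, map_sum, gam_mulX, mulX_comm k]

lemma der_xs (k : Fin n) (F : Poly n) : der k (xs n F) = xs n (der k F) + gam k F := by
  simp only [xs_apply, map_sum, der_gam, der_mulX, map_add, map_smul, Finset.sum_add_distrib,
    sum_dlt_smul]

lemma xs_gam (k : Fin n) (F : Poly n) :
    xs n (gam k F) = -gam k (xs n F) + (2 : ℂ) • mulX k F := by
  simp only [xs_apply, ← gam_mulX, map_sum, gam_gam _ k, Finset.sum_add_distrib,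
    Finset.sum_neg_distrib, mul_smul, ← Finset.smul_sum, sum_dlt_smul']

lemma eul_xs (F : Poly n) : eul n (xs n F) = xs n (eul n F) + xs n F := by
  rw [xs_apply, xs_apply, map_sum]
  simp only [eul_gam, eul_mulX, map_add, Finset.sum_add_distrib]

/-- The term `n` comes from `∑ γ_k² = n`, and `2 Eul` from the anticommutators of the `γ_k`. This
relation is the source of all eigenvalues in the Fischer decomposition. -/
lemma dirac_xs (F : Poly n) :
    dirac n (xs n F) = -xs n (dirac n F) + (2 : ℂ) • eul n F + (n : ℂ) • F := by
  rw [xs_apply, map_sum]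
  simp only [dirac_gam, dirac_mulX, der_mulX, map_add, gam_sq, dlt_self, one_smul, smul_add,
    Finset.sum_add_distrib, neg_add, Finset.sum_neg_distrib, ← Finset.smul_sum, ← xs_apply,
    ← eul_apply]
  simp only [Finset.sum_const, Finset.card_univ, Fintype.card_fin, ← Nat.cast_smul_eq_nsmul ℂ]
  module

lemma chi_xs (F : Poly n) : chi n (xs n F) = -xs n (chi n F) := by
  simp only [xs_apply, map_sum, chi_gam, chi_mulX, Finset.sum_neg_distrib]

lemma chi_dirac (F : Poly n) : chi n (dirac n F) = -dirac n (chi n F) := by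
  simp only [dirac_apply, map_sum, chi_gam, chi_der, Finset.sum_neg_distrib]

lemma chi_eul (F : Poly n) : chi n (eul n F) = eul n (chi n F) := by
  simp only [eul_apply, map_sum, chi_mulX, chi_der]

/-- Infinitesimal rotations. -/
def rot (j k : Fin n) : Module.End ℂ (Poly n) :=
  -(mulX j ∘ₗ der k - mulX k ∘ₗ der j + (1 / 2 : ℂ) • (gam j ∘ₗ gam k - dlt j k • LinearMap.id))

lemma rot_apply (j k : Fin n) (F : Poly n) : rot j k F =
    -(mulX j (der k F) - mulX k (der j F) + (1 / 2 : ℂ) • (gam j (gam k F) - dlt j k • F)) := rfl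

/-- The energy operator. -/
def hOp (n : ℕ) (E : ℂ) : Module.End ℂ (Poly n) := -(eul n + E • LinearMap.id)

lemma hOp_apply (E : ℂ) (F : Poly n) : hOp n E F = -(eul n F + E • F) := rfl

/-- Special conformal transformations. -/
def kOp (E : ℂ) (j : Fin n) : Module.End ℂ (Poly n) :=
  mulX j ∘ₗ dirac n ∘ₗ dirac n + gam j ∘ₗ dirac n - (2 : ℂ) • eul n ∘ₗ der j
    - (2 * E + 1) • der j

lemma kOp_apply (E : ℂ) (j : Fin n) (F : Poly n) : kOp E j F =
    mulX j (dirac n (dirac n F)) + gam j (dirac n F) - (2 : ℂ) • eul n (der j F)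
      - (2 * E + 1) • der j F := rfl

lemma rot_mulX (j k m : Fin n) (F : Poly n) : rot j k (mulX m F) =
    mulX m (rot j k F) + dlt j m • mulX k F - dlt k m • mulX j F := by
  simp only [rot_apply, der_mulX, map_add, map_sub, map_neg, map_smul, gam_mulX]
  rw [mulX_comm m j, mulX_comm m k]
  module

lemma rot_der (j k m : Fin n) (F : Poly n) : rot j k (der m F) =
    der m (rot j k F) + dlt j m • der k F - dlt k m • der j F := by
  simp only [rot_apply, der_mulX, map_add, map_sub, map_neg, map_smul, der_gam]
  rw [der_comm m j, der_comm m k, dlt_comm m j, dlt_comm m k]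
  module

lemma rot_gam (j k m : Fin n) (F : Poly n) : rot j k (gam m F) =
    gam m (rot j k F) + dlt j m • gam k F - dlt k m • gam j F := by
  simp only [rot_apply, map_add, map_sub, map_neg, map_smul, der_gam, gam_mulX]
  have h : gam j (gam k (gam m F)) = gam m (gam j (gam k F)) + (2 * dlt k m) • gam j F
      - (2 * dlt j m) • gam k F := by
    rw [gam_gam k m, map_add, map_neg, map_smul, gam_gam j m]; module
  rw [h]
  module

lemma rot_swap (j k : Fin n) (F : Poly n) : rot j k F = -rot k j F := by
  rw [rot_apply, rot_apply, gam_gam j k, dlt_comm k j]; module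

lemma rot_dirac (j k : Fin n) (F : Poly n) : rot j k (dirac n F) = dirac n (rot j k F) := by
  simp only [dirac_apply, map_sum, rot_gam, rot_der, map_add, map_sub, map_smul,
    Finset.sum_add_distrib, Finset.sum_sub_distrib, sum_dlt_smul]
  abel

lemma rot_xs (j k : Fin n) (F : Poly n) : rot j k (xs n F) = xs n (rot j k F) := by
  simp only [xs_apply, map_sum, rot_gam, rot_mulX, map_add, map_sub, map_smul,
    Finset.sum_add_distrib, Finset.sum_sub_distrib, sum_dlt_smul]
  abel

lemma rot_eul (j k : Fin n) (F : Poly n) : rot j k (eul n F) = eul n (rot j k F) := by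
  simp only [eul_apply, map_sum, rot_mulX, rot_der, map_add, map_sub, map_smul,
    Finset.sum_add_distrib, Finset.sum_sub_distrib, sum_dlt_smul]
  abel

lemma rot_chi (j k : Fin n) (F : Poly n) : rot j k (chi n F) = chi n (rot j k F) := by
  simp only [rot_apply, map_neg, map_add, map_sub, map_smul, chi_gam, chi_mulX, chi_der, neg_neg]

/-- This is the relation `[𝔭⁺, 𝔭⁻]`. Together with vanishing on constants it determines the operator
`kOp` by induction on the degree: `x_j ∂̸²` contributes `2 x_j ∂_k`, and `γ_j ∂̸` the spin part `γ_j
γ_k` of the rotation. -/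
lemma kOp_mulX (E : ℂ) (j k : Fin n) (F : Poly n) : kOp E j (mulX k F) =
    mulX k (kOp E j F) - (2 : ℂ) • rot j k F + (2 * dlt j k) • hOp n E F := by
  simp only [kOp_apply, rot_apply, hOp_apply, dirac_mulX, dirac_gam, map_add, map_sub, map_neg,
    map_smul, der_mulX, eul_mulX, gam_mulX]
  rw [mulX_comm k j]
  module

lemma kOp_chi (E : ℂ) (j : Fin n) (F : Poly n) : kOp E j (chi n F) = chi n (kOp E j F) := by
  simp only [kOp_apply, map_add, map_sub, map_smul, map_neg, chi_gam, chi_mulX, chi_der,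
    chi_dirac, neg_neg, chi_eul]

lemma rot_kOp (E : ℂ) (j k m : Fin n) (F : Poly n) : rot j k (kOp E m F) =
    kOp E m (rot j k F) + dlt j m • kOp E k F - dlt k m • kOp E j F := by
  simp only [kOp_apply, map_add, map_sub, map_smul, rot_mulX, rot_gam, rot_dirac, rot_eul, rot_der]
  module

lemma kOp_comm (E : ℂ) (j k : Fin n) (F : Poly n) : kOp E j (kOp E k F) = kOp E k (kOp E j F) := by
  simp only [kOp_apply, dirac_mulX, dirac_gam, map_add, map_sub, map_neg,
    map_smul, der_mulX, eul_mulX, gam_mulX, der_gam, eul_gam, der_eul, dirac_eul, der_dirac]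
  rw [mulX_comm k j, gam_gam k j, der_comm k j, dlt_comm k j]
  module

lemma hOp_kOp (E : ℂ) (k : Fin n) (F : Poly n) :
    hOp n E (kOp E k F) = kOp E k (hOp n E F) + kOp E k F := by
  simp only [kOp_apply, hOp_apply, map_add, map_sub, map_neg, map_smul, eul_mulX, eul_gam, der_eul,
    dirac_eul]
  module

lemma rot_rot (j k a b : Fin n) (F : Poly n) : rot j k (rot a b F) = rot a b (rot j k F)
    + dlt j a • rot k b F - dlt k a • rot j b F + dlt j b • rot a k F - dlt k b • rot a j F := by
  rw [rot_apply a b, rot_apply a b, rot_apply k b, rot_apply j b, rot_apply a k, rot_apply a j]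
  simp only [map_add, map_sub, map_neg, map_smul, rot_mulX, rot_der, rot_gam]
  rw [dlt_comm a k, dlt_comm a j]
  module
end Operators

/-! ### The representation of `so(2,n)` on spinor polynomials -/

section Representation
variable {n : ℕ}

/-- The representation of `so2 n` on polynomials with values in spinors, as a linear map. -/
def rhoLin (n : ℕ) (E : ℂ) : so2 n →ₗ[ℂ] Module.End ℂ (Poly n) :=
  (Complex.I • entry (Sum.inl 0) (Sum.inl 1)).smulRight (hOp n E)
    + ∑ k, (-(1 / 2 : ℂ) • entry (Sum.inl 0) (Sum.inr k)
        - (Complex.I / 2) • entry (Sum.inl 1) (Sum.inr k)).smulRight (mulX k)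
    + ∑ k, (-(1 / 2 : ℂ) • entry (Sum.inl 0) (Sum.inr k)
        + (Complex.I / 2) • entry (Sum.inl 1) (Sum.inr k)).smulRight (kOp E k)
    + ∑ j, ∑ k, (-(1 / 2 : ℂ) • entry (Sum.inr j) (Sum.inr k)).smulRight (rot j k)

lemma rhoLin_apply (E : ℂ) (x : so2 n) : rhoLin n E x =
    (Complex.I * entry (Sum.inl 0) (Sum.inl 1) x) • hOp n E
    + ∑ k, (-(1 / 2) * entry (Sum.inl 0) (Sum.inr k) x
        - Complex.I / 2 * entry (Sum.inl 1) (Sum.inr k) x) • mulX k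
    + ∑ k, (-(1 / 2) * entry (Sum.inl 0) (Sum.inr k) x
        + Complex.I / 2 * entry (Sum.inl 1) (Sum.inr k) x) • kOp E k
    + ∑ j, ∑ k, (-(1 / 2) * entry (Sum.inr j) (Sum.inr k) x) • rot j k := by
  simp only [rhoLin, LinearMap.add_apply, LinearMap.sum_apply, LinearMap.smulRight_apply,
    LinearMap.smul_apply, LinearMap.sub_apply, smul_eq_mul]

lemma rhoLin_hTime (E : ℂ) : rhoLin n E (hTime n) = hOp n E := by
  rw [rhoLin_apply]
  simp [entry_hTime, etaDiag]

lemma rhoLin_pMinus (E : ℂ) (k : Fin n) : rhoLin n E (pMinus k) = mulX k := by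
  rw [rhoLin_apply]
  have hI := Complex.I_mul_I
  have h : ∀ j : Fin n, (-(1 / 2 : ℂ) * entry (Sum.inl 0) (Sum.inr j) (pMinus k)
        - Complex.I / 2 * entry (Sum.inl 1) (Sum.inr j) (pMinus k)) = if j = k then 1 else 0 := by
    intro j
    simp only [entry_pMinus, etaDiag]
    by_cases hj : j = k <;> simp [hj]
    linear_combination -hI / 2
  have h' : ∀ j : Fin n, (-(1 / 2 : ℂ) * entry (Sum.inl 0) (Sum.inr j) (pMinus k)
        + Complex.I / 2 * entry (Sum.inl 1) (Sum.inr j) (pMinus k)) = 0 := by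
    intro j
    simp only [entry_pMinus, etaDiag]
    by_cases hj : j = k <;> simp [hj]
    linear_combination hI / 2
  have h0 : ∀ i j : Fin n, entry (Sum.inr i) (Sum.inr j) (pMinus k) = 0 := by
    intro i j; simp [entry_pMinus]
  simp only [h, h', h0]
  simp [entry_pMinus]

lemma rhoLin_pPlus (E : ℂ) (k : Fin n) : rhoLin n E (pPlus k) = kOp E k := by
  rw [rhoLin_apply]
  have hI := Complex.I_mul_I
  have h : ∀ j : Fin n, (-(1 / 2 : ℂ) * entry (Sum.inl 0) (Sum.inr j) (pPlus k)
        + Complex.I / 2 * entry (Sum.inl 1) (Sum.inr j) (pPlus k)) = if j = k then 1 else 0 := by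
    intro j
    simp only [entry_pPlus, etaDiag]
    by_cases hj : j = k <;> simp [hj]
    linear_combination -hI / 2
  have h' : ∀ j : Fin n, (-(1 / 2 : ℂ) * entry (Sum.inl 0) (Sum.inr j) (pPlus k)
        - Complex.I / 2 * entry (Sum.inl 1) (Sum.inr j) (pPlus k)) = 0 := by
    intro j
    simp only [entry_pPlus, etaDiag]
    by_cases hj : j = k <;> simp [hj]
    linear_combination hI / 2
  have h0 : ∀ i j : Fin n, entry (Sum.inr i) (Sum.inr j) (pPlus k) = 0 := by
    intro i j; simp [entry_pPlus]
  simp only [h, h', h0]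
  simp [entry_pPlus]

lemma rhoLin_rotM (E : ℂ) (a b : Fin n) : rhoLin n E (rotM a b) = rot a b := by
  rw [rhoLin_apply]
  have h : ∀ j k : Fin n, (-(1 / 2 : ℂ) * entry (Sum.inr j) (Sum.inr k) (rotM a b))
      = (1 / 2 : ℂ) * dlt j a * dlt k b - (1 / 2 : ℂ) * dlt k a * dlt j b := by
    intro j k
    simp only [entry_rotM, etaDiag, dlt, Sum.inr.injEq, Sum.elim_inr]
    split_ifs <;> norm_num
  have h0 : entry (Sum.inl 0) (Sum.inl 1) (rotM a b) = 0 := by simp [entry_rotM]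
  have h1 : ∀ k i, entry (Sum.inl i) (Sum.inr k) (rotM a b) = 0 := by simp [entry_rotM]
  apply LinearMap.ext
  intro F
  simp only [h, h0, h1, mul_zero, sub_zero, add_zero, zero_smul, Finset.sum_const_zero, zero_add,
    LinearMap.sum_apply]
  have h2 : ∀ j k : Fin n, ((1 / 2 * dlt j a * dlt k b - 1 / 2 * dlt k a * dlt j b) • rot j k) F
      = dlt j a • dlt k b • (1 / 2 : ℂ) • rot j k F - dlt j b • dlt k a • (1 / 2 : ℂ) • rot j k F := by
    intro j k
    rw [LinearMap.smul_apply]; module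
  simp only [h2, Finset.sum_sub_distrib, ← Finset.smul_sum, sum_dlt_smul']
  rw [rot_swap b a]; module

lemma so2_span : Submodule.span ℂ ({hTime n} ∪ Set.range pMinus ∪ Set.range pPlus ∪
    {x | ∃ j k : Fin n, x = rotM j k}) = ⊤ := by
  rw [eq_top_iff]
  rintro x -
  rw [so2_decomp x]
  refine add_mem (add_mem (add_mem ?_ ?_) ?_) ?_
  · exact Submodule.smul_mem _ _ (Submodule.subset_span (Or.inl (Or.inl (Or.inl rfl))))
  · exact sum_mem fun k _ => Submodule.smul_mem _ _
      (Submodule.subset_span (Or.inl (Or.inl (Or.inr ⟨k, rfl⟩))))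
  · exact sum_mem fun k _ => Submodule.smul_mem _ _
      (Submodule.subset_span (Or.inl (Or.inr ⟨k, rfl⟩)))
  · exact sum_mem fun j _ => sum_mem fun k _ => Submodule.smul_mem _ _
      (Submodule.subset_span (Or.inr ⟨j, k, rfl⟩))

/-- Induction on elements of `so2 n` through the generators. -/
lemma so2_induction {p : so2 n → Prop} (h0 : p (hTime n)) (hm : ∀ k, p (pMinus k))
    (hp : ∀ k, p (pPlus k)) (hr : ∀ j k, p (rotM j k)) (hz : p 0)
    (ha : ∀ x y, p x → p y → p (x + y)) (hs : ∀ (c : ℂ) x, p x → p (c • x)) (x : so2 n) : p x := by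
  have hx : x ∈ Submodule.span ℂ ({hTime n} ∪ Set.range pMinus ∪ Set.range pPlus ∪
    {x | ∃ j k : Fin n, x = rotM j k}) := by rw [so2_span]; trivial
  induction hx using Submodule.span_induction with
  | mem x hx =>
    rcases hx with ((rfl | ⟨k, rfl⟩) | ⟨k, rfl⟩) | ⟨j, k, rfl⟩
    exacts [h0, hm k, hp k, hr j k]
  | zero => exact hz
  | add x y _ _ hx hy => exact ha x y hx hy
  | smul c x _ hx => exact hs c x hx

/-- Both sides are bilinear in `x` and `y`, so it suffices to compare the bracket tables of the
generators with the commutators of the operators. -/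
lemma rhoLin_lie (E : ℂ) (x y : so2 n) (F : Poly n) : rhoLin n E ⁅x, y⁆ F =
    rhoLin n E x (rhoLin n E y F) - rhoLin n E y (rhoLin n E x F) := by
  -- Antisymmetry leaves one ordering to check for each pair of types of generators.
  have swap : ∀ {x y : so2 n}, (∀ F, rhoLin n E ⁅x, y⁆ F =
      rhoLin n E x (rhoLin n E y F) - rhoLin n E y (rhoLin n E x F)) → ∀ F, rhoLin n E ⁅y, x⁆ F =
      rhoLin n E y (rhoLin n E x F) - rhoLin n E x (rhoLin n E y F) := by
    intro x y h F
    rw [← lie_skew, map_neg, LinearMap.neg_apply, h, neg_sub]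
  have hHM : ∀ k F, rhoLin n E ⁅hTime n, pMinus k⁆ F = rhoLin n E (hTime n)
      (rhoLin n E (pMinus k) F) - rhoLin n E (pMinus k) (rhoLin n E (hTime n) F) := by
    intro k F
    simp only [lie_hTime_pMinus, map_neg, LinearMap.neg_apply, rhoLin_pMinus, rhoLin_hTime,
      hOp_apply, eul_mulX, map_add, map_smul]
    abel
  have hHP : ∀ k F, rhoLin n E ⁅hTime n, pPlus k⁆ F = rhoLin n E (hTime n)
      (rhoLin n E (pPlus k) F) - rhoLin n E (pPlus k) (rhoLin n E (hTime n) F) := by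
    intro k F
    simp only [lie_hTime_pPlus, rhoLin_pPlus, rhoLin_hTime, hOp_kOp]
    abel
  have hHR : ∀ j k F, rhoLin n E ⁅hTime n, rotM j k⁆ F = rhoLin n E (hTime n)
      (rhoLin n E (rotM j k) F) - rhoLin n E (rotM j k) (rhoLin n E (hTime n) F) := by
    intro j k F
    simp only [lie_hTime_rotM, map_zero, LinearMap.zero_apply, rhoLin_rotM, rhoLin_hTime,
      hOp_apply, map_neg, map_add, map_smul, rot_eul, sub_self]
  have hRM : ∀ j k m F, rhoLin n E ⁅rotM j k, pMinus m⁆ F = rhoLin n E (rotM j k)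
      (rhoLin n E (pMinus m) F) - rhoLin n E (pMinus m) (rhoLin n E (rotM j k) F) := by
    intro j k m F
    simp only [lie_rotM_pMinus, map_sub, map_smul, LinearMap.sub_apply, LinearMap.smul_apply,
      rhoLin_rotM, rhoLin_pMinus, rot_mulX, dlt]
    abel
  have hRP : ∀ j k m F, rhoLin n E ⁅rotM j k, pPlus m⁆ F = rhoLin n E (rotM j k)
      (rhoLin n E (pPlus m) F) - rhoLin n E (pPlus m) (rhoLin n E (rotM j k) F) := by
    intro j k m F
    simp only [lie_rotM_pPlus, map_sub, map_smul, LinearMap.sub_apply, LinearMap.smul_apply,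
      rhoLin_rotM, rhoLin_pPlus, rot_kOp, dlt]
    abel
  have hRR : ∀ j k a b F, rhoLin n E ⁅rotM j k, rotM a b⁆ F = rhoLin n E (rotM j k)
      (rhoLin n E (rotM a b) F) - rhoLin n E (rotM a b) (rhoLin n E (rotM j k) F) := by
    intro j k a b F
    simp only [lie_rotM_rotM, map_sub, map_add, map_smul, LinearMap.sub_apply,
      LinearMap.add_apply, LinearMap.smul_apply, rhoLin_rotM, rot_rot j k a b, dlt]
    abel
  have hPM : ∀ j k F, rhoLin n E ⁅pPlus j, pMinus k⁆ F = rhoLin n E (pPlus j)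
      (rhoLin n E (pMinus k) F) - rhoLin n E (pMinus k) (rhoLin n E (pPlus j) F) := by
    intro j k F
    simp only [lie_pPlus_pMinus, map_add, map_smul, LinearMap.add_apply, LinearMap.smul_apply,
      rhoLin_rotM, rhoLin_hTime, rhoLin_pPlus, rhoLin_pMinus, kOp_mulX, dlt]
    split_ifs <;> module
  induction x using so2_induction generalizing F with
  | hz => simp
  | ha x x' hx hx' =>
    simp only [add_lie, map_add, LinearMap.add_apply, hx, hx']; abel
  | hs c x hx => simp only [smul_lie, map_smul, LinearMap.smul_apply, hx]; module
  | h0 =>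
    induction y using so2_induction generalizing F with
    | hz => simp
    | ha x x' hx hx' => simp only [lie_add, map_add, LinearMap.add_apply, hx, hx']; abel
    | hs c x hx => simp only [lie_smul, map_smul, LinearMap.smul_apply, hx]; module
    | h0 => simp
    | hm k => exact hHM k F
    | hp k => exact hHP k F
    | hr j k => exact hHR j k F
  | hm m =>
    induction y using so2_induction generalizing F with
    | hz => simp
    | ha x x' hx hx' => simp only [lie_add, map_add, LinearMap.add_apply, hx, hx']; abel
    | hs c x hx => simp only [lie_smul, map_smul, LinearMap.smul_apply, hx]; module
    | h0 => exact swap (hHM m) F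
    | hm k =>
      simp only [lie_pMinus_pMinus, rhoLin_pMinus, mulX_comm m k, sub_self, map_zero,
        LinearMap.zero_apply]
    | hp k => exact swap (hPM k m) F
    | hr j k => exact swap (hRM j k m) F
  | hp m =>
    induction y using so2_induction generalizing F with
    | hz => simp
    | ha x x' hx hx' => simp only [lie_add, map_add, LinearMap.add_apply, hx, hx']; abel
    | hs c x hx => simp only [lie_smul, map_smul, LinearMap.smul_apply, hx]; module
    | h0 => exact swap (hHP m) F
    | hm k => exact hPM m k F
    | hp k =>
      simp only [lie_pPlus_pPlus, rhoLin_pPlus, kOp_comm E m k, sub_self, map_zero,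
        LinearMap.zero_apply]
    | hr j k => exact swap (hRP j k m) F
  | hr a b =>
    induction y using so2_induction generalizing F with
    | hz => simp
    | ha x x' hx hx' => simp only [lie_add, map_add, LinearMap.add_apply, hx, hx']; abel
    | hs c x hx => simp only [lie_smul, map_smul, LinearMap.smul_apply, hx]; module
    | h0 => exact swap (hHR a b) F
    | hm k => exact hRM a b k F
    | hp k => exact hRP a b k F
    | hr j k => exact hRR a b j k F

/-- The `so2 n`-module of polynomials with values in spinors, with lowest energy `E`. -/
def ConfMod (n : ℕ) (_E : ℂ) : Type := Poly n

variable (E : ℂ)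
instance : AddCommGroup (ConfMod n E) := inferInstanceAs (AddCommGroup (Poly n))
instance : Module ℂ (ConfMod n E) := inferInstanceAs (Module ℂ (Poly n))

instance : LieRingModule (so2 n) (ConfMod n E) where
  bracket x F := rhoLin n E x F
  add_lie x y F := by rw [map_add]; rfl
  lie_add x F G := map_add (rhoLin n E x) F G
  leibniz_lie x y F := by
    have h := rhoLin_lie E x y F
    exact (sub_eq_iff_eq_add.1 h.symm)

instance : LieModule ℂ (so2 n) (ConfMod n E) where
  smul_lie c x F := by change rhoLin n E (c • x) F = _; rw [map_smul]; rfl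
  lie_smul c x F := map_smul (rhoLin n E x) c F

variable {E}
lemma conf_lie (x : so2 n) (F : ConfMod n E) : ⁅x, F⁆ = rhoLin n E x F := rfl

lemma conf_lie_pMinus (k : Fin n) (F : ConfMod n E) : ⁅(pMinus k : so2 n), F⁆ = mulX k F := by
  rw [conf_lie, rhoLin_pMinus]

lemma conf_lie_pPlus (k : Fin n) (F : ConfMod n E) : ⁅(pPlus k : so2 n), F⁆ = kOp E k F := by
  rw [conf_lie, rhoLin_pPlus]

lemma rhoLin_chi (x : so2 n) (F : Poly n) :
    rhoLin n E x (chi n F) = chi n (rhoLin n E x F) := by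
  induction x using so2_induction with
  | hz => simp
  | ha x y hx hy => simp only [map_add, LinearMap.add_apply, hx, hy]
  | hs c x hx => simp only [map_smul, LinearMap.smul_apply, hx]
  | h0 => simp only [rhoLin_hTime, hOp_apply, map_neg, map_add, map_smul, chi_eul]
  | hm k => simp only [rhoLin_pMinus, chi_mulX]
  | hp k => simp only [rhoLin_pPlus, kOp_chi]
  | hr j k => simp only [rhoLin_rotM, rot_chi]
end Representation

/-! ### Degree, chirality and the Fischer decomposition -/

section Grading
variable {n : ℕ}

lemma poly_induction {p : Poly n → Prop}
    (hc : ∀ s : Bits n → ℂ, p (fun b => MvPolynomial.C (s b)))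
    (hx : ∀ k F, p F → p (mulX k F)) (ha : ∀ F G, p F → p G → p (F + G)) (F : Poly n) : p F := by
  have hsingle : ∀ (b : Bits n) (f : MvPolynomial (Fin n) ℂ), p (Pi.single b f) := by
    intro b f
    induction f using MvPolynomial.induction_on with
    | C a =>
      convert hc (Pi.single b a) using 1
      ext1 c
      by_cases h : c = b
      · subst h; simp
      · simp [h]
    | add f g hf hg => rw [Pi.single_add]; exact ha _ _ hf hg
    | mul_X f k hf =>
      convert hx k _ hf using 1
      ext1 c
      by_cases h : c = b
      · subst h; simp [mulX_apply, mul_comm]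
      · simp [h, mulX_apply]
  have h0 : p 0 := by simpa using hsingle (fun _ => true) 0
  have hF : F = ∑ b, Pi.single b (F b) := (Finset.univ_sum_single F).symm
  rw [hF]
  exact Finset.sum_induction _ p ha h0 fun b _ => hsingle b (F b)

lemma coeff_eul (F : Poly n) (b : Bits n) (m : Fin n →₀ ℕ) :
    (eul n F b).coeff m = (m.degree : ℂ) * (F b).coeff m := by
  have h : ∀ k, (mulX k (der k F) b).coeff m = (m k : ℂ) * (F b).coeff m := by
    intro k
    rw [mulX_apply, der_apply, MvPolynomial.coeff_X_mul']
    split_ifs with hk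
    · rw [MvPolynomial.coeff_pderiv]
      have hk1 : 1 ≤ m k := Nat.one_le_iff_ne_zero.2 (Finsupp.mem_support_iff.1 hk)
      have hm : m - Finsupp.single k 1 + Finsupp.single k 1 = m :=
        tsub_add_cancel_of_le (Finsupp.single_le_iff.2 hk1)
      rw [hm, mul_comm]
      congr 1
      simp [Nat.cast_sub hk1]
    · rw [Finsupp.notMem_support_iff.1 hk]; simp
  rw [eul_apply, Finset.sum_apply, MvPolynomial.coeff_sum]
  simp only [h, ← Finset.sum_mul, Finsupp.degree_eq_sum, Nat.cast_sum]

lemma coeff_eq_zero_of_eul {F : Poly n} {c : ℂ} (h : eul n F = c • F) (b : Bits n)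
    (m : Fin n →₀ ℕ) (hm : (m.degree : ℂ) ≠ c) : (F b).coeff m = 0 := by
  have h1 := coeff_eul F b m
  rw [h, Pi.smul_apply, MvPolynomial.coeff_smul, smul_eq_mul] at h1
  have h2 : ((m.degree : ℂ) - c) * (F b).coeff m = 0 := by linear_combination -h1
  exact (mul_eq_zero.1 h2).resolve_left (sub_ne_zero.2 hm)

lemma eq_zero_of_eul_neg {F : Poly n} (h : eul n F = (-1 : ℂ) • F) : F = 0 := by
  ext b m
  refine coeff_eq_zero_of_eul h b m fun h1 => ?_
  have := congrArg Complex.re h1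
  simp at this
  linarith [Nat.cast_nonneg (α := ℝ) m.degree]

lemma eq_C_of_eul_zero {F : Poly n} (h : eul n F = (0 : ℂ) • F) (b : Bits n) :
    F b = MvPolynomial.C ((F b).coeff 0) := by
  ext m
  by_cases hm : m = 0
  · subst hm; simp
  · rw [coeff_eq_zero_of_eul h b m, MvPolynomial.coeff_C, if_neg (Ne.symm hm)]
    rw [Nat.cast_ne_zero]
    exact fun h => hm (Finsupp.degree_eq_zero_iff _ |>.1 h)

lemma eul_const (s : Bits n → ℂ) : eul n (fun b => MvPolynomial.C (s b)) = 0 := by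
  rw [eul_apply]
  refine Finset.sum_eq_zero fun k _ => ?_
  have : der k (fun b => MvPolynomial.C (s b) : Poly n) = 0 := by
    ext1 b; simp [der_apply]
  rw [this, map_zero]

lemma eul_eigen_top (F : Poly n) : F ∈ ⨆ N : ℕ, Module.End.eigenspace (eul n) (N : ℂ) := by
  induction F using poly_induction with
  | hc s =>
    refine Submodule.mem_iSup_of_mem 0 ?_
    rw [Module.End.mem_eigenspace_iff, eul_const]; simp
  | hx k F hF =>
    have : (⨆ N : ℕ, Module.End.eigenspace (eul n) (N : ℂ)) ≤
        (⨆ N : ℕ, Module.End.eigenspace (eul n) (N : ℂ)).comap (mulX k) := by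
      refine iSup_le fun N G hG => Submodule.mem_iSup_of_mem (N + 1) ?_
      rw [Module.End.mem_eigenspace_iff] at hG ⊢
      rw [eul_mulX, hG, map_smul]
      push_cast; module
    exact this hF
  | ha F G hF hG => exact add_mem hF hG

/-- Monogenic spinor polynomials of degree `l` and chirality `(-1) ^ s`. -/
def mono (n s l : ℕ) : Submodule ℂ (Poly n) where
  carrier := {F | dirac n F = 0 ∧ eul n F = (l : ℂ) • F ∧ chi n F = (-1 : ℂ) ^ s • F}
  add_mem' := by
    rintro F G ⟨h1, h2, h3⟩ ⟨h1', h2', h3'⟩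
    exact ⟨by rw [map_add, h1, h1', add_zero], by rw [map_add, h2, h2', smul_add],
      by rw [map_add, h3, h3', smul_add]⟩
  zero_mem' := ⟨map_zero _, by simp, by simp⟩
  smul_mem' := by
    rintro c F ⟨h1, h2, h3⟩
    exact ⟨by rw [map_smul, h1, smul_zero], by rw [map_smul, h2, smul_comm],
      by rw [map_smul, h3, smul_comm]⟩

/-- Spinor polynomials of degree `N` and chirality `(-1) ^ s`. -/
def degSub (n s N : ℕ) : Submodule ℂ (Poly n) where
  carrier := {F | eul n F = (N : ℂ) • F ∧ chi n F = (-1 : ℂ) ^ s • F}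
  add_mem' := by
    rintro F G ⟨h2, h3⟩ ⟨h2', h3'⟩
    exact ⟨by rw [map_add, h2, h2', smul_add], by rw [map_add, h3, h3', smul_add]⟩
  zero_mem' := ⟨by simp, by simp⟩
  smul_mem' := by
    rintro c F ⟨h2, h3⟩
    exact ⟨by rw [map_smul, h2, smul_comm], by rw [map_smul, h3, smul_comm]⟩

lemma mem_degSub {s N : ℕ} {F : Poly n} : F ∈ degSub n s N ↔
    eul n F = (N : ℂ) • F ∧ chi n F = (-1 : ℂ) ^ s • F := Iff.rfl

/-- Spinor polynomials of chirality `(-1) ^ s`. -/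
def chirSub (n s : ℕ) : Submodule ℂ (Poly n) := Module.End.eigenspace (chi n) ((-1 : ℂ) ^ s)

lemma mem_chirSub {s : ℕ} {F : Poly n} : F ∈ chirSub n s ↔ chi n F = (-1 : ℂ) ^ s • F :=
  Module.End.mem_eigenspace_iff

lemma chi_chi (F : Poly n) : chi n (chi n F) = F := by
  ext1 b
  rw [chi_apply, chi_apply, smul_smul, par, ← Finset.prod_mul_distrib,
    Finset.prod_eq_one fun j _ => bsgn_mul_self _, one_smul]

lemma neg_one_pow_sq (s : ℕ) : (-1 : ℂ) ^ s * (-1 : ℂ) ^ s = 1 := by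
  rw [← mul_pow]; simp

lemma mem_iSup_degSub {s : ℕ} {F : Poly n} (hF : F ∈ chirSub n s) :
    F ∈ ⨆ N, degSub n s N := by
  -- This is the projector onto chirality `(-1) ^ s`. It commutes with the Euler operator and so
  -- maps homogeneous components to homogeneous components.
  let P : Module.End ℂ (Poly n) := (1 / 2 : ℂ) • (LinearMap.id + (-1 : ℂ) ^ s • chi n)
  have hP : ∀ G, P G = (1 / 2 : ℂ) • (G + (-1 : ℂ) ^ s • chi n G) := fun G => rfl
  have h1 : P F = F := by
    rw [hP, mem_chirSub.1 hF, smul_smul, neg_one_pow_sq]; module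
  have h2 : (⨆ N : ℕ, Module.End.eigenspace (eul n) (N : ℂ)) ≤ (⨆ N, degSub n s N).comap P := by
    refine iSup_le fun N G hG => Submodule.mem_iSup_of_mem N ?_
    rw [Module.End.mem_eigenspace_iff] at hG
    refine mem_degSub.2 ⟨?_, ?_⟩
    · rw [hP, map_smul, map_add, map_smul, ← chi_eul, hG, map_smul]; module
    · rw [hP, map_smul, map_add, map_smul, chi_chi, smul_comm ((-1 : ℂ) ^ s) (1 / 2 : ℂ),
        smul_add ((-1 : ℂ) ^ s), smul_smul, neg_one_pow_sq, one_smul, add_comm]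
  rw [← h1]
  exact h2 (eul_eigen_top F)

lemma eul_xs_pow (j : ℕ) {l : ℂ} {F : Poly n} (h : eul n F = l • F) :
    eul n ((xs n ^ j) F) = (l + j) • (xs n ^ j) F := by
  induction j with
  | zero => simpa using h
  | succ j ih =>
    rw [pow_succ', Module.End.mul_apply, eul_xs, ih, map_smul]; push_cast; module

lemma chi_xs_pow (j s : ℕ) {F : Poly n} (h : chi n F = (-1 : ℂ) ^ (s + j) • F) :
    chi n ((xs n ^ j) F) = (-1 : ℂ) ^ s • (xs n ^ j) F := by
  induction j generalizing s with
  | zero => simpa using h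
  | succ j ih =>
    rw [pow_succ', Module.End.mul_apply, chi_xs, ih (s + 1) (by rw [h]; ring_nf), map_smul]
    rw [pow_succ]; module

/-- The eigenvalues of `x̸ ∂̸` on the Fischer components. -/
def aVal (n l j : ℕ) : ℕ := if Even j then j else 2 * l + n + j - 1

/-- Moving `∂̸` past one more `x̸` produces `2 Eul + n` minus the previous eigenvalue, which is this
recursion; the parity formula is its solution starting at `0`. The natural subtraction in that
formula is harmless because `j ≥ 1` when `j` is odd. -/
lemma aVal_succ (l j : ℕ) : (aVal n l (j + 1) : ℂ) = 2 * (l + j) + n - aVal n l j := by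
  by_cases h : Even j
  · have h' : ¬ Even (j + 1) := by rwa [Nat.even_add_one, not_not]
    simp only [aVal, h, h', if_true, if_false]
    push_cast [show 2 * l + n + (j + 1) - 1 = 2 * l + n + j by omega]
    ring
  · have h' : Even (j + 1) := by rwa [Nat.even_add_one]
    have hj : 1 ≤ j := by rcases j with _ | j; · simp at h
                          · omega
    simp only [aVal, h, h', if_true, if_false]
    rw [Nat.cast_sub (by omega)]
    push_cast; ring

lemma aVal_succ_ne_zero (hn : 3 ≤ n) (l j : ℕ) : (aVal n l (j + 1) : ℂ) ≠ 0 := by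
  rw [Nat.cast_ne_zero, aVal]
  split_ifs <;> omega

lemma dirac_xs_pow {s l : ℕ} {F : Poly n} (h : F ∈ mono n s l) (j : ℕ) :
    dirac n ((xs n ^ (j + 1)) F) = (aVal n l (j + 1) : ℂ) • (xs n ^ j) F := by
  obtain ⟨h1, h2, -⟩ := h
  induction j with
  | zero =>
    rw [aVal_succ, zero_add, pow_one, dirac_xs, h1, h2]
    simp [aVal]; module
  | succ j ih =>
    rw [pow_succ', Module.End.mul_apply, dirac_xs, ih, eul_xs_pow _ h2, map_smul,
      ← Module.End.mul_apply, ← pow_succ', aVal_succ l (j + 1)]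
    push_cast; module

lemma xs_dirac_xs_pow {s l : ℕ} {F : Poly n} (h : F ∈ mono n s l) (j : ℕ) :
    xs n (dirac n ((xs n ^ j) F)) = (aVal n l j : ℂ) • (xs n ^ j) F := by
  rcases j with _ | j
  · simp [h.1, aVal]
  · rw [dirac_xs_pow h, map_smul, ← Module.End.mul_apply, ← pow_succ']

/-- The components of the Fischer decomposition. -/
def comp (n s j l : ℕ) : Submodule ℂ (Poly n) := (mono n (s + j) l).map (xs n ^ j)

lemma comp_le_degSub (s j l : ℕ) : comp n s j l ≤ degSub n s (j + l) := by
  rintro _ ⟨F, hF, rfl⟩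
  refine ⟨?_, chi_xs_pow j s hF.2.2⟩
  rw [eul_xs_pow j hF.2.1]; push_cast; rw [add_comm]

lemma xs_mem_comp {s j l : ℕ} {F : Poly n} (hF : F ∈ comp n (s + 1) j l) :
    xs n F ∈ comp n s (j + 1) l := by
  obtain ⟨m, hm, rfl⟩ := hF
  refine ⟨m, ?_, by rw [pow_succ', Module.End.mul_apply]⟩
  rwa [show s + (j + 1) = s + 1 + j by ring]

/-- The Fischer decomposition. -/
lemma degSub_le_iSup_comp (hn : 3 ≤ n) (N s : ℕ) :
    degSub n s N ≤ ⨆ p : {p : ℕ × ℕ // p.1 + p.2 = N}, comp n s p.1.1 p.1.2 := by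
  induction N generalizing s with
  | zero =>
    intro F hF
    refine Submodule.mem_iSup_of_mem ⟨(0, 0), rfl⟩ ⟨F, ⟨?_, hF.1, hF.2⟩, by simp⟩
    -- `∂̸` lowers the degree by one, so `∂̸F` would have degree `-1`.
    apply eq_zero_of_eul_neg
    have := dirac_eul F
    rw [hF.1, Nat.cast_zero, zero_smul, map_zero] at this
    rw [eq_neg_of_add_eq_zero_left this.symm]; module
  | succ N ih =>
    intro F hF
    have h1 : dirac n F ∈ degSub n (s + 1) N := by
      refine ⟨?_, ?_⟩
      · have := dirac_eul F
        rw [hF.1, map_smul] at this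
        rw [eq_sub_of_add_eq this.symm]; push_cast; module
      · rw [chi_dirac, hF.2, map_smul, pow_succ]; module
    -- On `x̸^j M_l` the operator `∂̸ x̸` is the nonzero scalar `aVal n l (j + 1)`, so it is onto in
    -- degree `N`. Solving `∂̸ x̸ h = ∂̸ F` makes `F - x̸ h` monogenic.
    have h2 : ∀ t, (⨆ p : {p : ℕ × ℕ // p.1 + p.2 = N}, comp n t p.1.1 p.1.2) ≤
        (⨆ p : {p : ℕ × ℕ // p.1 + p.2 = N}, comp n t p.1.1 p.1.2).map (dirac n ∘ₗ xs n) := by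
      intro t
      refine iSup_le ?_
      rintro ⟨⟨j, l⟩, hp⟩ _ ⟨m, hm, rfl⟩
      refine ⟨(aVal n l (j + 1) : ℂ)⁻¹ • (xs n ^ j) m, Submodule.smul_mem _ _
        (Submodule.mem_iSup_of_mem ⟨(j, l), hp⟩ ⟨m, hm, rfl⟩), ?_⟩
      rw [map_smul, LinearMap.comp_apply, ← Module.End.mul_apply (xs n), ← pow_succ',
        dirac_xs_pow hm, smul_smul, inv_mul_cancel₀ (aVal_succ_ne_zero hn l j), one_smul]
    obtain ⟨h, hh, hd⟩ := h2 _ (ih (s + 1) h1)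
    have h3 : xs n h ∈ ⨆ p : {p : ℕ × ℕ // p.1 + p.2 = N + 1}, comp n s p.1.1 p.1.2 := by
      have : (⨆ p : {p : ℕ × ℕ // p.1 + p.2 = N}, comp n (s + 1) p.1.1 p.1.2) ≤
          (⨆ p : {p : ℕ × ℕ // p.1 + p.2 = N + 1}, comp n s p.1.1 p.1.2).comap (xs n) := by
        refine iSup_le ?_
        rintro ⟨⟨j, l⟩, hp⟩ G hG
        exact Submodule.mem_iSup_of_mem ⟨(j + 1, l), by simp at hp ⊢; omega⟩ (xs_mem_comp hG)
      exact this hh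
    have h4 : xs n h ∈ degSub n s (N + 1) := by
      have : (⨆ p : {p : ℕ × ℕ // p.1 + p.2 = N + 1}, comp n s p.1.1 p.1.2) ≤
          degSub n s (N + 1) := by
        refine iSup_le ?_
        rintro ⟨⟨j, l⟩, hp⟩ G hG
        have := comp_le_degSub s j l hG
        simp only at hp
        rwa [hp] at this
      exact this h3
    have h5 : F - xs n h ∈ comp n s 0 (N + 1) := by
      have h6 := sub_mem hF h4
      refine ⟨F - xs n h, ⟨?_, h6.1, h6.2⟩, by simp⟩
      rw [map_sub, ← hd, LinearMap.comp_apply, sub_self]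
    have h7 : F = (F - xs n h) + xs n h := by abel
    rw [h7]
    exact add_mem (Submodule.mem_iSup_of_mem ⟨(0, N + 1), by simp⟩ h5) h3

lemma mem_iSup_comp (hn : 3 ≤ n) {s : ℕ} {F : Poly n} (hF : F ∈ chirSub n s) :
    F ∈ ⨆ p : ℕ × ℕ, comp n s p.1 p.2 := by
  refine (iSup_le fun N => (degSub_le_iSup_comp hn N s).trans (iSup_le fun p => ?_) :
    (⨆ N, degSub n s N) ≤ _) (mem_iSup_degSub hF)
  exact le_iSup (fun p : ℕ × ℕ => comp n s p.1 p.2) p.1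

lemma degSub_finite (s N : ℕ) : Module.Finite ℂ (degSub n s N) := by
  let f : degSub n s N →ₗ[ℂ] (Bits n × {m : Fin n →₀ ℕ // m.degree = N} → ℂ) :=
    { toFun := fun F p => (F.1 p.1).coeff p.2.1
      map_add' := fun F G => by ext p; simp
      map_smul' := fun c F => by ext p; simp }
  have hfin : Finite {m : Fin n →₀ ℕ // m.degree = N} := by
    refine Set.Finite.subset (Finset.finite_toSet (Finset.univ.finsuppAntidiag N)) ?_
    intro m hm
    have hm' : m.degree = N := hm
    rw [Finset.mem_coe, Finset.mem_finsuppAntidiag]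
    exact ⟨by rw [← hm', Finsupp.degree_eq_sum], by simp⟩
  refine Module.Finite.of_injective f ?_
  intro F G h
  apply Subtype.ext
  ext b m
  by_cases hm : m.degree = N
  · exact congrFun h (b, ⟨m, hm⟩)
  · have hm' : (m.degree : ℂ) ≠ (N : ℂ) := fun h => hm (by exact_mod_cast h)
    rw [coeff_eq_zero_of_eul F.2.1 b m hm', coeff_eq_zero_of_eul G.2.1 b m hm']

lemma mono_le_degSub (s l : ℕ) : mono n s l ≤ degSub n s l := fun _ h => h.2

lemma mono_finite (s l : ℕ) : Module.Finite ℂ (mono n s l) := by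
  have := degSub_finite (n := n) s l
  exact Submodule.finiteDimensional_of_le (mono_le_degSub s l)
end Grading

/-! ### Uniqueness of the highest weight vector among monogenics -/

section HighestWeight
variable {n : ℕ}

/-- Clifford multiplication by the isotropic vectors of positive weight. -/
def posG (i : Fin (n / 2)) : Module.End ℂ (Poly n) :=
  gam (evenIdx i) + Complex.I • gam (oddIdx i)

/-- Clifford multiplication by the isotropic vectors of negative weight. -/
def negG (i : Fin (n / 2)) : Module.End ℂ (Poly n) :=
  gam (evenIdx i) - Complex.I • gam (oddIdx i)

/-- Multiplication by the isotropic coordinates of positive weight. -/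
def posX (i : Fin (n / 2)) : Module.End ℂ (Poly n) :=
  mulX (evenIdx i) + Complex.I • mulX (oddIdx i)

/-- Multiplication by the isotropic coordinates of negative weight. -/
def negX (i : Fin (n / 2)) : Module.End ℂ (Poly n) :=
  mulX (evenIdx i) - Complex.I • mulX (oddIdx i)

/-- The derivative along the isotropic vectors of positive weight. -/
def posD (i : Fin (n / 2)) : Module.End ℂ (Poly n) :=
  der (evenIdx i) + Complex.I • der (oddIdx i)

/-- The derivative along the isotropic vectors of negative weight. -/
def negD (i : Fin (n / 2)) : Module.End ℂ (Poly n) :=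
  der (evenIdx i) - Complex.I • der (oddIdx i)

lemma posG_apply (i : Fin (n / 2)) (F : Poly n) :
    posG i F = gam (evenIdx i) F + Complex.I • gam (oddIdx i) F := rfl
lemma negG_apply (i : Fin (n / 2)) (F : Poly n) :
    negG i F = gam (evenIdx i) F - Complex.I • gam (oddIdx i) F := rfl
lemma posX_apply (i : Fin (n / 2)) (F : Poly n) :
    posX i F = mulX (evenIdx i) F + Complex.I • mulX (oddIdx i) F := rfl
lemma negX_apply (i : Fin (n / 2)) (F : Poly n) :
    negX i F = mulX (evenIdx i) F - Complex.I • mulX (oddIdx i) F := rfl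
lemma posD_apply (i : Fin (n / 2)) (F : Poly n) :
    posD i F = der (evenIdx i) F + Complex.I • der (oddIdx i) F := rfl
lemma negD_apply (i : Fin (n / 2)) (F : Poly n) :
    negD i F = der (evenIdx i) F - Complex.I • der (oddIdx i) F := rfl

lemma dlt_even_odd (i : Fin (n / 2)) : dlt (evenIdx i) (oddIdx i : Fin n) = 0 := by
  simp [dlt, evenIdx_ne_oddIdx]

lemma dlt_odd_even (i : Fin (n / 2)) : dlt (oddIdx i) (evenIdx i : Fin n) = 0 := by
  rw [dlt_comm, dlt_even_odd]

lemma posG_posG (i : Fin (n / 2)) (F : Poly n) : posG i (posG i F) = 0 := by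
  simp only [posG_apply, map_add, map_smul, gam_sq]
  rw [gam_gam (oddIdx i) (evenIdx i), dlt_odd_even]
  have := Complex.I_mul_I
  match_scalars <;> first | ring1 | linear_combination this

lemma posG_negG (i : Fin (n / 2)) (F : Poly n) :
    posG i (negG i F) = (4 : ℂ) • F - negG i (posG i F) := by
  simp only [posG_apply, negG_apply, map_add, map_sub, map_smul, gam_sq]
  have := Complex.I_mul_I
  match_scalars <;> first | ring1 | linear_combination (-2 : ℂ) * this

lemma posX_injective (i : Fin (n / 2)) {F : Poly n} (h : posX i F = 0) : F = 0 := by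
  ext1 b
  have h1 : (MvPolynomial.X (evenIdx i) + MvPolynomial.C Complex.I * MvPolynomial.X (oddIdx i)) * F b
      = 0 := by
    have := congrFun h b
    rw [posX_apply] at this
    simpa [mulX_apply, add_mul, MvPolynomial.smul_eq_C_mul, mul_assoc] using this
  refine (mul_eq_zero.1 h1).resolve_left fun h2 => ?_
  have := congrArg (MvPolynomial.coeff (Finsupp.single (evenIdx i) 1)) h2
  simp [MvPolynomial.coeff_C_mul, MvPolynomial.coeff_X, Finsupp.single_left_inj,
    (evenIdx_ne_oddIdx i i).symm] at this

/-- The action of the wedge of the isotropic vector `e_i` with `e_a` in isotropic coordinates; no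
Kronecker term survives because `a` lies outside plane `i`. -/
lemma rot_pos (i : Fin (n / 2)) (a : Fin n) (ha : 2 * i.1 + 2 ≤ a.1) (F : Poly n) :
    rot (evenIdx i) a F + Complex.I • rot (oddIdx i) a F =
      -(posX i (der a F) - mulX a (posD i F) + (1 / 2 : ℂ) • posG i (gam a F)) := by
  have h1 : dlt (evenIdx i) a = 0 := by
    simp [dlt, evenIdx, Fin.ext_iff]; omega
  have h2 : dlt (oddIdx i) a = 0 := by
    simp [dlt, oddIdx, Fin.ext_iff]; omega
  simp only [rot_apply, posX_apply, posD_apply, posG_apply, h1, h2, map_add, map_smul]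
  module

lemma posG_gam (i : Fin (n / 2)) (a : Fin n) (ha : 2 * i.1 + 2 ≤ a.1) (F : Poly n) :
    posG i (gam a F) = -gam a (posG i F) := by
  have h1 : dlt (evenIdx i) a = 0 := by
    simp [dlt, evenIdx, Fin.ext_iff]; omega
  have h2 : dlt (oddIdx i) a = 0 := by
    simp [dlt, oddIdx, Fin.ext_iff]; omega
  simp only [posG_apply, gam_gam _ a, h1, h2, map_add, map_smul]
  module

/-- The first isotropic index. -/
def fstIdx (hn : 3 ≤ n) : Fin (n / 2) := ⟨0, by omega⟩

/-- The coordinates beyond the first plane. -/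
def restIdx (n : ℕ) : Finset (Fin n) := Finset.univ.filter fun a => 2 ≤ a.1

lemma mem_restIdx {a : Fin n} : a ∈ restIdx n ↔ 2 ≤ a.1 := by simp [restIdx]

lemma sum_split (hn : 3 ≤ n) {M : Type} [AddCommGroup M] (f : Fin n → M) :
    ∑ k, f k = f (evenIdx (fstIdx hn)) + f (oddIdx (fstIdx hn)) + ∑ k ∈ restIdx n, f k := by
  have h : (Finset.univ.filter fun a : Fin n => ¬ 2 ≤ a.1)
      = {evenIdx (fstIdx hn), oddIdx (fstIdx hn)} := by
    ext a; simp [fstIdx, evenIdx, oddIdx, Fin.ext_iff]; omega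
  rw [← Finset.sum_filter_add_sum_filter_not Finset.univ (fun a : Fin n => 2 ≤ a.1), h,
    Finset.sum_pair (evenIdx_ne_oddIdx _ _), add_comm]
  rfl

lemma card_restIdx (hn : 3 ≤ n) : ((restIdx n).card : ℂ) = n - 2 := by
  have := sum_split hn (fun _ => (1 : ℤ))
  simp at this
  have h : ((restIdx n).card : ℤ) = n - 2 := by linarith
  exact_mod_cast congrArg (Int.cast : ℤ → ℂ) h

lemma dirac_split (hn : 3 ≤ n) (F : Poly n) : dirac n F =
    (1 / 2 : ℂ) • negG (fstIdx hn) (posD (fstIdx hn) F)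
      + (1 / 2 : ℂ) • posG (fstIdx hn) (negD (fstIdx hn) F) + ∑ a ∈ restIdx n, gam a (der a F) := by
  rw [dirac_apply, sum_split hn]
  simp only [negG_apply, posD_apply, posG_apply, negD_apply, map_add, map_sub, map_smul]
  have := Complex.I_mul_I
  match_scalars <;> first | ring1 | linear_combination this

lemma eul_split (hn : 3 ≤ n) (F : Poly n) : eul n F =
    (1 / 2 : ℂ) • negX (fstIdx hn) (posD (fstIdx hn) F)
      + (1 / 2 : ℂ) • posX (fstIdx hn) (negD (fstIdx hn) F)
      + ∑ a ∈ restIdx n, mulX a (der a F) := by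
  rw [eul_apply, sum_split hn]
  simp only [negX_apply, posD_apply, posX_apply, negD_apply, map_add, map_sub, map_smul]
  have := Complex.I_mul_I
  match_scalars <;> first | ring1 | linear_combination this

lemma posX_gam (i : Fin (n / 2)) (a : Fin n) (F : Poly n) :
    posX i (gam a F) = gam a (posX i F) := by
  simp only [posX_apply, map_add, map_smul, gam_mulX]

lemma posX_posG (i j : Fin (n / 2)) (F : Poly n) : posX i (posG j F) = posG j (posX i F) := by
  rw [posG_apply, posG_apply, map_add, map_smul, posX_gam, posX_gam]

lemma posX_negG (i j : Fin (n / 2)) (F : Poly n) : posX i (negG j F) = negG j (posX i F) := by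
  rw [negG_apply, negG_apply, map_sub, map_smul, posX_gam, posX_gam]

lemma posG_mulX (i : Fin (n / 2)) (a : Fin n) (F : Poly n) :
    posG i (mulX a F) = mulX a (posG i F) := by
  simp only [posG_apply, map_add, map_smul, gam_mulX]

lemma der_posG (i : Fin (n / 2)) (a : Fin n) (F : Poly n) :
    der a (posG i F) = posG i (der a F) := by
  simp only [posG_apply, map_add, map_smul, der_gam]

lemma posD_posG (i j : Fin (n / 2)) (F : Poly n) : posD i (posG j F) = posG j (posD i F) := by
  simp only [posD_apply, map_add, map_smul, der_posG]

lemma negD_posG (i j : Fin (n / 2)) (F : Poly n) : negD i (posG j F) = posG j (negD i F) := by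
  simp only [negD_apply, map_sub, map_smul, der_posG]

lemma posD_gam (i : Fin (n / 2)) (a : Fin n) (F : Poly n) :
    posD i (gam a F) = gam a (posD i F) := by
  simp only [posD_apply, map_add, map_smul, der_gam]

lemma posD_der (i : Fin (n / 2)) (a : Fin n) (F : Poly n) :
    posD i (der a F) = der a (posD i F) := by
  simp only [posD_apply, map_add, map_smul, der_comm a]

lemma negD_der (i : Fin (n / 2)) (a : Fin n) (F : Poly n) :
    negD i (der a F) = der a (negD i F) := by
  simp only [negD_apply, map_sub, map_smul, der_comm a]

lemma posD_posX (i : Fin (n / 2)) (F : Poly n) : posD i (posX i F) = posX i (posD i F) := by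
  simp only [posD_apply, posX_apply, map_add, map_smul, der_mulX, dlt_self, dlt_odd_even,
    dlt_even_odd]
  have := Complex.I_mul_I
  match_scalars <;> first | ring1 | linear_combination this

lemma posD_mulX (i : Fin (n / 2)) (a : Fin n) (ha : 2 * i.1 + 2 ≤ a.1) (F : Poly n) :
    posD i (mulX a F) = mulX a (posD i F) := by
  have h1 : dlt (evenIdx i) a = 0 := by
    simp [dlt, evenIdx, Fin.ext_iff]; omega
  have h2 : dlt (oddIdx i) a = 0 := by
    simp [dlt, oddIdx, Fin.ext_iff]; omega
  simp only [posD_apply, map_add, map_smul, der_mulX, h1, h2]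
  module

lemma gam_injective (a : Fin n) {F : Poly n} (h : gam a F = 0) : F = 0 := by
  rw [← gam_sq a F, h, map_zero]

lemma eul_der_of_eul {F : Poly n} {c : ℂ} (h : eul n F = c • F) (k : Fin n) :
    eul n (der k F) = (c - 1) • der k F := by
  have := der_eul k F
  rw [h, map_smul] at this
  rw [sub_smul, one_smul, this]; abel

lemma eul_posD_of_eul {F : Poly n} {c : ℂ} (h : eul n F = c • F) (i : Fin (n / 2)) :
    eul n (posD i F) = (c - 1) • posD i F := by
  rw [posD_apply, map_add, map_smul, eul_der_of_eul h, eul_der_of_eul h]; module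

lemma eul_negD_of_eul {F : Poly n} {c : ℂ} (h : eul n F = c • F) (i : Fin (n / 2)) :
    eul n (negD i F) = (c - 1) • negD i F := by
  rw [negD_apply, map_sub, map_smul, eul_der_of_eul h, eul_der_of_eul h]; module

lemma der_eq_zero_of_eul_zero {F : Poly n} (h : eul n F = (0 : ℂ) • F) (k : Fin n) :
    der k F = 0 :=
  eq_zero_of_eul_neg (by rw [eul_der_of_eul h, zero_sub])

/-- Only the positive roots involving the first plane are used. The derivative `posD` commutes with
the corresponding operators and with `∂̸`, so `posD F` satisfies the same hypotheses one degree
lower. Feeding the root equations into the Dirac equation multiplied by the isotropic coordinate `z`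
first gives `posD F = 0`, then `posG F = 0`, and finally the vanishing of the other derivatives. -/
lemma nilradical_killed (hn : 3 ≤ n) (l : ℕ) (F : Poly n) (h1 : dirac n F = 0)
    (h2 : eul n F = (l : ℂ) • F)
    (h3 : ∀ a ∈ restIdx n, posX (fstIdx hn) (der a F) - mulX a (posD (fstIdx hn) F)
      + (1 / 2 : ℂ) • posG (fstIdx hn) (gam a F) = 0) :
    posG (fstIdx hn) F = 0 ∧ posD (fstIdx hn) F = 0 ∧ ∀ a ∈ restIdx n, der a F = 0 := by
  have hge : ∀ a ∈ restIdx n, 2 * (fstIdx hn).1 + 2 ≤ a.1 := fun a ha => by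
    simpa [fstIdx] using mem_restIdx.1 ha
  induction l generalizing F with
  | zero =>
    rw [Nat.cast_zero] at h2
    have hd := der_eq_zero_of_eul_zero h2
    have hp : posD (fstIdx hn) F = 0 := by simp [posD_apply, hd]
    refine ⟨?_, hp, fun a _ => hd a⟩
    have ha : (⟨2, by omega⟩ : Fin n) ∈ restIdx n := mem_restIdx.2 le_rfl
    have := h3 _ ha
    rw [hd, hp, map_zero, map_zero, sub_zero, zero_add, posG_gam _ _ (hge _ ha), smul_neg,
      neg_eq_zero] at this
    exact gam_injective _ ((smul_eq_zero.1 this).resolve_left (by norm_num))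
  | succ l ih =>
    set i := fstIdx hn
    obtain ⟨g1, g2, g3⟩ := ih (posD i F)
      (by rw [posD_apply, map_add, map_smul, ← der_dirac, ← der_dirac, h1]; simp)
      (by rw [eul_posD_of_eul h2]; push_cast; congr 1; ring)
      (fun a ha => by
        have := congrArg (posD i) (h3 a ha)
        rwa [map_add, map_sub, map_smul, map_zero, posD_posX, posD_der,
          posD_mulX _ _ (hge a ha), posD_posG, posD_gam] at this)
    -- Multiply the Dirac equation by `z` and replace each `z ∂_a F` with the help of `h3`; the `n -
    -- 2` coordinates outside the first plane give the coefficient `(n - 2) / 2`.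
    have key : (1 / 2 : ℂ) • negG i (posX i (posD i F)) + (1 / 2 : ℂ) • posG i (posX i (negD i F))
        + ∑ a ∈ restIdx n, mulX a (gam a (posD i F)) + ((n - 2) / 2 : ℂ) • posG i F = 0 := by
      have h4 := congrArg (posX i) (dirac_split hn F)
      rw [h1, map_zero] at h4
      rw [map_add, map_add, map_smul, map_smul, posX_negG, posX_posG, map_sum] at h4
      rw [h4, add_assoc _ (∑ a ∈ _, _)]
      congr 1
      have h5 : ∀ a ∈ restIdx n, posX i (gam a (der a F))
          = mulX a (gam a (posD i F)) + (1 / 2 : ℂ) • posG i F := by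
        intro a ha
        have h6 : posX i (der a F) = mulX a (posD i F) + (1 / 2 : ℂ) • gam a (posG i F) := by
          have := h3 a ha
          rw [posG_gam _ _ (hge a ha)] at this
          rw [← sub_eq_zero, ← this]; module
        rw [posX_gam, h6, map_add, map_smul, gam_sq, gam_mulX]
      rw [Finset.sum_congr rfl h5, Finset.sum_add_distrib, Finset.sum_const,
        ← Nat.cast_smul_eq_nsmul ℂ, card_restIdx hn]
      module
    -- Applying `posG` to `key` kills every term except the first, since `posG² = 0` and `posG (posD
    -- F) = 0`; that term becomes `2 z posD F`, and `z` is not a zero divisor.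
    have hg : posD i F = 0 := by
      have h7 := congrArg (posG i) key
      have h8 : ∀ a ∈ restIdx n, posG i (mulX a (gam a (posD i F))) = 0 := fun a ha => by
        rw [posG_mulX, posG_gam _ _ (hge a ha), g1, map_zero, neg_zero, map_zero]
      rw [map_add, map_add, map_add, map_smul, map_smul, map_smul, posG_posG, posG_posG, map_sum,
        Finset.sum_eq_zero h8, posG_negG, ← posX_posG, g1] at h7
      simp only [map_zero, sub_zero, smul_zero, add_zero, smul_smul] at h7
      exact posX_injective i ((smul_eq_zero.1 h7).resolve_left (by norm_num))
    have hda : ∀ a ∈ restIdx n, posX i (der a F) = (1 / 2 : ℂ) • gam a (posG i F) := by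
      intro a ha
      have := h3 a ha
      rw [posG_gam _ _ (hge a ha), hg, map_zero] at this
      rw [← sub_eq_zero, ← this]; module
    -- Now `posG F` depends on one isotropic direction only, so the Euler operator on it is `z negD
    -- / 2`. Then `key` reads `(2l + n)/2` times `posG F` equals zero.
    have hh : posG i F = 0 := by
      have h9 : ∀ a ∈ restIdx n, der a (posG i F) = 0 := fun a ha => by
        refine posX_injective i ?_
        rw [der_posG, posX_posG, hda a ha, map_smul, posG_gam _ _ (hge a ha), posG_posG]
        simp
      have h10 : posX i (negD i (posG i F)) = (2 * (l + 1) : ℂ) • posG i F := by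
        have h11 : eul n (posG i F) = ((l + 1 : ℕ) : ℂ) • posG i F := by
          rw [posG_apply, map_add, map_smul, eul_gam, eul_gam, h2, map_smul, map_smul]; module
        rw [eul_split hn, posD_posG, hg, Finset.sum_eq_zero fun a ha => by rw [h9 a ha, map_zero]]
          at h11
        simp only [map_zero, smul_zero, zero_add, add_zero] at h11
        have := congrArg ((2 : ℂ) • ·) h11
        simp only [smul_smul] at this
        norm_num at this
        exact this
      rw [hg] at key
      simp only [map_zero, smul_zero, zero_add, Finset.sum_const_zero, add_zero] at key
      rw [← posX_posG, ← negD_posG, h10, smul_smul, ← add_smul] at key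
      refine (smul_eq_zero.1 key).resolve_left ?_
      have : (((2 * l + n : ℕ) : ℂ)) ≠ 0 := Nat.cast_ne_zero.2 (by omega)
      intro h; apply this; push_cast; linear_combination 2 * h
    refine ⟨hh, hg, fun a ha => posX_injective i ?_⟩
    rw [hda a ha, hh]; simp

/-- The isotropic coordinate of highest weight. -/
def zPoly (hn : 3 ≤ n) : MvPolynomial (Fin n) ℂ :=
  MvPolynomial.X (evenIdx (fstIdx hn)) + MvPolynomial.C Complex.I * MvPolynomial.X (oddIdx (fstIdx hn))

lemma posX_fst_apply (hn : 3 ≤ n) (F : Poly n) (b : Bits n) :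
    posX (fstIdx hn) F b = zPoly hn * F b := by
  rw [posX_apply, Pi.add_apply, Pi.smul_apply, mulX_apply, mulX_apply, zPoly,
    MvPolynomial.smul_eq_C_mul]
  ring

/-- When all derivatives except `negD` vanish, Euler's identity becomes `2 deg F · F = z negD F`,
which recovers `F` from a polynomial of lower degree of the same kind. -/
lemma eq_zPoly_pow (hn : 3 ≤ n) (l : ℕ) (F : Poly n) (h1 : posD (fstIdx hn) F = 0)
    (h2 : ∀ a ∈ restIdx n, der a F = 0) (h3 : eul n F = (l : ℂ) • F) :
    ∃ s : Bits n → ℂ, F = fun b => MvPolynomial.C (s b) * zPoly hn ^ l := by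
  induction l generalizing F with
  | zero =>
    refine ⟨fun b => (F b).coeff 0, ?_⟩
    ext1 b
    rw [Nat.cast_zero] at h3
    rw [pow_zero, mul_one]
    exact eq_C_of_eul_zero h3 b
  | succ l ih =>
    obtain ⟨s, hs⟩ := ih (negD (fstIdx hn) F)
      (by
        have : posD (fstIdx hn) (negD (fstIdx hn) F) = negD (fstIdx hn) (posD (fstIdx hn) F) := by
          rw [negD_apply, map_sub, map_smul, posD_der, posD_der, negD_apply]
        rw [this, h1, map_zero])
      (fun a ha => by rw [← negD_der, h2 a ha, map_zero])
      (by rw [eul_negD_of_eul h3]; push_cast; congr 1; ring)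
    refine ⟨fun b => (2 * (l + 1) : ℂ)⁻¹ * s b, ?_⟩
    rw [eul_split hn, h1, Finset.sum_eq_zero fun a ha => by rw [h2 a ha, map_zero]] at h3
    simp only [map_zero, smul_zero, zero_add, add_zero] at h3
    have h4 : F = (2 * (l + 1) : ℂ)⁻¹ • posX (fstIdx hn) (negD (fstIdx hn) F) := by
      have hl : (l + 1 : ℂ) ≠ 0 := by exact_mod_cast Nat.succ_ne_zero l
      push_cast at h3
      have : posX (fstIdx hn) (negD (fstIdx hn) F) = (2 * (l + 1) : ℂ) • F := by
        rw [mul_smul, ← h3, smul_smul]; norm_num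
      rw [this, smul_smul, inv_mul_cancel₀ (mul_ne_zero two_ne_zero hl), one_smul]
    rw [h4]
    ext1 b
    rw [Pi.smul_apply, posX_fst_apply, hs, MvPolynomial.smul_eq_C_mul, map_mul]
    ring

lemma half_even (i : Fin (n / 2)) : (half (evenIdx i) : Fin ((n + 1) / 2)) = ⟨i, by omega⟩ := by
  ext; simp [half, evenIdx]

lemma half_odd (i : Fin (n / 2)) : (half (oddIdx i) : Fin ((n + 1) / 2)) = ⟨i, by omega⟩ := by
  ext; simp [half, oddIdx]; omega

/-- In Fock space the positive isotropic Clifford vector is twice a creation operator, up to the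
sign string. Its kernel consists of the spinors in which mode `i` is occupied. -/
lemma posG_bits (i : Fin (n / 2)) (F : Poly n) (b : Bits n) : posG i F b =
    if b ⟨i, by omega⟩ then (2 * strg ⟨i, by omega⟩ b) • F (bflip ⟨i, by omega⟩ b) else 0 := by
  have he : (evenIdx i : Fin n).1 % 2 = 0 := by simp [evenIdx]
  have ho : (oddIdx i : Fin n).1 % 2 = 1 := by simp [oddIdx]
  rw [posG_apply, Pi.add_apply, Pi.smul_apply, gam_apply, gam_apply, half_even, half_odd, phase,
    phase, he, ho, smul_smul, ← add_smul]
  have hI := Complex.I_mul_I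
  have h1 : ¬ ((1 : ℕ) = 0) := one_ne_zero
  rcases hb : b ⟨i, by omega⟩ with _ | _
  · simp only [h1, if_true, if_false, Bool.false_eq_true]
    rw [show ∀ x : ℂ, x = 0 → x • F (bflip ⟨i, by omega⟩ b) = 0 from
      fun x hx => by rw [hx, zero_smul]]
    linear_combination strg ⟨i, by omega⟩ b * hI
  · simp only [h1, if_true, if_false]
    congr 1
    linear_combination -strg ⟨i, by omega⟩ b * hI

lemma eq_zero_of_posG {i : Fin (n / 2)} {F : Poly n} (h : posG i F = 0) {b : Bits n}
    (hb : b ⟨i, by omega⟩ = false) : F b = 0 := by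
  have := congrFun h (bflip ⟨i, by omega⟩ b)
  rw [posG_bits, bflip_self, hb, bflip_bflip] at this
  simp only [Bool.not_false, if_true, Pi.zero_apply] at this
  refine (smul_eq_zero.1 this).resolve_left (mul_ne_zero two_ne_zero fun h0 => ?_)
  have := strg_mul_self ⟨i, by omega⟩ (bflip ⟨i, by omega⟩ b)
  rw [h0] at this
  simp at this

/-- The occupation numbers of the highest weight spinor of chirality `(-1) ^ s`. -/
def topBits (n s : ℕ) : Bits n := fun j => if j.1 + 1 = (n + 1) / 2 then decide (Even s) else true

lemma par_of_top (hn : 3 ≤ n) {b : Bits n} (hb : ∀ j, j.1 + 1 ≠ (n + 1) / 2 → b j = true) :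
    par b = bsgn (b ⟨(n + 1) / 2 - 1, by omega⟩) := by
  rw [par, Finset.prod_eq_single ⟨(n + 1) / 2 - 1, by omega⟩]
  · intro j _ hj
    rw [hb j (fun h => hj (Fin.ext (by simp; omega)))]; simp [bsgn]
  · simp

lemma neg_one_pow_eq_bsgn (s : ℕ) : (-1 : ℂ) ^ s = bsgn (decide (Even s)) := by
  rcases Nat.even_or_odd s with h | h
  · simp [h, bsgn]
  · rw [h.neg_one_pow]; simp [bsgn, h]

lemma bsgn_inj {x y : Bool} (h : bsgn x = bsgn y) : x = y := by
  cases x <;> cases y <;> simp [bsgn] at h ⊢ <;> norm_num [neg_eq_iff_add_eq_zero, eq_neg_iff_add_eq_zero] at h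

/-- The highest weight vector of the monogenic spinor polynomials. -/
def hwv (hn : 3 ≤ n) (s l : ℕ) : Poly n := Pi.single (topBits n s) (zPoly hn ^ l)

/-- The nilradical conditions determine the highest weight vector. -/
lemma eq_smul_hwv (hn : 3 ≤ n) {s l : ℕ} {F : Poly n} (hF : F ∈ mono n s l)
    (h : ∀ (i : Fin (n / 2)) (a : Fin n), 2 * i.1 + 2 ≤ a.1 →
      rot (evenIdx i) a F + Complex.I • rot (oddIdx i) a F = 0) :
    ∃ c : ℂ, F = c • hwv hn s l := by
  have h' : ∀ (i : Fin (n / 2)) (a : Fin n), 2 * i.1 + 2 ≤ a.1 →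
      posX i (der a F) - mulX a (posD i F) + (1 / 2 : ℂ) • posG i (gam a F) = 0 := fun i a ha => by
    have := h i a ha
    rwa [rot_pos i a ha, neg_eq_zero] at this
  obtain ⟨g1, g2, g3⟩ := nilradical_killed hn l F hF.1 hF.2.1
    (fun a ha => h' _ _ (by simpa [fstIdx] using mem_restIdx.1 ha))
  obtain ⟨t, ht⟩ := eq_zPoly_pow hn l F g2 g3 hF.2.1
  -- As `F` involves only `z`, the orbital part of the later root vectors drops out and their spin
  -- part fills every mode that has a coordinate after it. Only the last mode stays free (for odd
  -- `n`, the one not attached to a full plane), and chirality fixes it.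
  have hG : ∀ i : Fin (n / 2), 2 * i.1 + 2 < n → posG i F = 0 := by
    intro i hi
    rcases Nat.eq_zero_or_pos i.1 with h0 | h0
    · rwa [show i = fstIdx hn from Fin.ext h0]
    · have h5 := h' i ⟨2 * i.1 + 2, hi⟩ le_rfl
      have h6 : posD i F = 0 := by
        rw [posD_apply, g3 _ (mem_restIdx.2 (by simp [evenIdx]; omega)),
          g3 _ (mem_restIdx.2 (by simp [oddIdx]; omega))]
        simp
      rw [g3 _ (mem_restIdx.2 (by simp)), h6, posG_gam _ _ le_rfl, map_zero, map_zero, sub_zero,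
        zero_add, smul_neg, neg_eq_zero] at h5
      exact gam_injective _ ((smul_eq_zero.1 h5).resolve_left (by norm_num))
  have hsupp : ∀ b, F b ≠ 0 → b = topBits n s := by
    intro b hb
    have hb1 : ∀ j : Fin ((n + 1) / 2), j.1 + 1 ≠ (n + 1) / 2 → b j = true := by
      intro j hj
      by_contra hbj
      have := j.2
      exact hb (eq_zero_of_posG (hG ⟨j.1, by omega⟩ (by simp; omega)) (by simpa using hbj))
    have h7 := congrFun hF.2.2 b
    rw [chi_apply, Pi.smul_apply, ← sub_eq_zero, ← sub_smul] at h7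
    have h8 := sub_eq_zero.1 ((smul_eq_zero.1 h7).resolve_right hb)
    rw [par_of_top hn hb1, neg_one_pow_eq_bsgn] at h8
    ext1 j
    rw [topBits]
    split_ifs with hj
    · rw [← bsgn_inj h8]; congr 1; ext; simp; omega
    · exact hb1 j hj
  refine ⟨t (topBits n s), ?_⟩
  ext1 b
  rw [hwv, Pi.smul_apply]
  by_cases hb : b = topBits n s
  · subst hb; rw [Pi.single_eq_same, MvPolynomial.smul_eq_C_mul]; exact congrFun ht _
  · rw [Pi.single_eq_of_ne hb, smul_zero]
    by_contra h9
    exact hb (hsupp b h9)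
end HighestWeight

/-! ### The Fischer inner product and irreducibility of the monogenics -/

section FischerForm
variable {n : ℕ}

/-- The factorial of a multi-index. -/
def multiFact (m : Fin n →₀ ℕ) : ℕ := ∏ i, (m i).factorial

lemma multiFact_pos (m : Fin n →₀ ℕ) : 0 < multiFact m :=
  Finset.prod_pos fun _ _ => Nat.factorial_pos _

lemma multiFact_add_single (m : Fin n →₀ ℕ) (k : Fin n) :
    multiFact (m + Finsupp.single k 1) = (m k + 1) * multiFact m := by
  rw [multiFact, multiFact, ← Finset.mul_prod_erase _ _ (Finset.mem_univ k),
    ← Finset.mul_prod_erase _ _ (Finset.mem_univ k), ← mul_assoc]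
  congr 1
  · simp [Nat.factorial_succ]
  · refine Finset.prod_congr rfl fun i hi => ?_
    rw [Finsupp.add_apply, Finsupp.single_eq_of_ne (Finset.ne_of_mem_erase hi), add_zero]

/-- The bilinear Fischer pairing of polynomials. -/
def polyPair (n : ℕ) : MvPolynomial (Fin n) ℂ →ₗ[ℂ] MvPolynomial (Fin n) ℂ →ₗ[ℂ] ℂ :=
  (MvPolynomial.basisMonomials (Fin n) ℂ).constr ℂ
    fun m => (multiFact m : ℂ) • MvPolynomial.lcoeff ℂ m

lemma polyPair_monomial (m : Fin n →₀ ℕ) (g : MvPolynomial (Fin n) ℂ) :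
    polyPair n (MvPolynomial.monomial m 1) g = multiFact m * g.coeff m := by
  have := (MvPolynomial.basisMonomials (Fin n) ℂ).constr_basis ℂ
    (fun m => (multiFact m : ℂ) • MvPolynomial.lcoeff ℂ m) m
  rw [MvPolynomial.coe_basisMonomials] at this
  rw [polyPair, this]; rfl

lemma poly_ext {M : Type} [AddCommGroup M] [Module ℂ M] {f g : MvPolynomial (Fin n) ℂ →ₗ[ℂ] M}
    (h : ∀ m, f (MvPolynomial.monomial m 1) = g (MvPolynomial.monomial m 1)) : f = g :=
  (MvPolynomial.basisMonomials (Fin n) ℂ).ext fun m => by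
    rw [MvPolynomial.coe_basisMonomials]; exact h m

/-- The weights `m!` are chosen so that multiplication and differentiation are adjoint: raising
`m_k` by one multiplies `m!` by `m_k + 1`. -/
lemma polyPair_X_mul (k : Fin n) (f g : MvPolynomial (Fin n) ℂ) :
    polyPair n (MvPolynomial.X k * f) g = polyPair n f (MvPolynomial.pderiv k g) := by
  have : (polyPair n).flip g ∘ₗ LinearMap.mulLeft ℂ (MvPolynomial.X k) =
      (polyPair n).flip (MvPolynomial.pderiv k g) := by
    refine poly_ext fun m => ?_
    have h : (MvPolynomial.X k * MvPolynomial.monomial m 1 : MvPolynomial (Fin n) ℂ)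
        = MvPolynomial.monomial (m + Finsupp.single k 1) 1 := by
      rw [MvPolynomial.X, MvPolynomial.monomial_mul, add_comm, one_mul]
    simp only [LinearMap.comp_apply, LinearMap.mulLeft_apply, LinearMap.flip_apply, h,
      polyPair_monomial, MvPolynomial.coeff_pderiv, multiFact_add_single]
    push_cast; ring
  exact DFunLike.congr_fun this f

lemma polyPair_comm (f g : MvPolynomial (Fin n) ℂ) : polyPair n f g = polyPair n g f := by
  have : polyPair n = (polyPair n).flip := by
    refine poly_ext fun m => poly_ext fun m' => ?_
    rw [LinearMap.flip_apply, polyPair_monomial, polyPair_monomial, MvPolynomial.coeff_monomial,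
      MvPolynomial.coeff_monomial]
    by_cases h : m' = m
    · subst h; rfl
    · rw [if_neg h, if_neg (Ne.symm h), mul_zero, mul_zero]
  exact DFunLike.congr_fun (DFunLike.congr_fun this f) g

/-- Complex conjugation of the coefficients of a polynomial. -/
abbrev polyConj (n : ℕ) : MvPolynomial (Fin n) ℂ →+* MvPolynomial (Fin n) ℂ :=
  MvPolynomial.map (starRingEnd ℂ)

lemma polyConj_smul (c : ℂ) (f : MvPolynomial (Fin n) ℂ) :
    polyConj n (c • f) = starRingEnd ℂ c • polyConj n f := by
  rw [MvPolynomial.smul_eq_C_mul, map_mul, MvPolynomial.map_C, MvPolynomial.smul_eq_C_mul]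

lemma polyPair_conj_self (f : MvPolynomial (Fin n) ℂ) :
    0 ≤ (polyPair n (polyConj n f) f).re ∧ ((polyPair n (polyConj n f) f).re = 0 → f = 0) := by
  have h : polyPair n (polyConj n f) f =
      ∑ m ∈ f.support, ((multiFact m * Complex.normSq (f.coeff m) : ℝ) : ℂ) := by
    have h1 : polyConj n f = ∑ m ∈ f.support, starRingEnd ℂ (f.coeff m) •
        MvPolynomial.monomial m 1 := by
      ext m
      simp only [MvPolynomial.coeff_map, MvPolynomial.coeff_sum, MvPolynomial.coeff_smul,
        MvPolynomial.coeff_monomial, smul_eq_mul, mul_ite, mul_one, mul_zero,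
        Finset.sum_ite_eq', MvPolynomial.mem_support_iff]
      split_ifs with h
      · rfl
      · rw [not_not.1 h, map_zero]
    rw [h1, map_sum, LinearMap.sum_apply]
    refine Finset.sum_congr rfl fun m _ => ?_
    rw [map_smul, LinearMap.smul_apply, polyPair_monomial, smul_eq_mul]
    push_cast
    rw [Complex.normSq_eq_conj_mul_self]; ring
  have h0 : ∀ m ∈ f.support, 0 ≤ (multiFact m * Complex.normSq (f.coeff m) : ℝ) := fun m _ =>
    mul_nonneg (Nat.cast_nonneg _) (Complex.normSq_nonneg _)
  rw [h, ← Complex.ofReal_sum, Complex.ofReal_re]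
  refine ⟨Finset.sum_nonneg h0, fun h2 => ?_⟩
  rw [Finset.sum_eq_zero_iff_of_nonneg h0] at h2
  ext m
  by_contra h3
  have := h2 m (MvPolynomial.mem_support_iff.2 h3)
  rcases mul_eq_zero.1 this with h4 | h4
  · exact (multiFact_pos m).ne' (by exact_mod_cast h4)
  · exact h3 (Complex.normSq_eq_zero.1 h4)

/-- The Fischer form on spinor polynomials. -/
def fischer (F G : Poly n) : ℂ := ∑ b, polyPair n (polyConj n (F b)) (G b)

lemma fischer_add_left (F F' G : Poly n) : fischer (F + F') G = fischer F G + fischer F' G := by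
  simp only [fischer, Pi.add_apply, map_add, LinearMap.add_apply, Finset.sum_add_distrib]

lemma fischer_add_right (F G G' : Poly n) : fischer F (G + G') = fischer F G + fischer F G' := by
  simp only [fischer, Pi.add_apply, map_add, Finset.sum_add_distrib]

lemma fischer_smul_left (c : ℂ) (F G : Poly n) :
    fischer (c • F) G = starRingEnd ℂ c * fischer F G := by
  simp only [fischer, Pi.smul_apply, polyConj_smul, map_smul, LinearMap.smul_apply, smul_eq_mul,
    Finset.mul_sum]

lemma fischer_smul_right (c : ℂ) (F G : Poly n) : fischer F (c • G) = c * fischer F G := by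
  simp only [fischer, Pi.smul_apply, map_smul, smul_eq_mul, Finset.mul_sum]

lemma fischer_neg_left (F G : Poly n) : fischer (-F) G = -fischer F G := by
  rw [← neg_one_smul ℂ, fischer_smul_left]; simp

lemma fischer_neg_right (F G : Poly n) : fischer F (-G) = -fischer F G := by
  rw [← neg_one_smul ℂ, fischer_smul_right]; simp

lemma fischer_sub_left (F F' G : Poly n) : fischer (F - F') G = fischer F G - fischer F' G := by
  rw [sub_eq_add_neg, fischer_add_left, fischer_neg_left, sub_eq_add_neg]

lemma fischer_sub_right (F G G' : Poly n) : fischer F (G - G') = fischer F G - fischer F G' := by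
  rw [sub_eq_add_neg, fischer_add_right, fischer_neg_right, sub_eq_add_neg]

lemma fischer_self_nonneg (F : Poly n) : 0 ≤ (fischer F F).re := by
  rw [fischer, Complex.re_sum]
  exact Finset.sum_nonneg fun b _ => (polyPair_conj_self (F b)).1

lemma fischer_self_eq_zero {F : Poly n} (h : fischer F F = 0) : F = 0 := by
  have h1 := congrArg Complex.re h
  rw [fischer, Complex.re_sum, Complex.zero_re,
    Finset.sum_eq_zero_iff_of_nonneg fun b _ => (polyPair_conj_self (F b)).1] at h1
  ext1 b
  exact (polyPair_conj_self (F b)).2 (h1 b (Finset.mem_univ b))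

lemma fischer_mulX (k : Fin n) (F G : Poly n) : fischer (mulX k F) G = fischer F (der k G) := by
  refine Finset.sum_congr rfl fun b _ => ?_
  rw [mulX_apply, map_mul, MvPolynomial.map_X, polyPair_X_mul, der_apply]

lemma fischer_der (k : Fin n) (F G : Poly n) : fischer (der k F) G = fischer F (mulX k G) := by
  refine Finset.sum_congr rfl fun b _ => ?_
  have h : polyConj n (MvPolynomial.pderiv k (F b)) = MvPolynomial.pderiv k (polyConj n (F b)) := by
    ext m
    simp [MvPolynomial.coeff_pderiv, MvPolynomial.coeff_map]
  rw [mulX_apply, polyPair_comm _ (_ * _), polyPair_X_mul, der_apply, polyPair_comm, h]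

lemma strg_conj (i : Fin ((n + 1) / 2)) (b : Bits n) : starRingEnd ℂ (strg i b) = strg i b := by
  rw [strg, map_prod]
  refine Finset.prod_congr rfl fun j _ => ?_
  cases b j <;> simp [bsgn]

lemma phase_conj (a : Fin n) (x : Bool) : starRingEnd ℂ (phase a (!x)) = phase a x := by
  rw [phase, phase]
  cases x <;> split_ifs <;> simp_all

/-- Reindex the sum by flipping the mode: the string at `half a` is real and unaffected, and the
phase of the flipped bit is the conjugate one. Together with the adjointness of `x_k` and `∂_k` this
makes rotations skew. -/
lemma fischer_gam (a : Fin n) (F G : Poly n) : fischer (gam a F) G = fischer F (gam a G) := by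
  have hinv : Function.Involutive (bflip (half a) : Bits n → Bits n) := bflip_bflip _
  rw [fischer, fischer, ← Equiv.sum_comp hinv.toPerm]
  refine Finset.sum_congr rfl fun b _ => ?_
  rw [Function.Involutive.coe_toPerm, gam_apply, gam_apply, bflip_bflip, polyConj_smul, map_smul,
    map_smul, LinearMap.smul_apply, map_mul, strg_conj, bflip_self, phase_conj,
    strg_bflip_ge le_rfl]

lemma fischer_rot (j k : Fin n) (F G : Poly n) :
    fischer (rot j k F) G = -fischer F (rot j k G) := by
  have hd : starRingEnd ℂ (dlt j k) = dlt j k := by rw [dlt]; split_ifs <;> simp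
  simp only [rot_apply, fischer_neg_left, fischer_neg_right, fischer_add_left, fischer_add_right,
    fischer_sub_left, fischer_sub_right, fischer_smul_left, fischer_smul_right, fischer_mulX,
    fischer_der, fischer_gam, gam_gam k j, hd, dlt_comm k j, map_div₀, map_one,
    map_ofNat]
  ring

/-- Monogenic spinor polynomials of fixed degree and chirality are irreducible under rotations. -/
lemma mono_irreducible (hn : 3 ≤ n) {s l : ℕ} (W : Submodule ℂ (Poly n)) (hW : W ≤ mono n s l)
    (hr : ∀ j k, ∀ F ∈ W, rot j k F ∈ W) (h : ∀ W : Submodule ℂ (Poly n), W ≤ mono n s l →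
      (∀ j k, ∀ F ∈ W, rot j k F ∈ W) → W ≠ ⊥ → hwv hn s l ∈ W) : W = ⊥ ∨ W = mono n s l := by
  by_contra! hcon
  obtain ⟨h1, h2⟩ := hcon
  have hv := h W hW hr h1
  -- The orthogonal complement of `W` in `M_l` is stable because rotations are skew. If both spaces
  -- were nonzero, both would contain the highest weight vector, which would then be orthogonal to
  -- itself.
  let W' : Submodule ℂ (Poly n) :=
    { carrier := {F | F ∈ mono n s l ∧ ∀ G ∈ W, fischer G F = 0}
      add_mem' := fun {F F'} hF hF' => ⟨add_mem hF.1 hF'.1, fun G hG => by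
        rw [fischer_add_right, hF.2 G hG, hF'.2 G hG, add_zero]⟩
      zero_mem' := ⟨zero_mem _, fun G _ => by
        rw [← zero_smul ℂ (0 : Poly n), fischer_smul_right, zero_mul]⟩
      smul_mem' := fun c F hF => ⟨Submodule.smul_mem _ c hF.1, fun G hG => by
        rw [fischer_smul_right, hF.2 G hG, mul_zero]⟩ }
  -- If the complement vanished, pairing with a basis of `W` would embed `M_l` in a space of
  -- dimension `dim W`, forcing `W = M_l`.
  have hW' : W' ≠ ⊥ := by
    intro h0
    apply h2
    have := mono_finite (n := n) s l
    have hWf : Module.Finite ℂ W := Submodule.finiteDimensional_of_le hW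
    let e := Module.finBasis ℂ W
    let f : mono n s l →ₗ[ℂ] (Fin (Module.finrank ℂ W) → ℂ) :=
      { toFun := fun F i => fischer (e i : Poly n) F
        map_add' := fun F G => by ext i; exact fischer_add_right _ _ _
        map_smul' := fun c F => by ext i; exact fischer_smul_right _ _ _ }
    have hf : Function.Injective f := by
      rw [injective_iff_map_eq_zero]
      intro F hF
      have : (F : Poly n) ∈ W' := by
        refine ⟨F.2, fun G hG => ?_⟩
        have hG' := congrArg Subtype.val (e.sum_repr ⟨G, hG⟩)
        simp only [Submodule.coe_sum, Submodule.coe_smul] at hG'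
        rw [← hG']
        have hsum : ∀ (t : Finset (Fin (Module.finrank ℂ W))) (g : _ → Poly n),
            (∀ i ∈ t, fischer (g i) F = 0) → fischer (∑ i ∈ t, g i) F = 0 := by
          intro t g hg
          induction t using Finset.induction_on with
          | empty => rw [Finset.sum_empty, ← zero_smul ℂ (0 : Poly n), fischer_smul_left]; simp
          | insert a t ha ih =>
            rw [Finset.sum_insert ha, fischer_add_left, hg a (Finset.mem_insert_self _ _),
              ih fun i hi => hg i (Finset.mem_insert_of_mem hi), add_zero]
        refine hsum _ _ fun i _ => ?_
        rw [fischer_smul_left]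
        have := congrFun hF i
        change fischer (e i : Poly n) F = 0 at this
        rw [this, mul_zero]
      rw [h0, Submodule.mem_bot] at this
      exact Subtype.ext this
    have hle := LinearMap.finrank_le_finrank_of_injective hf
    rw [Module.finrank_fin_fun] at hle
    exact Submodule.eq_of_le_of_finrank_le hW hle
  have hv' := h W' (fun F hF => hF.1) (fun j k F hF => ⟨?_, fun G hG => ?_⟩) hW'
  · have h3 := fischer_self_eq_zero (hv'.2 _ hv)
    have h4 := congrFun h3 (topBits n s)
    rw [hwv, Pi.single_eq_same] at h4
    have h5 := eq_zero_of_pow_eq_zero h4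
    have h6 := posX_injective (fstIdx hn) (F := fun _ => 1) (by
      ext1 b; rw [posX_fst_apply, h5, zero_mul]; rfl)
    exact one_ne_zero (congrFun h6 (topBits n s))
  · obtain ⟨⟨h3, h4, h5⟩, -⟩ := hF
    refine ⟨?_, ?_, ?_⟩
    · rw [← rot_dirac, h3, map_zero]
    · rw [← rot_eul, h4, map_smul]
    · rw [← rot_chi, h5, map_smul]
  · have := fischer_rot j k G F
    rw [hF.2 _ (hr j k G hG)] at this
    rw [← neg_eq_zero, ← this]
end FischerForm

/-! ### The `𝔨`-types of the spinor polynomials -/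

section KTypes
variable {n : ℕ}

/-- A nonzero finite dimensional `𝔨`-module has a vector killed by the positive root vectors. -/
lemma exists_killed {V : Type} [AddCommGroup V] [Module ℂ V] [LieRingModule (compactK n) V]
    [LieModule ℂ (compactK n) V] [FiniteDimensional ℂ V] [Nontrivial V] :
    ∃ v : V, v ≠ 0 ∧ ∀ x ∈ posCompact n, ⁅x, v⁆ = 0 := by
  let g := gradEnd n V
  -- Positive root vectors raise the grading by a positive integer, so they kill an eigenvector
  -- whose eigenvalue has maximal real part.
  obtain ⟨c, hc, hmax⟩ := Set.exists_max_image {c | g.HasEigenvalue c} Complex.re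
    (Module.End.finite_hasEigenvalue (f := g)) (Module.End.exists_eigenvalue g)
  obtain ⟨v, hv⟩ := hc.exists_hasEigenvector
  refine ⟨v, hv.2, fun x hx => ?_⟩
  by_contra hne
  obtain ⟨m, hm, hxm⟩ := lie_gradK_posCompact hx
  have h1 : g.HasEigenvalue (m + c) := by
    refine Module.End.hasEigenvalue_of_hasEigenvector (x := ⁅x, v⁆) ⟨?_, hne⟩
    rw [Module.End.mem_eigenspace_iff]
    change ⁅gradK n, ⁅x, v⁆⁆ = _
    have h2 : ⁅gradK n, v⁆ = c • v := hv.apply_eq_smul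
    rw [leibniz_lie, hxm, h2, smul_lie, lie_smul, add_smul]
  have h3 := hmax _ h1
  simp at h3
  omega

lemma rhoLin_wedgeSpace (E : ℂ) (j k : Fin n) :
    rhoLin n E (wedgeSpace (Pi.single j 1) (Pi.single k 1) : compactK n) = rot j k := by
  rw [wedgeSpace_single, rhoLin_rotM]

lemma rhoLin_compact_mem (E : ℂ) (W : Submodule ℂ (Poly n)) (hr : ∀ j k, ∀ F ∈ W, rot j k F ∈ W)
    (he : ∀ F ∈ W, eul n F ∈ W) (x : compactK n) {F : Poly n} (hF : F ∈ W) :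
    rhoLin n E (x : so2 n) F ∈ W := by
  have h : (x : so2 n) = _ := congrArg (kIncl n) (compactK_decomp x)
  rw [h]
  simp only [map_add, map_sum, map_smul, LinearMap.add_apply, LinearMap.sum_apply,
    LinearMap.smul_apply, kIncl_apply, rhoLin_wedgeSpace, coe_cartanH_zero, rhoLin_hTime, hOp_apply]
  refine add_mem (W.smul_mem _ (neg_mem (add_mem (he F hF) (W.smul_mem _ hF)))) ?_
  exact sum_mem fun j _ => sum_mem fun k _ => W.smul_mem _ (hr j k F hF)

/-- A submodule of spinor polynomials stable under rotations and dilations. -/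
def stableK (E : ℂ) (W : Submodule ℂ (Poly n)) (hr : ∀ j k, ∀ F ∈ W, rot j k F ∈ W)
    (he : ∀ F ∈ W, eul n F ∈ W) : LieSubmodule ℂ (compactK n) (ConfMod n E) where
  __ := (W : Submodule ℂ (ConfMod n E))
  lie_mem {x} _ hF := rhoLin_compact_mem E W hr he x hF

lemma mono_eul_mem {s l : ℕ} {W : Submodule ℂ (Poly n)} (hW : W ≤ mono n s l) :
    ∀ F ∈ W, eul n F ∈ W := fun F hF => by
  rw [(hW hF).2.1]; exact W.smul_mem _ hF

lemma mono_rot_mem {s l : ℕ} (j k : Fin n) {F : Poly n} (hF : F ∈ mono n s l) :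
    rot j k F ∈ mono n s l := by
  obtain ⟨h3, h4, h5⟩ := hF
  refine ⟨?_, ?_, ?_⟩
  · rw [← rot_dirac, h3, map_zero]
  · rw [← rot_eul, h4, map_smul]
  · rw [← rot_chi, h5, map_smul]

lemma rhoLin_isoPos (E : ℂ) (i : Fin (n / 2)) (a : Fin n) (F : Poly n) :
    rhoLin n E (wedgeSpace (isoPos i) (Pi.single a 1) : compactK n) F =
      rot (evenIdx i) a F + Complex.I • rot (oddIdx i) a F := by
  have h : (wedgeSpace (isoPos i) (Pi.single a 1) : compactK n) =
      wedgeSpace (Pi.single (evenIdx i) 1) (Pi.single a 1)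
      + Complex.I • wedgeSpace (Pi.single (oddIdx i) 1) (Pi.single a 1) := by
    have : (isoPos i : Fin n → ℂ) = Pi.single (evenIdx i) 1
        + Complex.I • Pi.single (oddIdx i) 1 := by
      rw [isoPos, ← Pi.single_smul, smul_eq_mul, mul_one]
    rw [this, wedgeSpace_eq, map_add, map_smul]; rfl
  have h' := congrArg (kIncl n) h
  rw [map_add, map_smul] at h'
  change (wedgeSpace (isoPos i) (Pi.single a 1) : so2 n) = _ at h'
  rw [h', map_add, map_smul, kIncl_apply, kIncl_apply, rhoLin_wedgeSpace, rhoLin_wedgeSpace]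
  rfl

lemma killed_of_posCompact {E : ℂ} {F : ConfMod n E} (h : ∀ x ∈ posCompact n, ⁅x, F⁆ = 0)
    (i : Fin (n / 2)) (a : Fin n) (ha : 2 * i.1 + 2 ≤ a.1) :
    rot (evenIdx i) a F + Complex.I • rot (oddIdx i) a F = 0 := by
  have h1 : ∀ x ∈ Submodule.span ℂ (posCompact n), ⁅x, F⁆ = 0 := by
    intro x hx
    induction hx using Submodule.span_induction with
    | mem x hx => exact h x hx
    | zero => exact zero_lie F
    | add x y _ _ hx hy => rw [add_lie, hx, hy, add_zero]
    | smul c x _ hx => rw [smul_lie, hx, smul_zero]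
  have h2 := h1 _ (wedge_isoPos_mem_span i a ha)
  exact (rhoLin_isoPos E i a F).symm.trans h2

/-- Every nonzero rotation-stable space of monogenics contains the highest weight vector. -/
lemma hwv_mem (hn : 3 ≤ n) {s l : ℕ} (W : Submodule ℂ (Poly n)) (hW : W ≤ mono n s l)
    (hr : ∀ j k, ∀ F ∈ W, rot j k F ∈ W) (hW0 : W ≠ ⊥) : hwv hn s l ∈ W ∧
    ∀ E, ∀ x ∈ posCompact n, rhoLin n E (x : so2 n) (hwv hn s l) = 0 := by
  -- An extremal vector exists by finite dimension and is a multiple of the expected vector by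
  -- uniqueness. This also proves that the expected vector is killed by the positive root vectors,
  -- without computing their action on it.
  have key : ∀ E, ∃ c : ℂ, c ≠ 0 ∧ c • hwv hn s l ∈ W ∧
      ∀ x ∈ posCompact n, rhoLin n E (x : so2 n) (c • hwv hn s l) = 0 := by
    intro E
    let W' := stableK E W hr (mono_eul_mem hW)
    have := mono_finite (n := n) s l
    have hfin : FiniteDimensional ℂ W' := (Submodule.finiteDimensional_of_le hW : Module.Finite ℂ W)
    have hnt : Nontrivial W' := (Submodule.nontrivial_iff_ne_bot.2 hW0 : Nontrivial W)
    obtain ⟨⟨F, hF⟩, hF0, hpos⟩ := exists_killed (n := n) (V := W')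
    have hpos' : ∀ x ∈ posCompact n, ⁅x, (F : ConfMod n E)⁆ = 0 := fun x hx =>
      congrArg Subtype.val (hpos x hx)
    obtain ⟨c, rfl⟩ := eq_smul_hwv hn (hW hF) (killed_of_posCompact hpos')
    refine ⟨c, ?_, hF, hpos'⟩
    rintro rfl
    exact hF0 (Subtype.ext (zero_smul ℂ (hwv hn s l)))
  constructor
  · obtain ⟨c, hc, h1, -⟩ := key 0
    have := W.smul_mem c⁻¹ h1
    rwa [smul_smul, inv_mul_cancel₀ hc, one_smul] at this
  · intro E x hx
    obtain ⟨c, hc, -, h1⟩ := key E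
    have := h1 x hx
    rw [map_smul] at this
    exact (smul_eq_zero.1 this).resolve_left hc

lemma mono_eq_bot_or (hn : 3 ≤ n) {s l : ℕ} (W : Submodule ℂ (Poly n)) (hW : W ≤ mono n s l)
    (hr : ∀ j k, ∀ F ∈ W, rot j k F ∈ W) : W = ⊥ ∨ W = mono n s l :=
  mono_irreducible hn W hW hr fun W' h1 h2 h3 => (hwv_mem hn W' h1 h2 h3).1

lemma zPoly_ne_zero (hn : 3 ≤ n) : zPoly hn ≠ 0 := by
  intro h5
  have h6 := posX_injective (fstIdx hn) (F := fun _ => 1) (by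
    ext1 b; rw [posX_fst_apply, h5, zero_mul]; rfl)
  exact one_ne_zero (congrFun h6 (topBits n 0))

lemma hwv_ne_zero (hn : 3 ≤ n) (s l : ℕ) : hwv hn s l ≠ 0 := by
  intro h
  have h4 := congrFun h (topBits n s)
  rw [hwv, Pi.single_eq_same] at h4
  exact zPoly_ne_zero hn (eq_zero_of_pow_eq_zero h4)

lemma hwv_succ (hn : 3 ≤ n) (s l : ℕ) : hwv hn s (l + 1) = posX (fstIdx hn) (hwv hn s l) := by
  ext1 b
  rw [posX_fst_apply, hwv, hwv]
  by_cases hb : b = topBits n s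
  · subst hb; rw [Pi.single_eq_same, Pi.single_eq_same, pow_succ']
  · rw [Pi.single_eq_of_ne hb, Pi.single_eq_of_ne hb, mul_zero]

lemma hwv_zero (hn : 3 ≤ n) (s : ℕ) : hwv hn s 0 =
    fun b => MvPolynomial.C (if b = topBits n s then 1 else 0) := by
  ext1 b
  rw [hwv]
  by_cases hb : b = topBits n s
  · subst hb; rw [Pi.single_eq_same, if_pos rfl, pow_zero, map_one]
  · rw [Pi.single_eq_of_ne hb, if_neg hb, map_zero]

lemma der_const (k : Fin n) (s : Bits n → ℂ) :
    der k (fun b => MvPolynomial.C (s b) : Poly n) = 0 := by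
  ext1 b; simp [der_apply]

/-- Commuting `∂̸` past the isotropic coordinate `z` costs `posG`, which kills the top spinor, so
multiplication by `z` preserves both conditions. -/
lemma hwv_mem_mono (hn : 3 ≤ n) (s l : ℕ) : hwv hn s l ∈ mono n s l := by
  have key : posG (fstIdx hn) (hwv hn s l) = 0 ∧ dirac n (hwv hn s l) = 0 ∧
      eul n (hwv hn s l) = (l : ℂ) • hwv hn s l := by
    induction l with
    | zero =>
      refine ⟨?_, ?_, ?_⟩
      · ext1 b
        rw [posG_bits]
        split_ifs with hb
        · rw [hwv, Pi.single_eq_of_ne, smul_zero]; · rfl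
          intro h
          have := congrFun h ⟨(fstIdx hn).1, by omega⟩
          rw [bflip_self, hb, topBits, if_neg (by simp [fstIdx]; omega)] at this
          exact absurd this (by simp)
        · rfl
      · rw [hwv_zero, dirac_apply]
        exact Finset.sum_eq_zero fun k _ => by rw [der_const, map_zero]
      · rw [hwv_zero, eul_const]; simp
    | succ l ih =>
      obtain ⟨h1, h2, h3⟩ := ih
      rw [hwv_succ]
      refine ⟨by rw [← posX_posG, h1, map_zero], ?_, ?_⟩
      · rw [posX_apply, map_add, map_smul, dirac_mulX, dirac_mulX, h2, map_zero, map_zero, zero_add,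
          zero_add, ← posG_apply, h1]
      · rw [posX_apply, map_add, map_smul, eul_mulX, eul_mulX, h3, map_smul, map_smul]
        push_cast; module
  refine ⟨key.2.1, key.2.2, ?_⟩
  ext1 b
  rw [chi_apply, Pi.smul_apply]
  by_cases hb : b = topBits n s
  · subst hb
    rw [par_of_top hn (b := topBits n s) fun j hj => if_neg hj, neg_one_pow_eq_bsgn, topBits, if_pos (by simp; omega)]
  · rw [hwv, Pi.single_eq_of_ne hb, smul_zero, smul_zero]

lemma mono_ne_bot (hn : 3 ≤ n) (s l : ℕ) : mono n s l ≠ ⊥ := fun h =>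
  hwv_ne_zero hn s l ((Submodule.mem_bot ℂ).1 (h ▸ hwv_mem_mono hn s l))

lemma posCompact_hwv (hn : 3 ≤ n) (s l : ℕ) (E : ℂ) {x : compactK n} (hx : x ∈ posCompact n) :
    rhoLin n E (x : so2 n) (hwv hn s l) = 0 :=
  (hwv_mem hn (mono n s l) le_rfl (fun j k _ hF => mono_rot_mem j k hF) (mono_ne_bot hn s l)).2
    E x hx

/-- Each factor `z` contributes one to the weight in the first plane, and the occupation of mode `i`
contributes `±1/2`. -/
lemma rot_plane_hwv (hn : 3 ≤ n) (s l : ℕ) (i : Fin (n / 2)) :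
    Complex.I • rot (evenIdx i) (oddIdx i) (hwv hn s l) =
      ((if i.1 = 0 then (l : ℂ) else 0) + bsgn (topBits n s ⟨i.1, by omega⟩) / 2) •
        hwv hn s l := by
  have hI := Complex.I_mul_I
  induction l with
  | zero =>
    have h1 : gam (evenIdx i) (gam (oddIdx i) (hwv hn s 0)) =
        (Complex.I * bsgn (topBits n s ⟨i.1, by omega⟩)) • hwv hn s 0 := by
      ext1 b
      have he : (evenIdx i : Fin n).1 % 2 = 0 := by simp [evenIdx]
      have ho : (oddIdx i : Fin n).1 % 2 = 1 := by simp [oddIdx]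
      have h1 : ¬ ((1 : ℕ) = 0) := one_ne_zero
      rw [gam_apply, gam_apply, half_even, half_odd, bflip_bflip, Pi.smul_apply, smul_smul,
        strg_bflip_ge le_rfl, bflip_self, phase, phase, he, ho]
      by_cases hb : b = topBits n s
      · subst hb
        congr 1
        have := strg_mul_self ⟨i.1, by omega⟩ (topBits n s)
        cases topBits n s ⟨i.1, by omega⟩ <;> simp [bsgn]
        · linear_combination Complex.I * this
        · linear_combination Complex.I * this
      · rw [hwv, Pi.single_eq_of_ne hb, smul_zero, smul_zero]
    rw [rot_apply, h1]
    have h2 : ∀ k : Fin n, der k (hwv hn s 0) = 0 := fun k => by rw [hwv_zero, der_const]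
    rw [h2, h2, dlt_even_odd]
    simp only [map_zero, sub_zero, zero_add, zero_smul, smul_smul, ← neg_smul, Nat.cast_zero,
      ite_self]
    congr 1
    linear_combination (-1 / 2 * bsgn (topBits n s ⟨i.1, by omega⟩)) * hI
  | succ l ih =>
    have h1 : Complex.I • rot (evenIdx i) (oddIdx i) (posX (fstIdx hn) (hwv hn s l)) =
        posX (fstIdx hn) (Complex.I • rot (evenIdx i) (oddIdx i) (hwv hn s l)) +
          (if i.1 = 0 then (1 : ℂ) else 0) • posX (fstIdx hn) (hwv hn s l) := by
      have e1 : dlt (evenIdx i) (evenIdx (fstIdx hn) : Fin n) = if i.1 = 0 then (1 : ℂ) else 0 := by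
        simp [dlt, evenIdx, fstIdx]
      have e2 : dlt (oddIdx i) (oddIdx (fstIdx hn) : Fin n) = if i.1 = 0 then (1 : ℂ) else 0 := by
        simp [dlt, oddIdx, fstIdx]
      have e3 : dlt (evenIdx i) (oddIdx (fstIdx hn) : Fin n) = 0 := by
        simp [dlt, evenIdx_ne_oddIdx]
      have e4 : dlt (oddIdx i) (evenIdx (fstIdx hn) : Fin n) = 0 := by
        rw [dlt_comm]; simp [dlt, evenIdx_ne_oddIdx]
      by_cases hi : i.1 = 0
      · have hi' : i = fstIdx hn := Fin.ext hi
        subst hi'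
        simp only [posX_apply, map_add, map_smul, rot_mulX, e1, e2, e3, e4, if_pos hi]
        match_scalars <;> first | ring1 | linear_combination hI | linear_combination -hI
      · simp only [posX_apply, map_add, map_smul, rot_mulX, e1, e2, e3, e4, if_neg hi]
        module
    rw [hwv_succ, h1, ih, map_smul, ← add_smul]
    congr 1
    split_ifs <;> push_cast <;> ring

/-- The last entry of the highest weight of the spinors of chirality `(-1) ^ s`. -/
def chirSpin (n s : ℕ) : ℝ := if Even s then 1 / 2 else lastSpin n

/-- For even `n` the free last mode belongs to the last plane, so chirality decides the sign of the
last entry. For odd `n` that mode belongs to no full plane, and both chiralities have the same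
weight. -/
lemma spinWeight_succ (hn : 3 ≤ n) (E : ℝ) (s l : ℕ) (i : Fin (n / 2)) :
    spinWeight n E l (chirSpin n s) i.succ =
      (if i.1 = 0 then (l : ℂ) else 0) + bsgn (topBits n s ⟨i.1, by omega⟩) / 2 := by
  have hi := i.2
  rw [spinWeight, Fin.val_succ, if_neg (Nat.succ_ne_zero _), topBits]
  by_cases h0 : i.1 = 0
  · rw [if_pos (by omega), if_pos h0, if_neg (by simp; omega)]
    simp [bsgn]; ring
  · rw [if_neg (by omega), if_neg h0, zero_add]
    by_cases h1 : i.1 + 1 = n / 2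
    · rw [if_pos h1, chirSpin, lastSpin]
      change _ = bsgn (if i.1 + 1 = (n + 1) / 2 then decide (Even s) else true) / 2
      rcases Nat.mod_two_eq_zero_or_one n with h2 | h2
      · rw [if_pos (show i.1 + 1 = (n + 1) / 2 by omega), h2]
        by_cases hs : Even s <;> simp [hs, bsgn]
        norm_num
      · rw [if_neg (show ¬ i.1 + 1 = (n + 1) / 2 by omega), h2]
        by_cases hs : Even s <;> simp [hs, bsgn]
        norm_num
    · rw [if_neg h1, if_neg (by simp; omega)]
      simp [bsgn]

lemma xs_xs (F : Poly n) : xs n (xs n F) = ∑ k, mulX k (mulX k F) := by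
  have h : xs n (xs n F) = -xs n (xs n F) + (2 : ℂ) • ∑ k, mulX k (mulX k F) := by
    nth_rewrite 2 [xs_apply]
    rw [xs_apply (xs n F)]
    simp only [map_sum, gam_mulX, xs_mulX, xs_gam, map_add, map_neg, map_smul,
      Finset.sum_add_distrib, Finset.sum_neg_distrib, Finset.smul_sum]
  have h2 : (2 : ℂ) • xs n (xs n F) = (2 : ℂ) • ∑ k, mulX k (mulX k F) := by
    rw [two_smul]; nth_rewrite 1 [h]; abel
  exact smul_right_injective _ (two_ne_zero) h2

/-- The square of `x̸` is multiplication by `∑ x_k²`, a nonzero element of a domain. -/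
lemma xs_injective (hn : 3 ≤ n) : Function.Injective (xs n) := by
  rw [injective_iff_map_eq_zero]
  intro F hF
  have h := xs_xs F
  rw [hF, map_zero] at h
  ext1 b
  have h1 := (congrFun h b).symm
  simp only [Finset.sum_apply, mulX_apply, ← mul_assoc, ← Finset.sum_mul] at h1
  refine (mul_eq_zero.1 h1).resolve_left fun h2 => ?_
  have h3 := congrArg (MvPolynomial.eval (Pi.single (⟨0, by omega⟩ : Fin n) (1 : ℂ))) h2
  simp [Pi.single_apply] at h3

lemma xs_pow_injective (hn : 3 ≤ n) (j : ℕ) : Function.Injective (xs n ^ j) := by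
  rw [Module.End.coe_pow]; exact (xs_injective hn).iterate j

lemma rot_xs_pow (j : ℕ) (a b : Fin n) (F : Poly n) :
    rot a b ((xs n ^ j) F) = (xs n ^ j) (rot a b F) := by
  induction j with
  | zero => rfl
  | succ j ih => rw [pow_succ', Module.End.mul_apply, rot_xs, ih, Module.End.mul_apply]

lemma comp_rot_mem {s j l : ℕ} (a b : Fin n) {F : Poly n} (hF : F ∈ comp n s j l) :
    rot a b F ∈ comp n s j l := by
  obtain ⟨m, hm, rfl⟩ := hF
  exact ⟨rot a b m, mono_rot_mem a b hm, (rot_xs_pow j a b m).symm⟩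

lemma comp_eul_mem {s j l : ℕ} {F : Poly n} (hF : F ∈ comp n s j l) :
    eul n F ∈ comp n s j l := by
  rw [(comp_le_degSub s j l hF).1]; exact Submodule.smul_mem _ _ hF

/-- The components of the Fischer decomposition as `𝔨`-modules. -/
def compK (n : ℕ) (E : ℂ) (s j l : ℕ) : LieSubmodule ℂ (compactK n) (ConfMod n E) :=
  stableK E (comp n s j l) (fun a b _ hF => comp_rot_mem a b hF) fun _ hF => comp_eul_mem hF

lemma compK_irreducible (hn : 3 ≤ n) (E : ℂ) (s j l : ℕ) :
    LieModule.IsIrreducible ℂ (compactK n) (compK n E s j l) := by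
  have hv : (xs n ^ j) (hwv hn (s + j) l) ∈ comp n s j l := ⟨_, hwv_mem_mono hn _ _, rfl⟩
  have hnt : Nontrivial (compK n E s j l) := by
    refine ⟨⟨⟨_, hv⟩, 0, fun h => ?_⟩⟩
    have h1 : (xs n ^ j) (hwv hn (s + j) l) = 0 := congrArg Subtype.val h
    exact hwv_ne_zero hn _ _ (xs_pow_injective hn j (h1.trans (map_zero _).symm))
  refine LieModule.IsIrreducible.mk fun N hN => ?_
  let ξ : mono n (s + j) l →ₗ[ℂ] compK n E s j l :=
    { toFun := fun m => ⟨(xs n ^ j) m, ⟨m, m.2, rfl⟩⟩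
      map_add' := fun a b => Subtype.ext (map_add (xs n ^ j) _ _)
      map_smul' := fun c a => Subtype.ext (map_smul (xs n ^ j) _ _) }
  have hξ : ∀ w, ∃ m, ξ m = w := by
    rintro ⟨w, m, hm, rfl⟩
    exact ⟨⟨m, hm⟩, rfl⟩
  let W : Submodule ℂ (Poly n) := (N.toSubmodule.comap ξ).map (mono n (s + j) l).subtype
  have hW : W ≤ mono n (s + j) l := Submodule.map_subtype_le _ _
  rcases mono_eq_bot_or hn W hW (by
    rintro a b _ ⟨m, hm, rfl⟩
    refine ⟨⟨rot a b m, mono_rot_mem a b m.2⟩, ?_, rfl⟩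
    have h1 := N.lie_mem (x := wedgeSpace (Pi.single a 1) (Pi.single b 1)) hm
    have h2 : ⁅wedgeSpace (Pi.single a 1) (Pi.single b 1), ξ m⁆
        = ξ ⟨rot a b m, mono_rot_mem a b m.2⟩ := by
      refine Subtype.ext ?_
      change rhoLin n E (wedgeSpace (Pi.single a 1) (Pi.single b 1) : compactK n)
        ((xs n ^ j) (m : Poly n)) = (xs n ^ j) (rot a b m)
      rw [rhoLin_wedgeSpace, rot_xs_pow]
    rw [h2] at h1
    exact h1) with h | h
  · exfalso
    apply hN
    rw [LieSubmodule.eq_bot_iff]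
    intro w hw
    obtain ⟨m, rfl⟩ := hξ w
    have h1 : (m : Poly n) ∈ W := ⟨m, hw, rfl⟩
    rw [h, Submodule.mem_bot] at h1
    rw [show m = 0 from Subtype.ext h1, map_zero]
  · rw [eq_top_iff]
    rintro w -
    obtain ⟨m, rfl⟩ := hξ w
    have h1 : (m : Poly n) ∈ W := by rw [h]; exact m.2
    obtain ⟨m', hm', h2⟩ := h1
    rwa [show m' = m from Subtype.ext h2] at hm'

/-- The hypothesis removes the energy component: `x̸` commutes with rotations but shifts the degree.
-/
lemma rhoLin_compact_xs_pow (E : ℂ) (j : ℕ) (x : compactK n) (F : Poly n)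
    (hx : entry (Sum.inl 0) (Sum.inl 1) (x : so2 n) = 0) :
    rhoLin n E (x : so2 n) ((xs n ^ j) F) = (xs n ^ j) (rhoLin n E (x : so2 n) F) := by
  have h : (x : so2 n) = _ := congrArg (kIncl n) (compactK_decomp x)
  rw [h]
  simp only [map_sum, map_smul, LinearMap.sum_apply,
    LinearMap.smul_apply, kIncl_apply, rhoLin_wedgeSpace, hx, rot_xs_pow, mul_zero, zero_smul,
    zero_add]

lemma entry_wedgeSpace (u v : Fin n → ℂ) :
    entry (Sum.inl 0) (Sum.inl 1) (wedgeSpace u v : so2 n) = 0 := by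
  change entry _ _ (wedge _ _) = 0
  rw [entry_wedge]; simp

/-- The `𝔨`-types of the module of spinor polynomials. -/
lemma compK_equiv (hn : 3 ≤ n) (E : ℝ) (s j l : ℕ) :
    Nonempty (KMod n (spinWeight n (E + (j + l)) l (chirSpin n (s + j)))
      ≃ₗ⁅ℂ, compactK n⁆ compK n (E : ℂ) s j l) := by
  have hv : (xs n ^ j) (hwv hn (s + j) l) ∈ comp n s j l := ⟨_, hwv_mem_mono hn _ _, rfl⟩
  refine KMod_equiv (compK_irreducible hn E s j l) ⟨_, hv⟩ (fun h => ?_) (fun x hx => ?_)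
    fun i => ?_
  · have h1 : (xs n ^ j) (hwv hn (s + j) l) = 0 := congrArg Subtype.val h
    exact hwv_ne_zero hn _ _ (xs_pow_injective hn j (h1.trans (map_zero _).symm))
  · refine Subtype.ext ?_
    change rhoLin n E (x : so2 n) ((xs n ^ j) (hwv hn (s + j) l)) = 0
    rw [rhoLin_compact_xs_pow, posCompact_hwv hn _ _ _ hx, map_zero]
    rcases hx with ⟨i, k, -, rfl | rfl⟩ | ⟨i, rfl⟩ <;> exact entry_wedgeSpace _ _
  · refine Subtype.ext ?_
    change rhoLin n E (cartanH n i : so2 n) ((xs n ^ j) (hwv hn (s + j) l))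
      = spinWeight n (E + (j + l)) l (chirSpin n (s + j)) i •
        ((xs n ^ j) (hwv hn (s + j) l) : Poly n)
    induction i using Fin.cases with
    | zero =>
      rw [coe_cartanH_zero, rhoLin_hTime, hOp_apply, (comp_le_degSub s j l hv).1, spinWeight]
      simp only [Fin.val_zero, if_true]
      push_cast; module
    | succ i =>
      have h1 : (cartanH n i.succ : so2 n) = Complex.I • rotM (evenIdx i) (oddIdx i) := by
        rw [cartanH_succ, ← wedgeSpace_single]; rfl
      rw [h1, map_smul, rhoLin_rotM, LinearMap.smul_apply, rot_xs_pow, ← map_smul, rot_plane_hwv,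
        spinWeight_succ hn, map_smul]
end KTypes

/-! ### Identification of the induced module with spinor polynomials -/

section Model
variable {n : ℕ}

/-- The functional calculus of a commuting family of endomorphisms. -/
lemma exists_polyAction {M : Type} [AddCommGroup M] [Module ℂ M] (T : Fin n → Module.End ℂ M)
    (hT : ∀ j k, T j * T k = T k * T j) :
    ∃ P : MvPolynomial (Fin n) ℂ →ₗ[ℂ] Module.End ℂ M,
      (∀ a, P (MvPolynomial.C a) = algebraMap ℂ _ a) ∧
      ∀ k f, P (MvPolynomial.X k * f) = T k * P f := by
  have hcomm : ∀ a ∈ Set.range T, ∀ b ∈ Set.range T, a * b = b * a := by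
    rintro _ ⟨j, rfl⟩ _ ⟨k, rfl⟩; exact hT j k
  have := Algebra.isMulCommutative_adjoin ℂ hcomm
  let _ : CommRing (Algebra.adjoin ℂ (Set.range T)) :=
    { (inferInstance : Ring (Algebra.adjoin ℂ (Set.range T))) with
      mul_comm := fun a b => this.is_comm.comm a b }
  let a : MvPolynomial (Fin n) ℂ →ₐ[ℂ] Algebra.adjoin ℂ (Set.range T) :=
    MvPolynomial.aeval fun k => ⟨T k, Algebra.subset_adjoin ⟨k, rfl⟩⟩
  refine ⟨(Algebra.adjoin ℂ (Set.range T)).val.toLinearMap ∘ₗ a.toLinearMap, fun c => ?_,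
    fun k f => ?_⟩
  · change ((a (MvPolynomial.C c) : Algebra.adjoin ℂ (Set.range T)) : Module.End ℂ M) = _
    rw [← MvPolynomial.algebraMap_eq, AlgHom.commutes]
    rfl
  · change ((a (MvPolynomial.X k * f) : Algebra.adjoin ℂ (Set.range T)) : Module.End ℂ M) = _
    rw [map_mul, MvPolynomial.aeval_X]
    rfl

/-- The spinor polynomial underlying a vector of the conformal module. -/
def toPoly {E : ℂ} (F : ConfMod n E) : Poly n := F

/-- The module of spinor polynomials of chirality `(-1) ^ s`. -/
def confChir (n : ℕ) (E : ℂ) (s : ℕ) : LieSubmodule ℂ (so2 n) (ConfMod n E) where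
  __ := (chirSub n s : Submodule ℂ (ConfMod n E))
  lie_mem {x F} hF := by
    have hF' : toPoly F ∈ chirSub n s := hF
    change rhoLin n E x (toPoly F) ∈ chirSub n s
    rw [mem_chirSub] at hF' ⊢
    rw [← rhoLin_chi, hF', map_smul]

lemma mem_confChir {E : ℂ} {s : ℕ} {F : ConfMod n E} :
    F ∈ confChir n E s ↔ chi n (toPoly F) = (-1 : ℂ) ^ s • toPoly F := mem_chirSub

lemma comp_le_chirSub (s j l : ℕ) : comp n s j l ≤ chirSub n s := fun _ hF =>
  mem_chirSub.2 (comp_le_degSub s j l hF).2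

lemma single_mem_mono {s : ℕ} {b : Bits n} (hb : par b = (-1 : ℂ) ^ s) :
    (Pi.single b 1 : Poly n) ∈ mono n s 0 := by
  have h : (Pi.single b 1 : Poly n) = fun c => MvPolynomial.C (if c = b then 1 else 0) := by
    ext1 c
    by_cases hc : c = b
    · subst hc; simp
    · simp [hc]
  refine ⟨?_, ?_, ?_⟩
  · rw [h, dirac_apply]
    exact Finset.sum_eq_zero fun k _ => by rw [der_const, map_zero]
  · rw [h, eul_const]; simp
  · ext1 c
    rw [chi_apply, Pi.smul_apply]
    by_cases hc : c = b
    · subst hc; rw [hb]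
    · rw [Pi.single_eq_of_ne hc, smul_zero, smul_zero]

lemma mem_comp_zero {s l : ℕ} {F : Poly n} : F ∈ comp n s 0 l ↔ F ∈ mono n s l := by
  rw [comp, pow_zero, Module.End.one_eq_id, Submodule.map_id]; rfl

lemma kOp_comp_zero {E : ℂ} {s : ℕ} {F : Poly n} (hF : F ∈ comp n s 0 0) (k : Fin n) :
    kOp E k F = 0 := by
  obtain ⟨h1, h2, -⟩ := mem_comp_zero.1 hF
  have h3 : der k F = 0 := der_eq_zero_of_eul_zero (by rw [h2, Nat.cast_zero]) k
  rw [kOp_apply, h1, h3]; simp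

lemma so2_lie_inclK_mem {μ : Fin (n / 2 + 1) → ℂ} (x : so2 n) (v : KMod n μ) :
    ⁅x, inclK n μ v⁆ ∈ wordSpan (Set.range (pMinus (n := n))) (Set.range (inclK n μ)) := by
  induction x using so2_induction with
  | hz => rw [zero_lie]; exact zero_mem _
  | ha x y hx hy => rw [add_lie]; exact add_mem hx hy
  | hs c x hx => rw [smul_lie]; exact Submodule.smul_mem _ _ hx
  | h0 =>
    rw [← coe_cartanH_zero, compact_lie_inclK]
    exact subset_wordSpan _ _ (Set.mem_range_self _)
  | hm k => exact lie_mem_wordSpan_of_mem (Set.mem_range_self k) (subset_wordSpan _ _ (Set.mem_range_self v))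
  | hp k => rw [pPlus_lie_inclK]; exact zero_mem _
  | hr j k =>
    rw [← wedgeSpace_single, compact_lie_inclK]
    exact subset_wordSpan _ _ (Set.mem_range_self _)

lemma NMod_wordSpan (μ : Fin (n / 2 + 1) → ℂ) :
    wordSpan (Set.range (pMinus (n := n))) (Set.range (inclK n μ)) = ⊤ := by
  refine NMod_generated _ (fun x w hw => lie_mem_wordSpan ?_ x hw) fun v =>
    subset_wordSpan _ _ (Set.mem_range_self v)
  rintro x _ ⟨v, rfl⟩
  exact so2_lie_inclK_mem x v

/-- The induced module is the module of spinor polynomials. -/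
theorem exists_NMod_equiv {E : ℂ} {s : ℕ} {μ : Fin (n / 2 + 1) → ℂ}
    (κ : KMod n μ ≃ₗ⁅ℂ, compactK n⁆ compK n E s 0 0) :
    ∃ e : NMod n μ ≃ₗ⁅ℂ, so2 n⁆ confChir n E s,
      ∀ v, (e (inclK n μ v) : ConfMod n E) = (κ v : ConfMod n E) := by
  obtain ⟨ψ, hψ⟩ := exists_NMod_hom (Y := confChir n E s)
    ({ toFun := fun v => ⟨κ v, comp_le_chirSub s 0 0 (κ v).2⟩
       map_add' := fun v w => Subtype.ext (congrArg (fun y : compK n E s 0 0 => (y : ConfMod n E)) (map_add κ v w))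
       map_smul' := fun c v => Subtype.ext (congrArg (fun y : compK n E s 0 0 => (y : ConfMod n E)) (map_smul κ c v)) } :
       KMod n μ →ₗ[ℂ] confChir n E s)
    (fun x v => Subtype.ext (congrArg (fun y : compK n E s 0 0 => (y : ConfMod n E)) (κ.toLieModuleHom.map_lie x v)))
    (fun k v => Subtype.ext ((conf_lie_pPlus k _).trans (kOp_comp_zero (κ v).2 k)))
  -- Since `𝔭⁻` is abelian, polynomials act on the induced module by substituting `pMinus k` for
  -- `x_k`.
  obtain ⟨P, hPC, hPX⟩ := exists_polyAction (fun k => LieModule.toEnd ℂ (so2 n) (NMod n μ) (pMinus k))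
    (fun j k => by
      have := LieHom.map_lie (LieModule.toEnd ℂ (so2 n) (NMod n μ)) (pMinus j) (pMinus k)
      rw [lie_pMinus_pMinus, map_zero, LieRing.of_associative_ring_bracket] at this
      exact (sub_eq_zero.1 this.symm))
  have hψP : ∀ f w b, toPoly (ψ (P f w) : ConfMod n E) b = f * toPoly (ψ w : ConfMod n E) b := by
    intro f w b
    induction f using MvPolynomial.induction_on with
    | C a =>
      rw [hPC, Module.algebraMap_end_apply, map_smul, ← MvPolynomial.smul_eq_C_mul]; rfl
    | add f g hf hg =>
      rw [map_add, LinearMap.add_apply, map_add, add_mul, ← hf, ← hg]; rfl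
    | mul_X f k hf =>
      rw [mul_comm f, hPX, mul_assoc, ← hf, Module.End.mul_apply, LieModule.toEnd_apply_apply,
        LieModuleHom.map_lie]
      exact congrFun (conf_lie_pMinus k _) b
  let w : Bits n → NMod n μ := fun b =>
    if h : par b = (-1 : ℂ) ^ s then
      inclK n μ (κ.symm ⟨Pi.single b 1, mem_comp_zero.2 (single_mem_mono h)⟩) else 0
  -- The candidate inverse of `ψ` applies the component polynomials to the basis spinors inside
  -- `N(μ)`; those of wrong chirality are sent to zero. It is onto, since its range contains `K(μ)`
  -- and is stable under `𝔭⁻`, and `ψ ∘ Θ` fixes the components of the right chirality. Hence `ψ` is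
  -- bijective.
  let Θ : Poly n →ₗ[ℂ] NMod n μ := ∑ b, LinearMap.applyₗ (w b) ∘ₗ P ∘ₗ LinearMap.proj b
  have hΘ : ∀ F, Θ F = ∑ b, P (F b) (w b) := fun F => by
    simp only [Θ, LinearMap.sum_apply]; rfl
  have hΘX : ∀ k F, Θ (mulX k F) = ⁅(pMinus k : so2 n), Θ F⁆ := by
    intro k F
    simp only [hΘ, lie_sum, mulX_apply, hPX]; rfl
  have hψw : ∀ b, toPoly (ψ (w b) : ConfMod n E) = if par b = (-1 : ℂ) ^ s then Pi.single b 1 else 0 := by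
    intro b
    by_cases h : par b = (-1 : ℂ) ^ s
    · simp only [w]
      rw [dif_pos h, if_pos h, hψ]
      change toPoly (κ (κ.symm _) : ConfMod n E) = _
      rw [LieModuleEquiv.apply_symm_apply]
      rfl
    · simp only [w]
      rw [dif_neg h, if_neg h, map_zero]; rfl
  have hψΘ : ∀ F b, par b = (-1 : ℂ) ^ s → toPoly (ψ (Θ F) : ConfMod n E) b = F b := by
    intro F b hb
    have h1 : toPoly (ψ (Θ F) : ConfMod n E) = ∑ c, toPoly (ψ (P (F c) (w c)) : ConfMod n E) := by
      rw [hΘ, map_sum]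
      exact map_sum (confChir n E s).toSubmodule.subtype _ _
    rw [h1, Finset.sum_apply, Finset.sum_eq_single b]
    · rw [hψP, hψw, if_pos hb, Pi.single_eq_same, mul_one]
    · intro c _ hc
      rw [hψP, hψw]
      split_ifs
      · rw [Pi.single_eq_of_ne hc.symm, mul_zero]
      · exact mul_zero _
    · simp
  have hΘC : ∀ v, inclK n μ v ∈ LinearMap.range Θ := by
    intro v
    have hv : toPoly (κ v : ConfMod n E) ∈ mono n s 0 := mem_comp_zero.1 (κ v).2
    refine ⟨toPoly (κ v : ConfMod n E), ?_⟩
    have h1 : ∀ b, toPoly (κ v : ConfMod n E) b = MvPolynomial.C ((toPoly (κ v : ConfMod n E) b).coeff 0) :=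
      eq_C_of_eul_zero (by rw [hv.2.1, Nat.cast_zero])
    have h0 : ∀ b, par b ≠ (-1 : ℂ) ^ s → toPoly (κ v : ConfMod n E) b = 0 := by
      intro b hb
      have h2 := congrFun hv.2.2 b
      rw [chi_apply, Pi.smul_apply, ← sub_eq_zero, ← sub_smul] at h2
      exact (smul_eq_zero.1 h2).resolve_left (sub_ne_zero.2 hb)
    have h2 : v = ∑ b, (if h : par b = (-1 : ℂ) ^ s then (toPoly (κ v : ConfMod n E) b).coeff 0 •
        κ.symm ⟨Pi.single b 1, mem_comp_zero.2 (single_mem_mono h)⟩ else 0) := by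
      let kl : KMod n μ →ₗ[ℂ] Poly n := (compK n E s 0 0).toSubmodule.subtype ∘ₗ
        (κ : KMod n μ →ₗ[ℂ] compK n E s 0 0)
      have hkl : ∀ v, kl v = toPoly (κ v : ConfMod n E) := fun v => rfl
      have hinj : Function.Injective kl := fun v w h => κ.injective (Subtype.ext h)
      apply hinj
      rw [map_sum, hkl]
      refine (Finset.univ_sum_single (toPoly (κ v : ConfMod n E))).symm.trans
        (Finset.sum_congr rfl fun b _ => ?_)
      split_ifs with h
      · rw [map_smul, hkl, LieModuleEquiv.apply_symm_apply]
        change _ = (((toPoly (κ v : ConfMod n E) b).coeff 0) • Pi.single b 1 : Poly n)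
        rw [← Pi.single_smul, MvPolynomial.smul_eq_C_mul, mul_one, ← h1]
      · rw [map_zero, h0 b h, Pi.single_zero]
    rw [hΘ]
    nth_rewrite 2 [h2]
    rw [map_sum]
    refine Finset.sum_congr rfl fun b _ => ?_
    rw [h1 b, hPC, Module.algebraMap_end_apply]
    simp only [w]
    split_ifs with h
    · rw [MvPolynomial.coeff_C, if_pos rfl, map_smul]
    · rw [smul_zero, map_zero]
  have hsurj : LinearMap.range Θ = ⊤ := by
    rw [eq_top_iff, ← NMod_wordSpan]
    refine wordSpan_le ?_ ?_
    · rintro _ ⟨v, rfl⟩; exact hΘC v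
    · rintro _ ⟨k, rfl⟩ _ ⟨F, rfl⟩
      exact ⟨mulX k F, hΘX k F⟩
  have hbij : Function.Bijective ψ := by
    constructor
    · rw [← LieModuleHom.coe_toLinearMap, injective_iff_map_eq_zero]
      intro m hm
      obtain ⟨F, rfl⟩ := LinearMap.range_eq_top.1 hsurj m
      rw [hΘ]
      refine Finset.sum_eq_zero fun b _ => ?_
      by_cases h : par b = (-1 : ℂ) ^ s
      · rw [← hψΘ F b h]
        rw [LieModuleHom.coe_toLinearMap] at hm
        rw [hm]
        exact (congrArg (fun T => T (w b)) (map_zero P)).trans rfl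
      · simp only [w]; rw [dif_neg h, map_zero]
    · intro F
      refine ⟨Θ (toPoly (F : ConfMod n E)), Subtype.ext ?_⟩
      have hF := mem_confChir.1 F.2
      have hF' := mem_confChir.1 (ψ (Θ (toPoly (F : ConfMod n E)))).2
      have h0 : ∀ {G : Poly n}, chi n G = (-1 : ℂ) ^ s • G → ∀ b, par b ≠ (-1 : ℂ) ^ s →
          G b = 0 := by
        intro G hG b hb
        have h2 := congrFun hG b
        rw [chi_apply, Pi.smul_apply, ← sub_eq_zero, ← sub_smul] at h2
        exact (smul_eq_zero.1 h2).resolve_left (sub_ne_zero.2 hb)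
      refine funext fun b => ?_
      by_cases h : par b = (-1 : ℂ) ^ s
      · exact hψΘ (toPoly (F : ConfMod n E)) b h
      · exact (h0 hF' b h).trans (h0 hF b h).symm
  refine ⟨{ ψ, LinearEquiv.ofBijective (ψ : NMod n μ →ₗ[ℂ] confChir n E s) hbij with }, fun v => ?_⟩
  exact congrArg Subtype.val (hψ v)

lemma exists_kappa (hn : 3 ≤ n) (E : ℝ) (s : ℕ) :
    Nonempty (KMod n (spinWeight n E 0 (chirSpin n s)) ≃ₗ⁅ℂ, compactK n⁆ compK n (E : ℂ) s 0 0) := by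
  have := compK_equiv hn E s 0 0
  rwa [Nat.cast_zero, add_zero, add_zero, add_zero] at this

/-- The universal property of the module of spinor polynomials. -/
theorem exists_confChir_hom (hn : 3 ≤ n) (E : ℝ) (s : ℕ) {Y : Type} [AddCommGroup Y] [Module ℂ Y]
    [LieRingModule (so2 n) Y] [LieModule ℂ (so2 n) Y] (φ : compK n (E : ℂ) s 0 0 →ₗ[ℂ] Y)
    (hk : ∀ (x : compactK n) v, φ ⁅x, v⁆ = ⁅(x : so2 n), φ v⁆)
    (hp : ∀ (k : Fin n) v, ⁅(pPlus k : so2 n), φ v⁆ = 0) :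
    ∃ f : confChir n (E : ℂ) s →ₗ⁅ℂ, so2 n⁆ Y,
      ∀ v : compK n (E : ℂ) s 0 0, f ⟨v, comp_le_chirSub s 0 0 v.2⟩ = φ v := by
  obtain ⟨κ⟩ := exists_kappa hn E s
  obtain ⟨e, he⟩ := exists_NMod_equiv κ
  obtain ⟨f, hf⟩ := exists_NMod_hom (φ ∘ₗ (κ : KMod n _ →ₗ[ℂ] compK n (E : ℂ) s 0 0))
    (fun x v => by
      change φ (κ ⁅x, v⁆) = ⁅(x : so2 n), φ (κ v)⁆
      rw [← hk]; congr 1; exact κ.toLieModuleHom.map_lie x v)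
    (fun k v => hp k (κ v))
  refine ⟨f.comp (e.symm : confChir n (E : ℂ) s →ₗ⁅ℂ, so2 n⁆ _), fun v => ?_⟩
  have h1 : (⟨v, comp_le_chirSub s 0 0 v.2⟩ : confChir n (E : ℂ) s) = e (inclK n _ (κ.symm v)) := by
    apply Subtype.ext
    rw [he, LieModuleEquiv.apply_symm_apply]
  change f (e.symm _) = φ v
  rw [h1, LieModuleEquiv.symm_apply_apply, hf]
  change φ (κ (κ.symm v)) = _
  rw [LieModuleEquiv.apply_symm_apply]
end Model

/-! ### The Casimir eigenvalues and the submodules of the conformal module -/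

section Casimir
variable {n : ℕ}

/-- The compact part of the Casimir operator. -/
def casimir (n : ℕ) (E : ℂ) : Module.End ℂ (Poly n) := ∑ k, mulX k ∘ₗ kOp E k

lemma casimir_apply (E : ℂ) (F : Poly n) : casimir n E F = ∑ k, mulX k (kOp E k F) := by
  simp [casimir, LinearMap.sum_apply]

/-- Collecting the Clifford sums with `x̸² = ∑ x_k²` leaves only `x̸²∂̸²`, `x̸∂̸` and a polynomial
in the Euler operator, all of them scalar on each Fischer component. -/
lemma casimir_eq (E : ℂ) (F : Poly n) : casimir n E F =
    xs n (xs n (dirac n (dirac n F))) + xs n (dirac n F) - (2 : ℂ) • eul n (eul n F)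
      - (2 * E - 1) • eul n F := by
  have h : ∀ k, mulX k (kOp E k F) = mulX k (mulX k (dirac n (dirac n F)))
      + gam k (mulX k (dirac n F)) - (2 : ℂ) • mulX k (der k (eul n F))
        - (2 * E - 1) • mulX k (der k F) := by
    intro k
    rw [kOp_apply, der_eul, gam_mulX, map_sub, map_sub, map_add, map_smul, map_smul, map_add]
    module
  rw [casimir_apply]
  simp only [h, Finset.sum_add_distrib, Finset.sum_sub_distrib, ← Finset.smul_sum, ← xs_xs,
    ← xs_apply, ← eul_apply]

/-- The eigenvalues of the compact part of the Casimir operator. -/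
def casVal (n : ℕ) (E : ℝ) (j l : ℕ) : ℝ :=
  j * (2 * l + n + j - 1) - (j + l) * (2 * (j + l) + 2 * E - 1)

/-- This is the eigenvalue of `x̸²∂̸² + x̸∂̸` on `x̸^(j+1) M_l`. The dependence on the parity of `j`
disappears in the product. -/
lemma aVal_mul (hn : 3 ≤ n) (j l : ℕ) :
    (aVal n l (j + 1) : ℂ) * (aVal n l j + 1) = (j + 1) * (2 * l + n + j) := by
  by_cases h : Even j
  · have h' : ¬ Even (j + 1) := by rwa [Nat.even_add_one, not_not]
    simp only [aVal, h, h', if_true, if_false]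
    push_cast [show 2 * l + n + (j + 1) - 1 = 2 * l + n + j by omega]
    ring
  · have h' : Even (j + 1) := by rwa [Nat.even_add_one]
    simp only [aVal, h, h', if_true, if_false]
    rw [Nat.cast_sub (by omega)]
    push_cast; ring

lemma casimir_comp (hn : 3 ≤ n) (E : ℝ) {s j l : ℕ} {F : Poly n} (hF : F ∈ comp n s j l) :
    casimir n E F = (casVal n E j l : ℂ) • F := by
  have he : eul n F = ((j + l : ℕ) : ℂ) • F := (comp_le_degSub s j l hF).1
  obtain ⟨m, hm, rfl⟩ := hF
  rw [casimir_eq, he, map_smul, he, xs_dirac_xs_pow hm, casVal]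
  rcases j with _ | j
  · rw [pow_zero, Module.End.one_apply, hm.1]
    simp only [map_zero, aVal, Even.zero, if_true, CharP.cast_eq_zero, zero_smul, smul_smul]
    push_cast
    module
  · have h1 : xs n (xs n (dirac n (dirac n ((xs n ^ (j + 1)) m)))) =
        ((aVal n l (j + 1) : ℂ) * aVal n l j) • (xs n ^ (j + 1)) m := by
      rw [dirac_xs_pow hm, map_smul, map_smul, map_smul, xs_dirac_xs_pow hm, map_smul, smul_smul,
        ← Module.End.mul_apply, ← pow_succ']
    rw [h1]
    simp only [smul_smul, ← add_smul, ← sub_smul]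
    congr 1
    have h2 := aVal_mul hn j l
    push_cast
    linear_combination h2

/-- With `N = j + l`, the value at `E = (n-1)/2` is `-N(N-1) - l(l+n-1) ≤ 0`, and it strictly
decreases in `E` when `N ≥ 1`. Off the constants, equality at the bound occurs only for `(j, l) =
(1, 0)`, which is where the singular vectors appear. -/
lemma casVal_neg {E : ℝ} (hE : ((n : ℝ) - 1) / 2 < E) {j l : ℕ} (h : 1 ≤ j + l) (hn : 3 ≤ n) :
    casVal n E j l < 0 := by
  have h1 : (1 : ℝ) ≤ j + l := by exact_mod_cast h
  have h2 : (3 : ℝ) ≤ n := by exact_mod_cast hn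
  have hj : (0 : ℝ) ≤ j := Nat.cast_nonneg j
  have hl : (0 : ℝ) ≤ l := Nat.cast_nonneg l
  rw [casVal]
  have h3 : ((j : ℝ) + l) * (2 * (j + l) + (n - 1) - 1) < (j + l) * (2 * (j + l) + 2 * E - 1) := by
    apply mul_lt_mul_of_pos_left <;> linarith
  nlinarith [mul_nonneg hj hl, mul_nonneg hl (sub_nonneg.2 h1), mul_nonneg hj (sub_nonneg.2 h1),
    mul_nonneg hl (sub_nonneg.2 h2)]

lemma rhoLin_mem_eul {E : ℂ} {W : Submodule ℂ (Poly n)}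
    (hW : ∀ x : so2 n, ∀ F ∈ W, rhoLin n E x F ∈ W) {F : Poly n} (hF : F ∈ W) : eul n F ∈ W := by
  have h := hW (hTime n) F hF
  rw [rhoLin_hTime, hOp_apply] at h
  have : eul n F = -(-(eul n F + E • F)) - E • F := by module
  rw [this]
  exact sub_mem (neg_mem h) (W.smul_mem _ hF)

lemma component_mem {V ι : Type} [AddCommGroup V] [Module ℂ V] (W : Submodule ℂ V)
    (g : Module.End ℂ V) (hg : ∀ w ∈ W, g w ∈ W) (t : Finset ι) {c : ι → ℂ}
    (hc : Function.Injective c) (f : ι → V) (hf : ∀ i ∈ t, g (f i) = c i • f i)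
    (h : ∑ i ∈ t, f i ∈ W) (i : ι) (hi : i ∈ t) : f i ∈ W := by
  classical
  rw [← Finset.add_sum_erase _ _ hi] at h
  refine mem_of_add_mem_of_eigen W g hg (c i) (hf i hi) (sum_mem fun k hk => ?_) h
  exact Submodule.mem_iSup_of_mem ⟨c k, fun h => Finset.ne_of_mem_erase hk (hc h)⟩
    (Module.End.mem_eigenspace_iff.2 (hf k (Finset.mem_of_mem_erase hk)))

lemma mem_iSup_inf_degSub {W : Submodule ℂ (Poly n)} (hg : ∀ F ∈ W, eul n F ∈ W) {s : ℕ}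
    {F : Poly n} (hF : F ∈ W) (hs : F ∈ chirSub n s) : F ∈ ⨆ N, W ⊓ degSub n s N := by
  obtain ⟨f, hf, rfl⟩ := (Submodule.mem_iSup_iff_exists_finsupp _ _).1 (mem_iSup_degSub hs)
  refine sum_mem fun N hN => Submodule.mem_iSup_of_mem N ⟨?_, hf N⟩
  exact component_mem W (eul n) hg f.support (c := fun N : ℕ => (N : ℂ)) Nat.cast_injective f
    (fun N _ => (hf N).1) hF N hN

/-- The chirality projector commutes with multiplication by coordinates, so induction over all
spinor polynomials shows that the projection of each of them lies in `W`. -/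
lemma chirSub_le {s : ℕ} {W : Submodule ℂ (Poly n)} (h1 : mono n s 0 ≤ W)
    (hX : ∀ k, ∀ F ∈ W, mulX k F ∈ W) : chirSub n s ≤ W := by
  let P : Module.End ℂ (Poly n) := (1 / 2 : ℂ) • (LinearMap.id + (-1 : ℂ) ^ s • chi n)
  have hP : ∀ G, P G = (1 / 2 : ℂ) • (G + (-1 : ℂ) ^ s • chi n G) := fun G => rfl
  have h2 : ∀ G, P G ∈ W := by
    intro G
    induction G using poly_induction with
    | hc t =>
      refine h1 ⟨?_, ?_, ?_⟩
      · rw [hP, map_smul, map_add, map_smul, ← neg_neg (dirac n (chi n _)), ← chi_dirac,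
          dirac_apply, Finset.sum_eq_zero fun k _ => by rw [der_const, map_zero]]
        simp
      · rw [hP, map_smul, map_add, map_smul, ← chi_eul, eul_const]
        simp
      · rw [hP, map_smul, map_add, map_smul, chi_chi, smul_comm ((-1 : ℂ) ^ s) (1 / 2 : ℂ),
          smul_add ((-1 : ℂ) ^ s), smul_smul, neg_one_pow_sq, one_smul, add_comm]
    | hx k G hG =>
      have : P (mulX k G) = mulX k (P G) := by
        rw [hP, hP, chi_mulX, map_smul, map_add, map_smul]
      rw [this]; exact hX _ _ hG
    | ha G G' hG hG' => rw [map_add]; exact add_mem hG hG'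
  intro G hG
  have h3 : P G = G := by
    rw [hP, mem_chirSub.1 hG, smul_smul, neg_one_pow_sq]; module
  rw [← h3]; exact h2 G

/-- One nonzero constant generates all constants of its chirality by irreducibility under rotations,
and these generate everything under `𝔭⁻`. -/
lemma le_of_mono_mem (hn : 3 ≤ n) {E : ℂ} {s : ℕ} {W : Submodule ℂ (Poly n)}
    (hW : ∀ x : so2 n, ∀ F ∈ W, rhoLin n E x F ∈ W) {F : Poly n} (hF : F ∈ W)
    (hm : F ∈ mono n s 0) (h0 : F ≠ 0) : chirSub n s ≤ W := by
  refine chirSub_le ?_ fun k G hG => by rw [← rhoLin_pMinus E]; exact hW _ _ hG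
  have := mono_eq_bot_or hn (s := s) (l := 0) (W ⊓ mono n s 0) inf_le_right
    (fun j k G hG => ⟨by rw [← rhoLin_rotM E]; exact hW _ _ hG.1, mono_rot_mem j k hG.2⟩)
  refine inf_eq_right.1 (this.resolve_left fun h => h0 ?_)
  rw [← Submodule.mem_bot ℂ, ← h]
  exact ⟨hF, hm⟩

lemma kOp_mem_degSub {E : ℂ} {s N : ℕ} {F : Poly n} (hF : F ∈ degSub n s (N + 1)) (k : Fin n) :
    kOp E k F ∈ degSub n s N := by
  refine ⟨?_, ?_⟩
  · have h := hOp_kOp E k F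
    rw [hOp_apply, hOp_apply, hF.1, map_neg, map_add, map_smul, map_smul] at h
    have h1 : eul n (kOp E k F) = -(-(eul n (kOp E k F) + E • kOp E k F)) - E • kOp E k F := by
      module
    rw [h1, h]; push_cast; module
  · rw [← kOp_chi, hF.2, map_smul]

lemma casimir_injOn (hn : 3 ≤ n) {E : ℝ} (hE : ((n : ℝ) - 1) / 2 < E) {s N : ℕ} {F : Poly n}
    (hF : F ∈ degSub n s (N + 1)) (h : casimir n E F = 0) : F = 0 := by
  have h1 := Module.End.eigenspaces_iSupIndep (casimir n E) 0
  refine Submodule.disjoint_def.1 h1 F (Module.End.mem_eigenspace_iff.2 (by rw [h, zero_smul])) ?_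
  have h2 : (⨆ p : {p : ℕ × ℕ // p.1 + p.2 = N + 1}, comp n s p.1.1 p.1.2) ≤
      ⨆ c, ⨆ (_ : c ≠ 0), Module.End.eigenspace (casimir n E) c := by
    refine iSup_le ?_
    rintro ⟨⟨j, l⟩, hp⟩ G hG
    simp only at hp hG
    refine Submodule.mem_iSup_of_mem (casVal n E j l : ℂ) (Submodule.mem_iSup_of_mem ?_
      (Module.End.mem_eigenspace_iff.2 (casimir_comp hn E hG)))
    exact_mod_cast (casVal_neg hE (by omega) hn).ne
  exact h2 (degSub_le_iSup_comp hn _ _ hF)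

/-- Above the unitarity bound there are no proper submodules. -/
lemma stable_eq_bot_or (hn : 3 ≤ n) {E : ℝ} (hE : ((n : ℝ) - 1) / 2 < E) {s : ℕ}
    {W : Submodule ℂ (Poly n)} (hWs : W ≤ chirSub n s)
    (hW : ∀ x : so2 n, ∀ F ∈ W, rhoLin n E x F ∈ W) : W = ⊥ ∨ chirSub n s ≤ W := by
  by_contra! hcon
  obtain ⟨h1, h2⟩ := hcon
  apply h1
  -- A nonzero constant in `W` would generate the whole sector. In degree `N + 1` all `K_k F` lie in
  -- `W` one degree lower and so vanish; then `∑ x_k K_k F = 0`, which forces `F = 0`.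
  have key : ∀ N, W ⊓ degSub n s N = ⊥ := by
    intro N
    induction N with
    | zero =>
      rw [eq_bot_iff]
      rintro F ⟨hF, hF'⟩
      by_contra h0
      refine h2 (le_of_mono_mem hn hW hF ⟨?_, hF'⟩ h0)
      rw [dirac_apply]
      refine Finset.sum_eq_zero fun k _ => ?_
      rw [der_eq_zero_of_eul_zero (by rw [hF'.1, Nat.cast_zero]), map_zero]
    | succ N ih =>
      rw [eq_bot_iff]
      rintro F ⟨hF, hF'⟩
      refine casimir_injOn hn hE hF' ?_
      rw [casimir_apply]
      refine Finset.sum_eq_zero fun k _ => ?_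
      have : kOp (E : ℂ) k F ∈ W ⊓ degSub n s N :=
        ⟨by rw [← rhoLin_pPlus]; exact hW _ _ hF, kOp_mem_degSub hF' k⟩
      rw [ih, Submodule.mem_bot] at this
      rw [this, map_zero]
  rw [eq_bot_iff]
  intro F hF
  have := mem_iSup_inf_degSub (fun G hG => rhoLin_mem_eul hW hG) hF (hWs hF)
  simpa [key] using this

/-- For general `E` the two sides differ by `(n - 2E - 1) γ_k G`. This is what singles out the
unitarity bound. -/
lemma kOp_xs {E : ℂ} (hE : 2 * E + 1 = n) (k : Fin n) (G : Poly n) :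
    kOp E k (xs n G) = xs n (kOp (E + 1) k G) := by
  simp only [kOp_apply, dirac_xs, map_add, map_neg, map_sub, map_smul, der_xs, eul_xs, xs_mulX,
    xs_gam, dirac_eul, eul_gam]
  rw [← hE]
  module

lemma rhoLin_xs {E : ℂ} (hE : 2 * E + 1 = n) (x : so2 n) (G : Poly n) :
    rhoLin n E x (xs n G) = xs n (rhoLin n (E + 1) x G) := by
  induction x using so2_induction with
  | hz => simp
  | ha x y hx hy => simp only [map_add, LinearMap.add_apply, hx, hy]
  | hs c x hx => simp only [map_smul, LinearMap.smul_apply, hx]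
  | h0 =>
    simp only [rhoLin_hTime, hOp_apply, map_neg, map_add, map_smul, eul_xs]; module
  | hm k => simp only [rhoLin_pMinus, xs_mulX]
  | hp k => simp only [rhoLin_pPlus, kOp_xs hE]
  | hr j k => simp only [rhoLin_rotM, rot_xs]

/-- The spinor polynomials divisible by the position vector. -/
def xsSub (n s : ℕ) : Submodule ℂ (Poly n) := (chirSub n (s + 1)).map (xs n)

lemma rhoLin_mem_chirSub (E : ℂ) {s : ℕ} (x : so2 n) {F : Poly n} (hF : F ∈ chirSub n s) :
    rhoLin n E x F ∈ chirSub n s := by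
  rw [mem_chirSub] at hF ⊢
  rw [← rhoLin_chi, hF, map_smul]

lemma rhoLin_mem_xsSub {E : ℂ} (hE : 2 * E + 1 = n) {s : ℕ} (x : so2 n) {F : Poly n}
    (hF : F ∈ xsSub n s) : rhoLin n E x F ∈ xsSub n s := by
  obtain ⟨G, hG, rfl⟩ := hF
  rw [rhoLin_xs hE]
  exact ⟨_, rhoLin_mem_chirSub _ x hG, rfl⟩

lemma xsSub_le (s : ℕ) : xsSub n s ≤ chirSub n s := by
  rintro _ ⟨G, hG, rfl⟩
  rw [SetLike.mem_coe, mem_chirSub] at hG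
  rw [mem_chirSub, chi_xs, hG, map_smul, pow_succ]; module

lemma comp_succ_le_xsSub (s j l : ℕ) : comp n s (j + 1) l ≤ xsSub n s := by
  rintro _ ⟨m, hm, rfl⟩
  refine ⟨(xs n ^ j) m, mem_chirSub.2 (chi_xs_pow j (s + 1) ?_), by
    rw [pow_succ', Module.End.mul_apply]⟩
  rw [hm.2.2]; ring_nf

lemma coeff_xs (F : Poly n) (b : Bits n) : (xs n F b).coeff 0 = 0 := by
  rw [xs_apply, Finset.sum_apply, MvPolynomial.coeff_sum]
  refine Finset.sum_eq_zero fun k _ => ?_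
  rw [gam_mulX, mulX_apply, MvPolynomial.coeff_X_mul']
  simp

lemma xsSub_ne (hn : 3 ≤ n) (s : ℕ) : ¬ chirSub n s ≤ xsSub n s := by
  intro h
  obtain ⟨G, -, hG⟩ := h (mem_chirSub.2 (hwv_mem_mono hn s 0).2.2)
  have := coeff_xs G (topBits n s)
  rw [hG, hwv, Pi.single_eq_same, pow_zero] at this
  simp at this

/-- Modulo multiples of `x̸` only the component `j = 0` of the Fischer decomposition survives, so
the Casimir operator acts on each degree of the quotient by one scalar. -/
lemma casimir_sub_mem_xsSub (hn : 3 ≤ n) (E : ℝ) {s N : ℕ} {F : Poly n}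
    (hF : F ∈ degSub n s N) : casimir n E F - (casVal n E 0 N : ℂ) • F ∈ xsSub n s := by
  have h : (⨆ p : {p : ℕ × ℕ // p.1 + p.2 = N}, comp n s p.1.1 p.1.2) ≤
      (xsSub n s).comap (casimir n E - (casVal n E 0 N : ℂ) • LinearMap.id) := by
    refine iSup_le ?_
    rintro ⟨⟨j, l⟩, hp⟩ G hG
    change casimir n E G - (casVal n E 0 N : ℂ) • G ∈ xsSub n s
    simp only at hp hG
    rw [casimir_comp hn E hG]
    rcases j with _ | j
    · rw [zero_add] at hp
      rw [hp, sub_self]; exact zero_mem _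
    · have := comp_succ_le_xsSub s j l hG
      exact sub_mem (Submodule.smul_mem _ _ this) (Submodule.smul_mem _ _ this)
  exact h (degSub_le_iSup_comp hn _ _ hF)

/-- At the unitarity bound, the multiples of the position vector are the largest submodule. -/
lemma stable_le_or (hn : 3 ≤ n) {E : ℝ} (hE : 2 * (E : ℂ) + 1 = n) {s : ℕ}
    {W : Submodule ℂ (Poly n)} (hWs : W ≤ chirSub n s)
    (hW : ∀ x : so2 n, ∀ F ∈ W, rhoLin n E x F ∈ W) : W ≤ xsSub n s ∨ chirSub n s ≤ W := by
  by_contra! hcon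
  obtain ⟨h1, h2⟩ := hcon
  apply h1
  have hE' : 2 * E + 1 = n := by exact_mod_cast hE
  have hn' : (3 : ℝ) ≤ n := by exact_mod_cast hn
  -- The descent in degree is run modulo `x̸`, where the scalar in degree `N + 1` is
  -- `-(N+1)(2(N+1)+n-2)`, which is nonzero.
  have key : ∀ N, W ⊓ degSub n s N ≤ xsSub n s := by
    intro N
    induction N with
    | zero =>
      rintro F ⟨hF, hF'⟩
      by_contra h0
      refine h2 (le_of_mono_mem hn hW hF ⟨?_, hF'⟩ fun h => h0 (h ▸ zero_mem _))
      rw [dirac_apply]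
      refine Finset.sum_eq_zero fun k _ => ?_
      rw [der_eq_zero_of_eul_zero (by rw [hF'.1, Nat.cast_zero]), map_zero]
    | succ N ih =>
      rintro F ⟨hF, hF'⟩
      have h3 : casimir n E F ∈ xsSub n s := by
        rw [casimir_apply]
        refine sum_mem fun k _ => ?_
        rw [← rhoLin_pMinus (E : ℂ)]
        exact rhoLin_mem_xsSub hE _ (ih ⟨by rw [← rhoLin_pPlus]; exact hW _ _ hF,
          kOp_mem_degSub hF' k⟩)
      have h4 := sub_mem h3 (casimir_sub_mem_xsSub hn E hF')
      rw [sub_sub_cancel] at h4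
      have h5 : (casVal n E 0 (N + 1) : ℂ) ≠ 0 := by
        have hN : (0 : ℝ) ≤ N := Nat.cast_nonneg N
        have : casVal n E 0 (N + 1) = -((N + 1) * (2 * (N + 1) + n - 2)) := by
          rw [casVal, ← hE']; push_cast; ring
        rw [this]
        refine Complex.ofReal_ne_zero.2 (neg_ne_zero.2 (mul_pos ?_ ?_).ne') <;> linarith
      have h6 := Submodule.smul_mem _ (casVal n E 0 (N + 1) : ℂ)⁻¹ h4
      rwa [smul_smul, inv_mul_cancel₀ h5, one_smul] at h6
  intro F hF
  have := mem_iSup_inf_degSub (fun G hG => rhoLin_mem_eul hW hG) hF (hWs hF)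
  exact (iSup_le key) this
end Casimir

/-! ### The invariant Hermitian form -/

section Unitarity
variable {n : ℕ}

/-- Complex conjugation of `so2 n` with respect to the real form. -/
def conjSo (x : so2 n) : so2 n :=
  ⟨x.1.map (starRingEnd ℂ), by
    have hx := (mem_skewAdjointMatricesSubmodule _ _).1
      ((mem_skewAdjointMatricesLieSubalgebra _ _).1 x.2)
    refine (mem_skewAdjointMatricesLieSubalgebra _ _).2
      ((mem_skewAdjointMatricesSubmodule _ _).2 ?_)
    have hd : (LieAlgebra.Orthogonal.indefiniteDiagonal (Fin 2) (Fin n) ℂ).map (starRingEnd ℂ)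
        = LieAlgebra.Orthogonal.indefiniteDiagonal (Fin 2) (Fin n) ℂ := by
      rw [LieAlgebra.Orthogonal.indefiniteDiagonal, Matrix.diagonal_map (map_zero _)]
      congr 1
      ext a
      rcases a with a | a <;> simp
    have h := congrArg (fun A => A.map (starRingEnd ℂ)) hx
    have h' : ((x.1.transpose * LieAlgebra.Orthogonal.indefiniteDiagonal (Fin 2) (Fin n) ℂ).map
        (starRingEnd ℂ)) = (LieAlgebra.Orthogonal.indefiniteDiagonal (Fin 2) (Fin n) ℂ * -x.1).map
        (starRingEnd ℂ) := h
    rw [Matrix.map_mul, Matrix.map_mul, hd] at h'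
    change (x.1.map (starRingEnd ℂ)).transpose * _ = _ * -(x.1.map (starRingEnd ℂ))
    rw [← Matrix.transpose_map, h']
    congr 1⟩

lemma entry_conjSo (x : so2 n) (a b : Fin 2 ⊕ Fin n) :
    entry a b (conjSo x) = starRingEnd ℂ (entry a b x) := rfl

lemma conjSo_add (x y : so2 n) : conjSo (x + y) = conjSo x + conjSo y :=
  so2_ext fun a b => by simp only [entry_conjSo, map_add]

lemma conjSo_smul (c : ℂ) (x : so2 n) : conjSo (c • x) = starRingEnd ℂ c • conjSo x :=
  so2_ext fun a b => by simp only [entry_conjSo, map_smul, smul_eq_mul, map_mul]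

lemma conjSo_lie (x y : so2 n) : conjSo ⁅x, y⁆ = ⁅conjSo x, conjSo y⁆ := by
  apply Subtype.ext
  change (⁅x.1, y.1⁆ : Matrix _ _ ℂ).map _ = ⁅x.1.map _, y.1.map _⁆
  rw [LieRing.of_associative_ring_bracket, LieRing.of_associative_ring_bracket,
    Matrix.map_sub _ (map_sub _), Matrix.map_mul, Matrix.map_mul]

lemma conjSo_of_real {x : so2 n} (hx : IsRealElement x) : conjSo x = x :=
  so2_ext fun a b => Complex.conj_eq_iff_im.2 (hx a b)

lemma etaDiag_conj (a : Fin 2 ⊕ Fin n) : starRingEnd ℂ (etaDiag n a) = etaDiag n a := by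
  rcases a with a | a <;> simp [etaDiag]

lemma conjSo_hTime : conjSo (hTime n) = -hTime n :=
  so2_ext fun a b => by
    rw [entry_conjSo, map_neg, entry_hTime, map_mul, etaDiag_conj]
    split_ifs <;> simp

lemma conjSo_rotM (j k : Fin n) : conjSo (rotM j k) = rotM j k :=
  so2_ext fun a b => by
    rw [entry_conjSo, entry_rotM, map_mul, etaDiag_conj]
    split_ifs <;> simp

lemma ite_neg_I (p : Prop) [Decidable p] :
    (if p then -Complex.I else 0) = -(if p then Complex.I else 0) := by
  split_ifs <;> simp

lemma conjSo_pPlus (k : Fin n) : conjSo (pPlus k) = pMinus k :=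
  so2_ext fun a b => by
    rw [entry_conjSo, entry_pPlus, entry_pMinus, map_mul, etaDiag_conj]
    simp only [map_mul, map_sub, map_add, apply_ite (starRingEnd ℂ), map_one, map_zero,
      Complex.conj_I, ite_neg_I]
    ring

lemma conjSo_pMinus (k : Fin n) : conjSo (pMinus k) = pPlus k :=
  so2_ext fun a b => by
    rw [entry_conjSo, entry_pPlus, entry_pMinus, map_mul, etaDiag_conj]
    simp only [map_mul, map_sub, apply_ite (starRingEnd ℂ), map_one, map_zero,
      Complex.conj_I, ite_neg_I]
    ring

/-- The conjugate linear functionals on spinor polynomials, with the contragredient action. -/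
def AntiDual (n : ℕ) (_E : ℂ) : Type := Poly n →ₗ⋆[ℂ] ℂ

section
variable (E : ℂ)
instance : AddCommGroup (AntiDual n E) := inferInstanceAs (AddCommGroup (Poly n →ₗ⋆[ℂ] ℂ))
instance : Module ℂ (AntiDual n E) := inferInstanceAs (Module ℂ (Poly n →ₗ⋆[ℂ] ℂ))

/-- The conjugate linear functional underlying an element of the contragredient module. -/
def AntiDual.toMap {E : ℂ} (φ : AntiDual n E) : Poly n →ₗ⋆[ℂ] ℂ := φ

/-- Evaluation of a conjugate linear functional. -/
def AntiDual.ev {E : ℂ} (φ : AntiDual n E) (F : Poly n) : ℂ := φ.toMap F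

variable {E}

lemma AntiDual.ext {φ ψ : AntiDual n E} (h : ∀ F, φ.ev F = ψ.ev F) : φ = ψ :=
  LinearMap.ext (f := φ.toMap) (g := ψ.toMap) h

lemma AntiDual.ev_add (φ : AntiDual n E) (F G : Poly n) : φ.ev (F + G) = φ.ev F + φ.ev G :=
  map_add φ.toMap F G

lemma AntiDual.ev_sub (φ : AntiDual n E) (F G : Poly n) : φ.ev (F - G) = φ.ev F - φ.ev G :=
  map_sub φ.toMap F G

lemma AntiDual.ev_smul (φ : AntiDual n E) (c : ℂ) (F : Poly n) :
    φ.ev (c • F) = starRingEnd ℂ c * φ.ev F :=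
  LinearMap.map_smulₛₗ φ.toMap c F

lemma AntiDual.smul_ev (φ : AntiDual n E) (c : ℂ) (F : Poly n) : (c • φ).ev F = c * φ.ev F := rfl

instance : LieRingModule (so2 n) (AntiDual n E) where
  -- Conjugating `x` keeps the action complex linear in `x` on conjugate-linear functionals.
  -- Homomorphisms into this module are then invariant sesquilinear pairings.
  bracket x φ := (-(φ.toMap.comp (rhoLin n E (conjSo x))) : Poly n →ₗ⋆[ℂ] ℂ)
  add_lie x y φ := AntiDual.ext fun F => by
    change -φ.ev (rhoLin n E (conjSo (x + y)) F) =
      -φ.ev (rhoLin n E (conjSo x) F) + -φ.ev (rhoLin n E (conjSo y) F)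
    rw [conjSo_add, map_add, LinearMap.add_apply, AntiDual.ev_add, neg_add]
  lie_add x φ ψ := AntiDual.ext fun F => neg_add (φ.ev _) (ψ.ev _)
  leibniz_lie x y φ := AntiDual.ext fun F => by
    change - -φ.ev (rhoLin n E (conjSo y) (rhoLin n E (conjSo x) F)) =
      -φ.ev (rhoLin n E (conjSo ⁅x, y⁆) F)
        + - -φ.ev (rhoLin n E (conjSo x) (rhoLin n E (conjSo y) F))
    rw [conjSo_lie, rhoLin_lie, AntiDual.ev_sub]; ring

lemma AntiDual.lie_ev (x : so2 n) (φ : AntiDual n E) (F : Poly n) :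
    AntiDual.ev ⁅x, φ⁆ F = -φ.ev (rhoLin n E (conjSo x) F) := rfl

instance : LieModule ℂ (so2 n) (AntiDual n E) where
  smul_lie c x φ := AntiDual.ext fun F => by
    rw [AntiDual.lie_ev, AntiDual.smul_ev, AntiDual.lie_ev, conjSo_smul, map_smul,
      LinearMap.smul_apply, AntiDual.ev_smul, Complex.conj_conj, mul_neg]
  lie_smul c x φ := AntiDual.ext fun F => by
    rw [AntiDual.lie_ev, AntiDual.smul_ev, AntiDual.smul_ev, AntiDual.lie_ev, mul_neg]
end

lemma fischer_eul (F G : Poly n) : fischer (eul n F) G = fischer F (eul n G) := by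
  have hl : ∀ (t : Finset (Fin n)) (f : Fin n → Poly n) (G : Poly n),
      fischer (∑ k ∈ t, f k) G = ∑ k ∈ t, fischer (f k) G := by
    intro t f G
    simp only [fischer, Finset.sum_apply, map_sum, LinearMap.sum_apply]
    rw [Finset.sum_comm]
  have hr : ∀ (t : Finset (Fin n)) (f : Fin n → Poly n) (G : Poly n),
      fischer G (∑ k ∈ t, f k) = ∑ k ∈ t, fischer G (f k) := by
    intro t f G
    simp only [fischer, Finset.sum_apply, map_sum]
    rw [Finset.sum_comm]
  rw [eul_apply, eul_apply, hl, hr]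
  exact Finset.sum_congr rfl fun k _ => by rw [fischer_mulX, fischer_der]

lemma fischer_zero_right (F : Poly n) : fischer F 0 = 0 := by
  rw [← zero_smul ℂ (0 : Poly n), fischer_smul_right, zero_mul]

/-- Pairing with a spinor polynomial as a conjugate linear functional. -/
def fischerFun (G : Poly n) : Poly n →ₗ⋆[ℂ] ℂ where
  toFun F := fischer F G
  map_add' F F' := fischer_add_left F F' G
  map_smul' c F := fischer_smul_left c F G

/-- The pairing as a map to the contragredient module. -/
def fischerDual (n : ℕ) (E : ℂ) : Poly n →ₗ[ℂ] AntiDual n E where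
  toFun G := (fischerFun G : Poly n →ₗ⋆[ℂ] ℂ)
  map_add' G G' := AntiDual.ext fun F => by
    change fischer F (G + G') = fischer F G + fischer F G'
    exact fischer_add_right F G G'
  map_smul' c G := AntiDual.ext fun F => by
    change fischer F (c • G) = c * fischer F G
    exact fischer_smul_right c F G

lemma fischerDual_ev (E : ℂ) (F G : Poly n) : (fischerDual n E G).ev F = fischer F G := rfl

lemma der_mono_zero {s : ℕ} {F : Poly n} (hF : F ∈ mono n s 0) (k : Fin n) : der k F = 0 :=
  der_eq_zero_of_eul_zero (by rw [hF.2.1, Nat.cast_zero]) k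

/-- The Fischer form is invariant under the compact subalgebra: rotations are skew, and the energy
operator is self-adjoint because `E` is real. -/
lemma fischerDual_lie (E : ℝ) (x : compactK n) (G : Poly n) :
    fischerDual n E (rhoLin n E (x : so2 n) G) = ⁅(x : so2 n), fischerDual n E G⁆ := by
  have h0 : fischerDual n E (rhoLin n E (hTime n) G) = ⁅hTime n, fischerDual n E G⁆ := by
    refine AntiDual.ext fun F => ?_
    rw [AntiDual.lie_ev, fischerDual_ev, fischerDual_ev, conjSo_hTime, map_neg,
      LinearMap.neg_apply, fischer_neg_left, neg_neg, rhoLin_hTime, hOp_apply, hOp_apply,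
      fischer_neg_left, fischer_neg_right, fischer_add_left, fischer_add_right, fischer_eul,
      fischer_smul_left, fischer_smul_right, Complex.conj_ofReal]
  have h1 : ∀ j k, fischerDual n E (rhoLin n E (rotM j k) G) = ⁅rotM j k, fischerDual n E G⁆ := by
    intro j k
    refine AntiDual.ext fun F => ?_
    rw [AntiDual.lie_ev, fischerDual_ev, fischerDual_ev, conjSo_rotM, rhoLin_rotM, fischer_rot,
      neg_neg]
  have h : (x : so2 n) = _ := congrArg (kIncl n) (compactK_decomp x)
  rw [h]
  simp only [map_add, map_sum, map_smul, LinearMap.add_apply, LinearMap.sum_apply,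
    LinearMap.smul_apply, kIncl_apply, wedgeSpace_single, coe_cartanH_zero, add_lie, sum_lie,
    smul_lie, h0, h1]

/-- The invariant form on spinor polynomials of chirality `(-1) ^ s`. -/
lemma exists_form (hn : 3 ≤ n) (E : ℝ) (s : ℕ) : ∃ B : Poly n →ₗ⋆[ℂ] Poly n →ₗ[ℂ] ℂ,
    (∀ x F G, B F (rhoLin n E x G) = -B (rhoLin n E (conjSo x) F) G) ∧
    ∀ F, ∀ G ∈ mono n s 0, B F G = fischer F G := by
  -- Pairing with a constant is annihilated by `𝔭⁺`, because the adjoint of multiplication by `x_k`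
  -- is a derivative, which kills constants. The universal property therefore extends the Fischer
  -- pairing from constants to an invariant form.
  obtain ⟨f, hf⟩ := exists_confChir_hom hn E s (Y := AntiDual n E)
    (fischerDual n E ∘ₗ (compK n (E : ℂ) s 0 0).toSubmodule.subtype)
    (fun x v => fischerDual_lie E x (toPoly (v : ConfMod n E)))
    (fun k v => by
      refine AntiDual.ext fun F => ?_
      rw [AntiDual.lie_ev, conjSo_pPlus, rhoLin_pMinus]
      change -fischer (mulX k F) (toPoly (v : ConfMod n E)) = 0
      have h : der k (toPoly (v : ConfMod n E)) = 0 := der_mono_zero (mem_comp_zero.1 v.2) k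
      rw [fischer_mulX, h, fischer_zero_right, neg_zero])
  let P : Module.End ℂ (Poly n) := (1 / 2 : ℂ) • (LinearMap.id + (-1 : ℂ) ^ s • chi n)
  have hP : ∀ G, P G = (1 / 2 : ℂ) • (G + (-1 : ℂ) ^ s • chi n G) := fun G => rfl
  have hPm : ∀ G, P G ∈ chirSub n s := by
    intro G
    rw [mem_chirSub, hP, map_smul, map_add, map_smul, chi_chi,
      smul_comm ((-1 : ℂ) ^ s) (1 / 2 : ℂ),
      smul_add ((-1 : ℂ) ^ s), smul_smul, neg_one_pow_sq, one_smul, add_comm]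
  have hPl : ∀ (x : so2 n) G, P (rhoLin n E x G) = rhoLin n E x (P G) := by
    intro x G
    rw [hP, hP, map_smul, map_add, map_smul, rhoLin_chi]
  -- Projecting the second argument defines the form on all spinor polynomials, and invariance
  -- survives because chirality commutes with the action.
  let Q : Poly n →ₗ[ℂ] confChir n (E : ℂ) s := P.codRestrict (chirSub n s) hPm
  refine ⟨LinearMap.mk₂'ₛₗ (starRingEnd ℂ) (RingHom.id ℂ) (fun F G => (f (Q G)).ev F)
    (fun F F' G => AntiDual.ev_add _ F F') (fun c F G => AntiDual.ev_smul _ c F)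
    (fun F G G' => by rw [map_add, map_add]; rfl) (fun F c G => by rw [map_smul, map_smul]; rfl),
    fun x F G => ?_, fun F G hG => ?_⟩
  · change (f (Q (rhoLin n E x G))).ev F = -(f (Q G)).ev (rhoLin n E (conjSo x) F)
    have : Q (rhoLin n E x G) = ⁅x, Q G⁆ := Subtype.ext (hPl x G)
    rw [this, LieModuleHom.map_lie, AntiDual.lie_ev]
  · change (f (Q G)).ev F = _
    have h1 : Q G = ⟨G, mem_chirSub.2 hG.2.2⟩ := by
      refine Subtype.ext ?_
      change P G = G
      rw [hP, hG.2.2, smul_smul, neg_one_pow_sq]; module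
    rw [h1]
    exact congrArg (fun φ : AntiDual n E => φ.ev F) (hf ⟨G, mem_comp_zero.2 hG⟩)

/-- Eigenvectors of a `B`-symmetric operator with distinct real eigenvalues are orthogonal, so the
form of the sum is the sum of the forms. -/
lemma pos_of_components {V ι : Type} [AddCommGroup V] [Module ℂ V] (B : V →ₗ⋆[ℂ] V →ₗ[ℂ] ℂ)
    (g : Module.End ℂ V) (hg : ∀ a b, B (g a) b = B a (g b)) (t : Finset ι) (c : ι → ℝ)
    (hc : Function.Injective c) (f : ι → V) (hf : ∀ i, g (f i) = (c i : ℂ) • f i)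
    (hpos : ∀ i, f i ≠ 0 → 0 < (B (f i) (f i)).re) (hne : ∑ i ∈ t, f i ≠ 0) :
    0 < (B (∑ i ∈ t, f i) (∑ i ∈ t, f i)).re := by
  have horth : ∀ i k, i ≠ k → B (f i) (f k) = 0 := by
    intro i k hik
    have h := hg (f i) (f k)
    rw [hf, hf, LinearMap.map_smulₛₗ, map_smul, LinearMap.smul_apply, Complex.conj_ofReal,
      ← sub_eq_zero, ← sub_smul] at h
    refine (smul_eq_zero.1 h).resolve_left ?_
    exact sub_ne_zero.2 fun h => hik (hc (Complex.ofReal_injective h))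
  have hsum : B (∑ i ∈ t, f i) (∑ i ∈ t, f i) = ∑ i ∈ t, B (f i) (f i) := by
    rw [map_sum]
    refine Finset.sum_congr rfl fun i hi => ?_
    rw [map_sum, LinearMap.sum_apply,
      Finset.sum_eq_single_of_mem i hi fun k _ hk => horth k i hk]
  rw [hsum, Complex.re_sum]
  obtain ⟨i, hi, hi0⟩ := Finset.exists_ne_zero_of_sum_ne_zero hne
  refine Finset.sum_pos' (fun k _ => ?_) ⟨i, hi, hpos i hi0⟩
  by_cases hk : f k = 0
  · rw [hk, map_zero]; exact le_rfl
  · exact (hpos k hk).le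

/-- In fixed degree `N` only the term `j(2N - j + n - 1)` varies, and it strictly increases in `j`
for `j ≤ N`. -/
lemma casVal_injective (hn : 3 ≤ n) (E : ℝ) (N : ℕ) : Function.Injective
    fun p : {p : ℕ × ℕ // p.1 + p.2 = N} => casVal n E p.1.1 p.1.2 := by
  have hn' : (3 : ℝ) ≤ n := by exact_mod_cast hn
  have key : ∀ j l j' l' : ℕ, j + l = j' + l' → j < j' →
      casVal n E j l < casVal n E j' l' := by
    intro j l j' l' h hj
    have h1 : (j : ℝ) + l = j' + l' := by exact_mod_cast h
    have h2 : (j : ℝ) + 1 ≤ j' := by exact_mod_cast hj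
    have h3 : (0 : ℝ) ≤ l' := Nat.cast_nonneg _
    have h4 : (0 : ℝ) ≤ j := Nat.cast_nonneg _
    have hl : (l : ℝ) = j' + l' - j := by linarith
    have h5 : 0 < ((j' : ℝ) - j) * (2 * l' + (j' - j) + n - 1) := by
      apply mul_pos <;> linarith
    rw [casVal, casVal, ← h1, hl]
    nlinarith
  rintro ⟨⟨j, l⟩, h⟩ ⟨⟨j', l'⟩, h'⟩ heq
  simp only at h h' heq
  have hj : j = j' := by
    rcases lt_trichotomy j j' with hlt | hlt | hlt
    · exact absurd heq (key j l j' l' (h.trans h'.symm) hlt).ne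
    · exact hlt
    · exact absurd heq (key j' l' j l (h'.trans h.symm) hlt).ne'
  subst hj
  have : l = l' := by omega
  subst this
  rfl

lemma polyPair_conj (f g : MvPolynomial (Fin n) ℂ) :
    polyPair n (polyConj n f) (polyConj n g) = starRingEnd ℂ (polyPair n f g) := by
  induction f using MvPolynomial.induction_on' with
  | monomial m a =>
    have h : MvPolynomial.monomial m a = a • MvPolynomial.monomial m (1 : ℂ) := by
      rw [MvPolynomial.smul_monomial, smul_eq_mul, mul_one]
    rw [h, polyConj_smul, MvPolynomial.map_monomial, map_one, map_smul, map_smul,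
      LinearMap.smul_apply, LinearMap.smul_apply, polyPair_monomial, polyPair_monomial,
      MvPolynomial.coeff_map, smul_eq_mul, smul_eq_mul, map_mul, map_mul, map_natCast]
  | add f f' hf hf' =>
    rw [map_add, map_add, map_add, LinearMap.add_apply, LinearMap.add_apply, hf, hf', map_add]

lemma fischer_conj (F G : Poly n) : fischer G F = starRingEnd ℂ (fischer F G) := by
  rw [fischer, fischer, map_sum]
  refine Finset.sum_congr rfl fun b _ => ?_
  rw [← polyPair_conj, polyPair_comm]
  congr 2
  ext m
  simp [MvPolynomial.coeff_map]

/-! ### Hermitian symmetry and positivity above the bound -/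

section Positivity
variable {E : ℝ} {s : ℕ} {B : Poly n →ₗ⋆[ℂ] Poly n →ₗ[ℂ] ℂ}

lemma form_mulX (hB : ∀ x F G, B F (rhoLin n E x G) = -B (rhoLin n E (conjSo x) F) G)
    (k : Fin n) (F G : Poly n) : B F (mulX k G) = -B (kOp E k F) G := by
  have := hB (pMinus k) F G
  rwa [conjSo_pMinus, rhoLin_pMinus, rhoLin_pPlus] at this

lemma form_kOp (hB : ∀ x F G, B F (rhoLin n E x G) = -B (rhoLin n E (conjSo x) F) G)
    (k : Fin n) (F G : Poly n) : B F (kOp E k G) = -B (mulX k F) G := by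
  have := hB (pPlus k) F G
  rwa [conjSo_pPlus, rhoLin_pMinus, rhoLin_pPlus] at this

lemma form_eul (hB : ∀ x F G, B F (rhoLin n E x G) = -B (rhoLin n E (conjSo x) F) G)
    (F G : Poly n) : B (eul n F) G = B F (eul n G) := by
  have := hB (hTime n) F G
  rw [conjSo_hTime, map_neg, rhoLin_hTime, LinearMap.neg_apply, hOp_apply, hOp_apply, map_neg,
    neg_neg, map_add, map_add, LinearMap.add_apply, LinearMap.map_smulₛₗ B, (B F).map_smul,
    LinearMap.smul_apply, Complex.conj_ofReal] at this
  linear_combination this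

lemma form_casimir_left (hB : ∀ x F G, B F (rhoLin n E x G) = -B (rhoLin n E (conjSo x) F) G)
    (F G : Poly n) : B (casimir n E F) G = -∑ k, B (kOp E k F) (kOp E k G) := by
  rw [casimir_apply, map_sum, LinearMap.sum_apply, ← Finset.sum_neg_distrib]
  exact Finset.sum_congr rfl fun k _ => by rw [form_kOp hB, neg_neg]

lemma form_casimir_right (hB : ∀ x F G, B F (rhoLin n E x G) = -B (rhoLin n E (conjSo x) F) G)
    (F G : Poly n) : B F (casimir n E G) = -∑ k, B (kOp E k F) (kOp E k G) := by
  rw [casimir_apply, map_sum, ← Finset.sum_neg_distrib]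
  exact Finset.sum_congr rfl fun k _ => form_mulX hB k _ _

/-- The form is built asymmetrically, from its second argument. On constants it is the Hermitian
Fischer form; moving each factor `x_k` across as `-K_k` propagates the symmetry, first with one
argument constant and then in general. -/
lemma form_conj (hB : ∀ x F G, B F (rhoLin n E x G) = -B (rhoLin n E (conjSo x) F) G)
    (hB0 : ∀ F, ∀ G ∈ mono n s 0, B F G = fischer F G) {F G : Poly n} (hF : F ∈ chirSub n s)
    (hG : G ∈ chirSub n s) : B G F = starRingEnd ℂ (B F G) := by
  -- A multiple of a coordinate pairs to zero with a constant on either side, because `K_k` and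
  -- `∂_k` kill constants.
  have h1 : ∀ G ∈ mono n s 0, ∀ F ∈ chirSub n s, B G F = starRingEnd ℂ (B F G) := by
    intro G hG F hF
    let Z : Submodule ℂ (Poly n) :=
      { carrier := {F | B G F = starRingEnd ℂ (B F G)}
        add_mem' := fun {a b} ha hb => by
          change B G (a + b) = starRingEnd ℂ (B (a + b) G)
          rw [map_add, map_add, LinearMap.add_apply, map_add, ha, hb]
        zero_mem' := by
          change B G 0 = starRingEnd ℂ (B 0 G)
          rw [map_zero, map_zero, LinearMap.zero_apply, map_zero]
        smul_mem' := fun c a ha => by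
          change B G (c • a) = starRingEnd ℂ (B (c • a) G)
          rw [(B G).map_smul, LinearMap.map_smulₛₗ B, LinearMap.smul_apply, smul_eq_mul,
            smul_eq_mul, map_mul, Complex.conj_conj, ha] }
    refine (chirSub_le (W := Z) (fun F hF => ?_) (fun k F _ => ?_)) hF
    · change B G F = starRingEnd ℂ (B F G)
      rw [hB0 _ _ hF, hB0 _ _ hG, fischer_conj]
    · change B G (mulX k F) = starRingEnd ℂ (B (mulX k F) G)
      rw [form_mulX hB, hB0 _ _ hG, kOp_comp_zero (mem_comp_zero.2 hG), fischer_mulX,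
        der_mono_zero hG, fischer_zero_right]
      simp
  let Z : Submodule ℂ (Poly n) :=
    { carrier := {G | G ∈ chirSub n s ∧ ∀ F ∈ chirSub n s, B G F = starRingEnd ℂ (B F G)}
      add_mem' := fun {a b} ha hb => ⟨add_mem ha.1 hb.1, fun F hF => by
        rw [map_add, map_add, LinearMap.add_apply, map_add, ha.2 F hF, hb.2 F hF]⟩
      zero_mem' := ⟨zero_mem _, fun F _ => by
        rw [map_zero, map_zero, LinearMap.zero_apply, map_zero]⟩
      smul_mem' := fun c a ha => ⟨Submodule.smul_mem _ c ha.1, fun F hF => by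
        rw [LinearMap.map_smulₛₗ B, LinearMap.smul_apply, (B F).map_smul, smul_eq_mul, smul_eq_mul,
          map_mul, ha.2 F hF]⟩ }
  have h2 : chirSub n s ≤ Z := by
    refine chirSub_le (fun G hG => ⟨mem_chirSub.2 hG.2.2, h1 G hG⟩) fun k G hG =>
      ⟨by rw [← rhoLin_pMinus 0]; exact rhoLin_mem_chirSub _ _ hG.1, fun F hF => ?_⟩
    have h3 := hG.2 (kOp E k F) (by rw [← rhoLin_pPlus]; exact rhoLin_mem_chirSub _ _ hF)
    rw [form_kOp hB] at h3
    rw [form_mulX hB, map_neg, ← h3, neg_neg]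
  exact (h2 hG).2 F hF

/-- On a Fischer component the Casimir eigenvalue times `B(F,F)` equals `-∑ B(K_k F, K_k F)`. The
eigenvalue is negative and some `K_k F` is nonzero, so positivity passes up from degree `N`.
Distinct components are orthogonal because the Casimir operator is symmetric with distinct
eigenvalues. -/
lemma form_pos_degSub (hn : 3 ≤ n) (hE : ((n : ℝ) - 1) / 2 < E)
    (hB : ∀ x F G, B F (rhoLin n E x G) = -B (rhoLin n E (conjSo x) F) G)
    (hB0 : ∀ F, ∀ G ∈ mono n s 0, B F G = fischer F G) (N : ℕ) {F : Poly n}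
    (hF : F ∈ degSub n s N) (h0 : F ≠ 0) : 0 < (B F F).re := by
  induction N generalizing F with
  | zero =>
    have hm : F ∈ mono n s 0 := by
      refine ⟨?_, hF⟩
      rw [dirac_apply]
      refine Finset.sum_eq_zero fun k _ => ?_
      rw [der_eq_zero_of_eul_zero (by rw [hF.1, Nat.cast_zero]), map_zero]
    rw [hB0 _ _ hm]
    refine lt_of_le_of_ne (fischer_self_nonneg F) fun h => h0 (fischer_self_eq_zero ?_)
    have him : (fischer F F).im = 0 := Complex.conj_eq_iff_im.1 (fischer_conj F F).symm
    exact Complex.ext h.symm him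
  | succ N ih =>
    obtain ⟨f, hf, rfl⟩ := (Submodule.mem_iSup_iff_exists_finsupp _ _).1
      (degSub_le_iSup_comp hn _ _ hF)
    refine pos_of_components B (casimir n E)
      (fun a b => by rw [form_casimir_left hB, form_casimir_right hB]) f.support _
      (casVal_injective hn E (N + 1)) f (fun p => casimir_comp hn E (hf p)) (fun p hp => ?_) h0
    have hd : f p ∈ degSub n s (N + 1) := by
      have := comp_le_degSub s p.1.1 p.1.2 (hf p)
      rwa [p.2] at this
    have hneg : casVal n E p.1.1 p.1.2 < 0 := casVal_neg hE (by have := p.2; omega) hn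
    have h1 := congrArg Complex.re (form_casimir_right hB (f p) (f p))
    rw [casimir_comp hn E (hf p), map_smul, smul_eq_mul, Complex.re_ofReal_mul, Complex.neg_re,
      Complex.re_sum] at h1
    have h2 : 0 < ∑ k, (B (kOp E k (f p)) (kOp E k (f p))).re := by
      have h3 : ∃ k, kOp (E : ℂ) k (f p) ≠ 0 := by
        by_contra! hcon
        refine hp (casimir_injOn hn hE hd ?_)
        rw [casimir_apply]
        exact Finset.sum_eq_zero fun k _ => by rw [hcon k, map_zero]
      obtain ⟨k, hk⟩ := h3
      refine Finset.sum_pos' (fun i _ => ?_) ⟨k, Finset.mem_univ k, ih (kOp_mem_degSub hd k) hk⟩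
      by_cases hi : kOp (E : ℂ) i (f p) = 0
      · rw [hi, map_zero]; exact le_rfl
      · exact (ih (kOp_mem_degSub hd i) hi).le
    by_contra! h4
    have := mul_nonneg_of_nonpos_of_nonpos hneg.le h4
    linarith

lemma form_pos (hn : 3 ≤ n) (hE : ((n : ℝ) - 1) / 2 < E)
    (hB : ∀ x F G, B F (rhoLin n E x G) = -B (rhoLin n E (conjSo x) F) G)
    (hB0 : ∀ F, ∀ G ∈ mono n s 0, B F G = fischer F G) {F : Poly n}
    (hF : F ∈ chirSub n s) (h0 : F ≠ 0) : 0 < (B F F).re := by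
  obtain ⟨f, hf, rfl⟩ := (Submodule.mem_iSup_iff_exists_finsupp _ _).1 (mem_iSup_degSub hF)
  exact pos_of_components B (eul n) (form_eul hB) f.support (fun N => (N : ℝ)) Nat.cast_injective f
    (fun N => by rw [(hf N).1, Complex.ofReal_natCast])
    (fun N hN => form_pos_degSub hn hE hB hB0 N (hf N) hN) h0
end Positivity

/-- Above the unitarity bound the spinor polynomials are unitarizable. -/
theorem confChir_unitarizable (hn : 3 ≤ n) {E : ℝ} (hE : ((n : ℝ) - 1) / 2 < E) (s : ℕ) :
    IsUnitarizable n (confChir n (E : ℂ) s) := by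
  obtain ⟨B, hB, hB0⟩ := exists_form hn E s
  let ι : confChir n (E : ℂ) s →ₗ[ℂ] Poly n := (confChir n (E : ℂ) s).toSubmodule.subtype
  refine ⟨LinearMap.mk₂'ₛₗ (starRingEnd ℂ) (RingHom.id ℂ) (fun v w => B (ι v) (ι w))
    (fun v v' w => by rw [map_add, map_add, LinearMap.add_apply])
    (fun c v w => by rw [map_smul, LinearMap.map_smulₛₗ, LinearMap.smul_apply])
    (fun v w w' => by rw [map_add, map_add]) (fun c v w => by rw [map_smul, map_smul]; rfl),
    fun v w => form_conj hB hB0 v.2 w.2, fun v hv => form_pos hn hE hB hB0 v.2 fun h =>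
      hv (Subtype.ext h), fun x hx v w => ?_⟩
  change B (rhoLin n E x (ι v)) (ι w) = -B (ι v) (rhoLin n E x (ι w))
  rw [hB, conjSo_of_real hx, neg_neg]

lemma IsUnitarizable.of_equiv {V W : Type} [AddCommGroup V] [Module ℂ V] [LieRingModule (so2 n) V]
    [AddCommGroup W] [Module ℂ W] [LieRingModule (so2 n) W] (e : V ≃ₗ⁅ℂ, so2 n⁆ W)
    (h : IsUnitarizable n W) : IsUnitarizable n V := by
  obtain ⟨B, h1, h2, h3⟩ := h
  let ι : V →ₗ[ℂ] W := e
  have hι : ∀ (x : so2 n) v, ι ⁅x, v⁆ = ⁅x, ι v⁆ := fun x v => e.toLieModuleHom.map_lie x v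
  refine ⟨LinearMap.mk₂'ₛₗ (starRingEnd ℂ) (RingHom.id ℂ) (fun v w => B (ι v) (ι w))
    (fun v v' w => by rw [map_add, map_add, LinearMap.add_apply])
    (fun c v w => by rw [map_smul, LinearMap.map_smulₛₗ, LinearMap.smul_apply])
    (fun v w w' => by rw [map_add, map_add]) (fun c v w => by rw [map_smul, map_smul]; rfl),
    fun v w => h1 _ _, fun v hv => h2 _ fun h => hv (e.injective (h.trans (map_zero ι).symm)),
    fun x hx v w => ?_⟩
  change B (ι ⁅x, v⁆) (ι w) = -B (ι v) (ι ⁅x, w⁆)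
  rw [hι, hι, h3 x hx]
end Unitarity

/-! ### Maximal quotients and direct sums of eigenspaces -/

section Generic
variable {L M V : Type} [LieRing L] [LieAlgebra ℂ L] [AddCommGroup M] [Module ℂ M]
  [LieRingModule L M] [LieModule ℂ L M] [AddCommGroup V] [Module ℂ V] [LieRingModule L V]

lemma quotient_sumOfProper_irreducible (h : sumOfProper L M ≠ ⊤) :
    LieModule.IsIrreducible ℂ L (M ⧸ sumOfProper L M) := by
  have hnt : Nontrivial (M ⧸ sumOfProper L M) :=
    Submodule.Quotient.nontrivial_iff.2 fun h' => h (by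
      rw [← LieSubmodule.toSubmodule_inj]; exact h')
  refine LieModule.IsIrreducible.mk fun N hN => ?_
  by_contra hT
  apply hN
  have h1 : N.comap (LieSubmodule.Quotient.mk' (sumOfProper L M)) ≤ sumOfProper L M := by
    refine le_sSup fun h2 => hT ?_
    rw [eq_top_iff]
    rintro y -
    obtain ⟨m, rfl⟩ := LieSubmodule.Quotient.surjective_mk' _ y
    have : m ∈ N.comap (LieSubmodule.Quotient.mk' (sumOfProper L M)) := by
      rw [h2]; exact LieSubmodule.mem_top _
    exact this
  rw [LieSubmodule.eq_bot_iff]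
  intro y hy
  obtain ⟨m, rfl⟩ := LieSubmodule.Quotient.surjective_mk' _ y
  exact (LieSubmodule.Quotient.mk_eq_zero' (N := sumOfProper L M)).2 (h1 hy)

lemma sumOfProper_eq_of_forall_le {W : LieSubmodule ℂ L M} (hW : W ≠ ⊤)
    (h : ∀ W' : LieSubmodule ℂ L M, W' ≠ ⊤ → W' ≤ W) : sumOfProper L M = W :=
  le_antisymm (sSup_le h) (le_sSup hW)

/-- The images lie in eigenspaces of one operator for distinct eigenvalues and are therefore
independent. -/
lemma toModule_injective_of_eigen {ι : Type} [DecidableEq ι] {U : ι → Type}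
    [∀ i, AddCommGroup (U i)] [∀ i, Module ℂ (U i)] (φ : ∀ i, U i →ₗ[ℂ] V)
    (hφ : ∀ i, Function.Injective (φ i)) (T : Module.End ℂ V) (c : ι → ℂ)
    (hc : Function.Injective c) (hT : ∀ i u, T (φ i u) = c i • φ i u) :
    Function.Injective (DirectSum.toModule ℂ ι V φ) := by
  have hind : iSupIndep fun i => LinearMap.range (φ i) := by
    refine ((Module.End.eigenspaces_iSupIndep T).comp hc).mono fun i => ?_
    rintro _ ⟨u, rfl⟩
    exact Module.End.mem_eigenspace_iff.2 (hT i u)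
  have h : ⇑(DirectSum.toModule ℂ ι V φ) =
      DFinsupp.lsum ℕ (fun i => (LinearMap.range (φ i)).subtype) ∘
        DFinsupp.mapRange.linearMap (fun i => (φ i).rangeRestrict) := by
    have h1 : DirectSum.toModule ℂ ι V φ =
        DirectSum.toModule ℂ ι V (fun i => (LinearMap.range (φ i)).subtype) ∘ₗ
          DFinsupp.mapRange.linearMap (fun i => (φ i).rangeRestrict) := by
      refine DirectSum.linearMap_ext ℂ fun i => LinearMap.ext fun u => ?_
      rw [LinearMap.comp_apply, LinearMap.comp_apply, LinearMap.comp_apply,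
        DirectSum.toModule_lof]
      have : DFinsupp.mapRange.linearMap (fun i => (φ i).rangeRestrict)
          (DirectSum.lof ℂ ι U i u) =
          DirectSum.lof ℂ ι (fun i => LinearMap.range (φ i)) i ((φ i).rangeRestrict u) :=
        DFinsupp.mapRange_single (hf := fun i => map_zero _)
      rw [this, DirectSum.toModule_lof]
      rfl
    rw [h1]
    rfl
  rw [h]
  refine hind.dfinsupp_lsum_injective.comp ?_
  refine (DFinsupp.mapRange_injective _ fun i => map_zero _).2 fun i a b hab => ?_
  exact hφ i (congrArg Subtype.val hab)

lemma lieEquiv_directSum {ι : Type} [DecidableEq ι] {U : ι → Type} [∀ i, AddCommGroup (U i)]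
    [∀ i, Module ℂ (U i)] [∀ i, LieRingModule L (U i)] [∀ i, LieModule ℂ L (U i)]
    (φ : ∀ i, U i →ₗ⁅ℂ, L⁆ V)
    (hinj : Function.Injective (DirectSum.toModule ℂ ι V fun i => (φ i : U i →ₗ[ℂ] V)))
    (hsup : ∀ v, v ∈ ⨆ i, LinearMap.range (φ i : U i →ₗ[ℂ] V)) :
    Nonempty (V ≃ₗ⁅ℂ, L⁆ ⨁ i, U i) := by
  have hof : ∀ i u, DirectSum.toModule ℂ ι V (fun i => (φ i : U i →ₗ[ℂ] V))
      (DirectSum.of U i u) = φ i u := fun i u => DirectSum.toModule_lof ℂ i u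
  let Φ : (⨁ i, U i) →ₗ⁅ℂ, L⁆ V :=
    { DirectSum.toModule ℂ ι V (fun i => (φ i : U i →ₗ[ℂ] V)) with
      map_lie' := fun {x v} => by
        change DirectSum.toModule ℂ ι V (fun i => (φ i : U i →ₗ[ℂ] V)) ⁅x, v⁆ =
          ⁅x, DirectSum.toModule ℂ ι V (fun i => (φ i : U i →ₗ[ℂ] V)) v⁆
        induction v using DirectSum.induction_on with
        | zero => rw [lie_zero, map_zero, lie_zero]
        | of i u =>
          have : ⁅x, DirectSum.of U i u⁆ = DirectSum.of U i ⁅x, u⁆ :=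
            ((DirectSum.lieModuleOf ℂ ι L U i).map_lie x u).symm
          rw [this, hof, hof, LieModuleHom.map_lie]
        | add v w hv hw => rw [lie_add, map_add, map_add, hv, hw, lie_add] }
  have hsurj : Function.Surjective Φ := by
    have : (⨆ i, LinearMap.range (φ i : U i →ₗ[ℂ] V)) ≤
        LinearMap.range (DirectSum.toModule ℂ ι V fun i => (φ i : U i →ₗ[ℂ] V)) := by
      refine iSup_le fun i => ?_
      rintro _ ⟨u, rfl⟩
      exact ⟨DirectSum.of U i u, hof i u⟩
    exact fun v => this (hsup v)
  exact ⟨LieModuleEquiv.symm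
    { Φ, LinearEquiv.ofBijective (Φ : (⨁ i, U i) →ₗ[ℂ] V) ⟨hinj, hsurj⟩ with }⟩
end Generic

/-! ### Transfer from spinor polynomials to `N(μ)` and `L(μ)` -/

section Main
variable {n : ℕ}

lemma chirSpin_zero : chirSpin n 0 = 1 / 2 := by simp [chirSpin]

lemma chirSpin_one : chirSpin n 1 = lastSpin n := by simp [chirSpin]

/-- The spinor polynomials underlying a submodule. -/
def polySub {E : ℂ} {s : ℕ} (N : LieSubmodule ℂ (so2 n) (confChir n E s)) :
    Submodule ℂ (Poly n) := N.toSubmodule.map (confChir n E s).toSubmodule.subtype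

lemma mem_polySub {E : ℂ} {s : ℕ} {N : LieSubmodule ℂ (so2 n) (confChir n E s)}
    {v : confChir n E s} : toPoly (v : ConfMod n E) ∈ polySub N ↔ v ∈ N := by
  constructor
  · rintro ⟨w, hw, h⟩
    have : w = v := Subtype.ext h
    exact this ▸ hw
  · exact fun h => ⟨v, h, rfl⟩

lemma polySub_le {E : ℂ} {s : ℕ} (N : LieSubmodule ℂ (so2 n) (confChir n E s)) :
    polySub N ≤ chirSub n s := by
  rintro _ ⟨w, -, rfl⟩
  exact w.2

lemma rhoLin_mem_polySub {E : ℂ} {s : ℕ} (N : LieSubmodule ℂ (so2 n) (confChir n E s))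
    (x : so2 n) : ∀ F ∈ polySub N, rhoLin n E x F ∈ polySub N := by
  rintro _ ⟨w, hw, rfl⟩
  exact ⟨(⁅x, (show confChir n E s from w)⁆ : confChir n E s), N.lie_mem hw, rfl⟩

lemma eq_top_of_chirSub_le {E : ℂ} {s : ℕ} {N : LieSubmodule ℂ (so2 n) (confChir n E s)}
    (h : chirSub n s ≤ polySub N) : N = ⊤ := by
  rw [eq_top_iff]
  rintro v -
  exact mem_polySub.1 (h v.2)

lemma confChir_irreducible (hn : 3 ≤ n) {E : ℝ} (hE : ((n : ℝ) - 1) / 2 < E) (s : ℕ) :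
    LieModule.IsIrreducible ℂ (so2 n) (confChir n (E : ℂ) s) := by
  have hnt : Nontrivial (confChir n (E : ℂ) s) :=
    ⟨⟨⟨hwv hn s 0, mem_chirSub.2 (hwv_mem_mono hn s 0).2.2⟩, 0, fun h =>
      hwv_ne_zero hn s 0 (congrArg Subtype.val h)⟩⟩
  refine LieModule.IsIrreducible.mk fun N hN => ?_
  rcases stable_eq_bot_or hn hE (polySub_le N) (rhoLin_mem_polySub N) with h | h
  · exfalso
    apply hN
    rw [LieSubmodule.eq_bot_iff]
    intro v hv
    have := mem_polySub.2 hv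
    rw [h] at this
    exact Subtype.ext ((Submodule.mem_bot ℂ).1 this)
  · exact eq_top_of_chirSub_le h

/-- Above the unitarity bound the induced module is irreducible, and both it and its irreducible
quotient are realized on spinor polynomials. -/
theorem NMod_LMod_equiv (hn : 3 ≤ n) {E : ℝ} (hE : ((n : ℝ) - 1) / 2 < E) (s : ℕ) :
    LieModule.IsIrreducible ℂ (so2 n) (NMod n (spinWeight n E 0 (chirSpin n s))) ∧
    Nonempty (LMod n (spinWeight n E 0 (chirSpin n s)) ≃ₗ⁅ℂ, so2 n⁆ confChir n (E : ℂ) s) := by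
  obtain ⟨κ⟩ := exists_kappa hn E s
  obtain ⟨e, -⟩ := exists_NMod_equiv κ
  have hC := confChir_irreducible hn hE s
  have hN := isIrreducible_of_equiv e hC
  refine ⟨hN, (quotient_sumOfProper_equiv hC (e : NMod n _ →ₗ⁅ℂ, so2 n⁆ confChir n (E : ℂ) s)
    e.surjective fun W hW w hw => ?_).2⟩
  have hW' := (IsSimpleOrder.eq_bot_or_eq_top W).resolve_right hW
  rw [hW'] at hw
  rw [(LieSubmodule.mem_bot _).1 hw, map_zero]

theorem LMod_irreducible (hn : 3 ≤ n) {E : ℝ} (hE : ((n : ℝ) - 1) / 2 < E) (s : ℕ) :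
    LieModule.IsIrreducible ℂ (so2 n) (LMod n (spinWeight n E 0 (chirSpin n s))) := by
  obtain ⟨e⟩ := (NMod_LMod_equiv hn hE s).2
  exact isIrreducible_of_equiv e (confChir_irreducible hn hE s)

theorem LMod_unitarizable (hn : 3 ≤ n) {E : ℝ} (hE : ((n : ℝ) - 1) / 2 < E) (s : ℕ) :
    IsUnitarizable n (LMod n (spinWeight n E 0 (chirSpin n s))) := by
  obtain ⟨e⟩ := (NMod_LMod_equiv hn hE s).2
  exact IsUnitarizable.of_equiv e (confChir_unitarizable hn hE s)

/-- The multiples of the position vector, as a submodule at the unitarity bound. -/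
def xsConf {E : ℂ} (hE : 2 * E + 1 = n) (s : ℕ) : LieSubmodule ℂ (so2 n) (confChir n E s) where
  __ := Submodule.comap (confChir n E s).toSubmodule.subtype
    (xsSub n s : Submodule ℂ (ConfMod n E))
  lie_mem {x v} hv := by
    have hv' : toPoly (v : ConfMod n E) ∈ xsSub n s := hv
    exact rhoLin_mem_xsSub hE x hv'

lemma mem_xsConf {E : ℂ} (hE : 2 * E + 1 = n) {s : ℕ} {v : confChir n E s} :
    v ∈ xsConf hE s ↔ toPoly (v : ConfMod n E) ∈ xsSub n s := Iff.rfl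

lemma xsConf_ne_top (hn : 3 ≤ n) {E : ℂ} (hE : 2 * E + 1 = n) (s : ℕ) : xsConf hE s ≠ ⊤ := by
  intro h
  refine xsSub_ne hn s fun F hF => ?_
  have : (⟨F, hF⟩ : confChir n E s) ∈ xsConf hE s := by rw [h]; exact LieSubmodule.mem_top _
  exact this

lemma le_xsConf (hn : 3 ≤ n) {E : ℝ} (hE : 2 * (E : ℂ) + 1 = n) {s : ℕ}
    {N : LieSubmodule ℂ (so2 n) (confChir n (E : ℂ) s)} (hN : N ≠ ⊤) : N ≤ xsConf hE s := by
  rcases stable_le_or hn hE (polySub_le N) (rhoLin_mem_polySub N) with h | h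
  · exact fun v hv => h (mem_polySub.2 hv)
  · exact absurd (eq_top_of_chirSub_le h) hN

/-- Multiplication by the position vector identifies the module above with `xsConf`. -/
lemma xsConf_equiv (hn : 3 ≤ n) {E : ℂ} (hE : 2 * E + 1 = n) (s : ℕ) :
    Nonempty (xsConf hE s ≃ₗ⁅ℂ, so2 n⁆ confChir n (E + 1) (s + 1)) := by
  let f : confChir n (E + 1) (s + 1) →ₗ⁅ℂ, so2 n⁆ xsConf hE s :=
    { toFun := fun v => ⟨⟨xs n (toPoly (v : ConfMod n (E + 1))), xsSub_le s ⟨_, v.2, rfl⟩⟩,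
        ⟨_, v.2, rfl⟩⟩
      map_add' := fun v w => Subtype.ext (Subtype.ext (map_add (xs n) _ _))
      map_smul' := fun c v => Subtype.ext (Subtype.ext (map_smul (xs n) _ _))
      map_lie' := fun {x v} => Subtype.ext (Subtype.ext (rhoLin_xs hE x _).symm) }
  have hf : Function.Bijective (f : confChir n (E + 1) (s + 1) →ₗ[ℂ] xsConf hE s) := by
    constructor
    · intro v w h
      exact Subtype.ext (xs_injective hn (congrArg
        (fun y : xsConf hE s => toPoly ((y : confChir n E s) : ConfMod n E)) h))
    · rintro ⟨v, hv⟩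
      obtain ⟨G, hG, h⟩ := (mem_xsConf hE).1 hv
      exact ⟨⟨G, hG⟩, Subtype.ext (Subtype.ext h)⟩
  exact ⟨LieModuleEquiv.symm { f, LinearEquiv.ofBijective _ hf with }⟩

/-- At the unitarity bound the induced module has a largest proper submodule, which is again an
irreducible module of spinor polynomials. -/
theorem NMod_maximal (hn : 3 ≤ n) {E : ℝ} (hE : 2 * (E : ℂ) + 1 = n) (s : ℕ) :
    ∃ W : LieSubmodule ℂ (so2 n) (NMod n (spinWeight n E 0 (chirSpin n s))),
      W ≠ ⊥ ∧ W ≠ ⊤ ∧ (∀ W', W' ≠ ⊤ → W' ≤ W) ∧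
      Nonempty (W ≃ₗ⁅ℂ, so2 n⁆ confChir n (E + 1 : ℂ) (s + 1)) := by
  obtain ⟨κ⟩ := exists_kappa hn E s
  obtain ⟨e, -⟩ := exists_NMod_equiv κ
  let f : NMod n (spinWeight n E 0 (chirSpin n s)) →ₗ⁅ℂ, so2 n⁆ confChir n (E : ℂ) s := e
  obtain ⟨g⟩ := xsConf_equiv hn hE s
  have hT : (xsConf hE s).comap f ≠ ⊤ := by
    intro h
    apply xsConf_ne_top hn hE s
    rw [eq_top_iff]
    rintro v -
    obtain ⟨m, rfl⟩ := e.surjective v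
    have : m ∈ (xsConf hE s).comap f := by rw [h]; exact LieSubmodule.mem_top _
    exact this
  let r : (xsConf hE s).comap f →ₗ⁅ℂ, so2 n⁆ xsConf hE s :=
    { toFun := fun v => ⟨f v, v.2⟩
      map_add' := fun v w => Subtype.ext (map_add f _ _)
      map_smul' := fun c v => Subtype.ext (map_smul f _ _)
      map_lie' := fun {x v} => Subtype.ext (f.map_lie x _) }
  have hr : Function.Bijective (r : (xsConf hE s).comap f →ₗ[ℂ] xsConf hE s) := by
    constructor
    · intro v w h
      exact Subtype.ext (e.injective (congrArg Subtype.val h))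
    · rintro ⟨v, hv⟩
      obtain ⟨m, rfl⟩ := e.surjective v
      exact ⟨⟨m, hv⟩, rfl⟩
  let r' : (xsConf hE s).comap f ≃ₗ⁅ℂ, so2 n⁆ xsConf hE s :=
    { r, LinearEquiv.ofBijective _ hr with }
  refine ⟨(xsConf hE s).comap f, fun h => ?_, hT, fun W hW => ?_, ⟨r'.trans g⟩⟩
  · have h1 : (⟨hwv hn (s + 1) 0, mem_chirSub.2 (hwv_mem_mono hn (s + 1) 0).2.2⟩ :
        confChir n (E + 1 : ℂ) (s + 1)) ≠ 0 := fun h =>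
      hwv_ne_zero hn (s + 1) 0 (congrArg Subtype.val h)
    obtain ⟨v, hv⟩ := (r'.trans g).surjective
      ⟨hwv hn (s + 1) 0, mem_chirSub.2 (hwv_mem_mono hn (s + 1) 0).2.2⟩
    apply h1
    have hv0 : v = 0 := Subtype.ext ((LieSubmodule.eq_bot_iff _).1 h v v.2)
    rw [← hv, hv0]
    exact map_zero (r'.trans g).toLieModuleHom
  · intro w hw
    refine le_xsConf hn hE (N := W.map f) (fun h => hW ?_) (LieSubmodule.mem_map_of_mem hw)
    rw [eq_top_iff]
    rintro m -
    have : f m ∈ W.map f := by rw [h]; exact LieSubmodule.mem_top _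
    obtain ⟨m', hm', h'⟩ := (LieSubmodule.mem_map _).1 this
    exact e.injective h' ▸ hm'

/-- The Fischer decomposition into irreducible modules of the compact subalgebra. -/
theorem confChir_directSum (hn : 3 ≤ n) (E : ℝ) (s : ℕ) {T : Type} [DecidableEq T]
    (ψ : T → ℕ × ℕ) (hψ : Function.Bijective ψ) (μ : T → Fin (n / 2 + 1) → ℂ)
    (κ : ∀ t, KMod n (μ t) ≃ₗ⁅ℂ, compactK n⁆ compK n (E : ℂ) s (ψ t).1 (ψ t).2) :
    Nonempty (confChir n (E : ℂ) s ≃ₗ⁅ℂ, compactK n⁆ ⨁ t, KMod n (μ t)) := by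
  have hval : ∀ t {u v : compK n (E : ℂ) s (ψ t).1 (ψ t).2}, u = v →
      (u : ConfMod n E) = (v : ConfMod n E) := fun t u v h => congrArg Subtype.val h
  let φ : ∀ t, KMod n (μ t) →ₗ⁅ℂ, compactK n⁆ confChir n (E : ℂ) s := fun t =>
    { toFun := fun u => ⟨κ t u, comp_le_chirSub s _ _ (κ t u).2⟩
      map_add' := fun u v => Subtype.ext (hval t (map_add (κ t).toLieModuleHom u v))
      map_smul' := fun c v => Subtype.ext (hval t (map_smul (κ t).toLieModuleHom c v))
      map_lie' := fun {x v} => Subtype.ext (hval t ((κ t).toLieModuleHom.map_lie x v)) }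
  let ι : confChir n (E : ℂ) s →ₗ[ℂ] Poly n := (confChir n (E : ℂ) s).toSubmodule.subtype
  have hι : Function.Injective ι := Subtype.val_injective
  have hφ : ∀ t u, ι (φ t u) ∈ comp n s (ψ t).1 (ψ t).2 := fun t u => (κ t u).2
  refine lieEquiv_directSum φ ?_ ?_
  · have h : Function.Injective (DirectSum.toModule ℂ T (Poly n) fun t =>
        ι ∘ₗ (φ t : KMod n (μ t) →ₗ[ℂ] confChir n (E : ℂ) s)) := by
      -- One operator separates all components: the imaginary part of its eigenvalue is the degree,
      -- and the real part is the Casimir value, which is injective within each degree.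
      refine toModule_injective_of_eigen _
        (fun t u v h => (κ t).injective (Subtype.ext h))
        (casimir n E + Complex.I • eul n)
        (fun t => (casVal n E (ψ t).1 (ψ t).2 : ℂ) + Complex.I * (((ψ t).1 + (ψ t).2 : ℕ) : ℂ))
        ?_ fun t u => ?_
      · intro t t' h
        apply hψ.1
        have hre := congrArg Complex.re h
        have him := congrArg Complex.im h
        simp only [Complex.add_re, Complex.add_im, Complex.ofReal_re, Complex.ofReal_im,
          Complex.mul_re, Complex.mul_im, Complex.I_re, Complex.I_im, Complex.natCast_re,
          Complex.natCast_im, zero_mul, mul_zero, one_mul, zero_add, sub_zero, add_zero] at hre him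
        have hN : (ψ t).1 + (ψ t).2 = (ψ t').1 + (ψ t').2 := by exact_mod_cast him
        exact congrArg Subtype.val
          (casVal_injective hn E _ (a₁ := ⟨ψ t, hN⟩) (a₂ := ⟨ψ t', rfl⟩) hre)
      · have h := hφ t u
        change (casimir n E + Complex.I • eul n) (ι (φ t u)) = _ • ι (φ t u)
        rw [LinearMap.add_apply, LinearMap.smul_apply, casimir_comp hn E h,
          (comp_le_degSub _ _ _ h).1, smul_smul, add_smul]
    have h' : (DirectSum.toModule ℂ T (Poly n) fun t =>
        ι ∘ₗ (φ t : KMod n (μ t) →ₗ[ℂ] confChir n (E : ℂ) s)) =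
        ι ∘ₗ DirectSum.toModule ℂ T _ fun t =>
          (φ t : KMod n (μ t) →ₗ[ℂ] confChir n (E : ℂ) s) := by
      refine DirectSum.linearMap_ext ℂ fun t => LinearMap.ext fun u => ?_
      rw [LinearMap.comp_apply, LinearMap.comp_apply, LinearMap.comp_apply,
        DirectSum.toModule_lof, DirectSum.toModule_lof]
      rfl
    rw [h', LinearMap.coe_comp] at h
    exact h.of_comp
  · intro v
    have h : (⨆ p : ℕ × ℕ, comp n s p.1 p.2) ≤
        (⨆ t, LinearMap.range (φ t : KMod n (μ t) →ₗ[ℂ] confChir n (E : ℂ) s)).map ι := by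
      refine iSup_le fun p => ?_
      obtain ⟨t, rfl⟩ := hψ.2 p
      intro G hG
      obtain ⟨u, hu⟩ := (κ t).surjective ⟨G, hG⟩
      exact ⟨φ t u, Submodule.mem_iSup_of_mem t ⟨u, rfl⟩, congrArg Subtype.val hu⟩
    obtain ⟨w, hw, hwv⟩ := h (mem_iSup_comp hn v.2)
    exact hι hwv ▸ hw

end Main

end ConformalSpin

end

theorem mainTheorem7 (n : ℕ) (hn : 3 ≤ n) :
    (∀ E₀ : ℝ, ((n : ℝ) - 1) / 2 < E₀ →
      LieModule.IsIrreducible ℂ (ConformalSpin.so2 n)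
        (ConformalSpin.NMod n (ConformalSpin.spinWeight n E₀ 0 (1 / 2))) ∧
      LieModule.IsIrreducible ℂ (ConformalSpin.so2 n)
        (ConformalSpin.LMod n (ConformalSpin.spinWeight n E₀ 0 (1 / 2))) ∧
      Nonempty
        (ConformalSpin.LMod n (ConformalSpin.spinWeight n E₀ 0 (1 / 2))
          ≃ₗ⁅ℂ, ConformalSpin.compactK n⁆
          ⨁ t : (ℕ × ℕ) ⊕ (ℕ × ℕ), ConformalSpin.KMod n
            (Sum.elim
              (fun p : ℕ × ℕ => ConformalSpin.spinWeight n (E₀ + p.1 + 2 * p.2) p.1 (1 / 2))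
              (fun p : ℕ × ℕ => ConformalSpin.spinWeight n (E₀ + p.1 + 2 * p.2 + 1) p.1
                (ConformalSpin.lastSpin n)) t))) ∧
    (¬ LieModule.IsIrreducible ℂ (ConformalSpin.so2 n)
        (ConformalSpin.NMod n (ConformalSpin.spinWeight n (((n : ℝ) - 1) / 2) 0 (1 / 2))) ∧
      ∃ W : LieSubmodule ℂ (ConformalSpin.so2 n)
          (ConformalSpin.NMod n (ConformalSpin.spinWeight n (((n : ℝ) - 1) / 2) 0 (1 / 2))),
        IsCoatom W ∧ (∀ W', W' ≠ ⊤ → W' ≤ W) ∧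
        Nonempty (W ≃ₗ⁅ℂ, ConformalSpin.so2 n⁆
          ConformalSpin.LMod n (ConformalSpin.spinWeight n (((n : ℝ) + 1) / 2) 0
            (ConformalSpin.lastSpin n))) ∧
        LieModule.IsIrreducible ℂ (ConformalSpin.so2 n)
          (ConformalSpin.LMod n (ConformalSpin.spinWeight n (((n : ℝ) + 1) / 2) 0
            (ConformalSpin.lastSpin n))) ∧
        ConformalSpin.IsUnitarizable n
          (ConformalSpin.LMod n (ConformalSpin.spinWeight n (((n : ℝ) + 1) / 2) 0
            (ConformalSpin.lastSpin n))) ∧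
        Nonempty
          ((ConformalSpin.NMod n (ConformalSpin.spinWeight n (((n : ℝ) - 1) / 2) 0 (1 / 2)) ⧸ W)
            ≃ₗ⁅ℂ, ConformalSpin.so2 n⁆
          ConformalSpin.LMod n (ConformalSpin.spinWeight n (((n : ℝ) - 1) / 2) 0 (1 / 2))) ∧
        LieModule.IsIrreducible ℂ (ConformalSpin.so2 n)
          (ConformalSpin.LMod n (ConformalSpin.spinWeight n (((n : ℝ) - 1) / 2) 0 (1 / 2)))) := by
  open ConformalSpin in
  refine ⟨fun E hE => ?_, ?_⟩
  · have hN := NMod_LMod_equiv hn hE 0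
    have hL := LMod_irreducible hn hE 0
    rw [chirSpin_zero] at hN hL
    refine ⟨hN.1, hL, ?_⟩
    obtain ⟨e⟩ := hN.2
    -- The pair is `(j, l)` for the component `x̸^j M_l`. Even powers `j = 2k` start from monogenics
    -- of the original chirality, odd powers `j = 2k + 1` from the opposite one.
    let ψ : (ℕ × ℕ) ⊕ (ℕ × ℕ) → ℕ × ℕ :=
      Sum.elim (fun p => (2 * p.2, p.1)) fun p => (2 * p.2 + 1, p.1)
    have hψ : Function.Bijective ψ := by
      constructor
      · rintro (⟨l, k⟩ | ⟨l, k⟩) (⟨l', k'⟩ | ⟨l', k'⟩) h <;>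
          simp only [ψ, Sum.elim_inl, Sum.elim_inr, Prod.mk.injEq] at h <;>
          simp only [Sum.inl.injEq, Sum.inr.injEq, Prod.mk.injEq, reduceCtorEq] <;> omega
      · rintro ⟨j, l⟩
        rcases Nat.even_or_odd' j with ⟨k, rfl | rfl⟩
        · exact ⟨Sum.inl (l, k), rfl⟩
        · exact ⟨Sum.inr (l, k), rfl⟩
    have hκ : ∀ t : (ℕ × ℕ) ⊕ (ℕ × ℕ), Nonempty (KMod n
        (Sum.elim (fun p : ℕ × ℕ => spinWeight n (E + p.1 + 2 * p.2) p.1 (1 / 2))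
          (fun p : ℕ × ℕ => spinWeight n (E + p.1 + 2 * p.2 + 1) p.1 (lastSpin n)) t)
        ≃ₗ⁅ℂ, compactK n⁆ compK n (E : ℂ) 0 (ψ t).1 (ψ t).2) := by
      intro t
      have hμ : Sum.elim (fun p : ℕ × ℕ => spinWeight n (E + p.1 + 2 * p.2) p.1 (1 / 2))
          (fun p : ℕ × ℕ => spinWeight n (E + p.1 + 2 * p.2 + 1) p.1 (lastSpin n)) t =
          spinWeight n (E + ((ψ t).1 + (ψ t).2)) (ψ t).2 (chirSpin n (0 + (ψ t).1)) := by
        rcases t with ⟨l, k⟩ | ⟨l, k⟩ <;>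
          simp only [ψ, Sum.elim_inl, Sum.elim_inr] <;> congr 1
        · push_cast; ring
        · simp [chirSpin]
        · push_cast; ring
        · simp [chirSpin]
      rw [hμ]
      exact compK_equiv hn E 0 (ψ t).1 (ψ t).2
    obtain ⟨g⟩ := confChir_directSum hn E 0 ψ hψ _ fun t => (hκ t).some
    let e' : LMod n (spinWeight n E 0 (1 / 2)) ≃ₗ⁅ℂ, compactK n⁆ confChir n (E : ℂ) 0 :=
      { e with map_lie' := fun {x v} => e.toLieModuleHom.map_lie (x : so2 n) v }
    exact ⟨e'.trans g⟩
  · have hE : 2 * ((((n : ℝ) - 1) / 2 : ℝ) : ℂ) + 1 = n := by push_cast; ring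
    have hE1 : ((((n : ℝ) - 1) / 2 : ℝ) : ℂ) + 1 = ((((n : ℝ) + 1) / 2 : ℝ) : ℂ) := by
      push_cast; ring
    have hlt : ((n : ℝ) - 1) / 2 < ((n : ℝ) + 1) / 2 := by linarith
    have hM := NMod_maximal hn hE 0
    rw [chirSpin_zero, zero_add, hE1] at hM
    obtain ⟨W, hb, ht, hmax, ⟨e⟩⟩ := hM
    -- The maximal submodule is the conformal module of the opposite chirality with parameter
    -- `(n+1)/2`. This lies strictly above the bound, so the results there give its irreducibility
    -- and unitarity.
    have hN := (NMod_LMod_equiv hn hlt 1).2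
    have hL := LMod_irreducible hn hlt 1
    have hU := LMod_unitarizable hn hlt 1
    rw [chirSpin_one] at hN hL hU
    obtain ⟨e'⟩ := hN
    have hW := sumOfProper_eq_of_forall_le ht hmax
    refine ⟨fun h => ?_, W, ⟨ht, fun W' hW' => ?_⟩, hmax, ⟨e.trans e'.symm⟩, hL, hU, ?_, ?_⟩
    · exact (IsSimpleOrder.eq_bot_or_eq_top W).elim hb ht
    · by_contra hne
      exact hW'.not_ge (hmax W' hne)
    · subst hW
      exact ⟨LieModuleEquiv.refl⟩
    · exact quotient_sumOfProper_irreducible (by rw [hW]; exact ht)
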